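/- There is an algorithm with the following property. Let $G$ be an undirected, unweighted, connected graph on $n\ge 1$ vertices (given by its adjacency matrix), let $C$ be the cycle on $N\ge 3$ vertices $0,1,\dots,N-1$ in cyclic order (given by the number $N$), and let $d\ge 1$ be an integer. Call a map $F:V(G)\to V(C)$ a non-contracting distortion-$d$ embedding of $G$ into $C$ if $$D_G(u,v)\ \le\ D_C(F(u),F(v))\ \le\ d\cdot D_G(u,v)\qquad\text{for all } u,v\in V(G),$$ where $D_G$ and $D_C$ are the shortest-path distances. On input $(G,C,d)$ the algorithm outputs a non-contracting distortion-$d$ embedding of $G$ into $C$ if one exists, and otherwise reports that none exists. Its running time is $$O\left(n^3\cdot d^{2d+3}\cdot (4d(2d+2))^{4d+4}\right),$$ with an absolute constant, independent of $N$. Here time is the number of steps of a word RAM with unit-cost addition, subtraction, multiplication, division, comparison and indirect addressing, on words of any length sufficient to hold the sum of $N$ and the time bound. In particular the problem is fixed-parameter tractable with parameter $d$: it is solved in time $f(d)\cdot n^{k}$ for a computable function $f$ and a constant $k$. -/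

import Mathlib

/-- `F` is a non-contracting embedding of distortion (at most) `d` of the shortest-path metric of
`G` into the shortest-path metric of `H` (used for connected graphs `G` and `H`). -/
def IsNonContractingEmbedding {V V' : Type*} (G : SimpleGraph V) (H : SimpleGraph V') (d : ℕ)
    (F : V → V') : Prop :=
  ∀ u v : V, G.dist u v ≤ H.dist (F u) (F v) ∧ H.dist (F u) (F v) ≤ d * G.dist u v

namespace WordRAM

/-- Instructions of a word RAM. Register operands and jump targets are literals of the program. -/
inductive Instr : Type
  /-- `const r k`: put the literal `k` into register `r`. -/
  | const (r k : ℕ) : Instr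
  /-- `add r x y`: put the sum of registers `x` and `y` into register `r`. -/
  | add (r x y : ℕ) : Instr
  /-- `sub r x y`: truncated subtraction. -/
  | sub (r x y : ℕ) : Instr
  /-- `mul r x y`: multiplication. -/
  | mul (r x y : ℕ) : Instr
  /-- `div r x y`: division with rounding down (with result `0` if the divisor is `0`). -/
  | div (r x y : ℕ) : Instr
  /-- `load r x`: put the memory cell addressed by register `x` into register `r`. -/
  | load (r x : ℕ) : Instr
  /-- `store x y`: put register `y` into the memory cell addressed by register `x`. -/
  | store (x y : ℕ) : Instr
  /-- `jmp l`: continue with instruction number `l`. -/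
  | jmp (l : ℕ) : Instr
  /-- `jlt x y l`: if register `x` is less than register `y`, continue with instruction `l`. -/
  | jlt (x y l : ℕ) : Instr
  /-- `jeq x y l`: if registers `x` and `y` are equal, continue with instruction `l`. -/
  | jeq (x y l : ℕ) : Instr

/-- A program is a finite list of instructions, numbered from `0`. -/
abbrev Program : Type := List Instr

/-- A configuration: program counter, registers and memory. -/
structure Config : Type where
  /-- number of the next instruction -/
  pc : ℕ
  /-- contents of the registers -/
  reg : ℕ → ℕ
  /-- contents of the memory cells -/
  mem : ℕ → ℕ

/-- Assign the value `x`, reduced to a word of `w` bits, to register `r`, and go on to the next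
instruction. -/
def Config.assign (w : ℕ) (s : Config) (r x : ℕ) : Config :=
  { s with pc := s.pc + 1, reg := Function.update s.reg r (x % 2 ^ w) }

/-- The effect of one instruction on a machine with words of `w` bits. -/
def Instr.exec (w : ℕ) (s : Config) : Instr → Config
  | .const r k => s.assign w r k
  | .add r x y => s.assign w r (s.reg x + s.reg y)
  | .sub r x y => s.assign w r (s.reg x - s.reg y)
  | .mul r x y => s.assign w r (s.reg x * s.reg y)
  | .div r x y => s.assign w r (s.reg x / s.reg y)
  | .load r x => s.assign w r (s.mem (s.reg x))
  | .store x y => { s with pc := s.pc + 1, mem := Function.update s.mem (s.reg x) (s.reg y) }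
  | .jmp l => { s with pc := l }
  | .jlt x y l => { s with pc := if s.reg x < s.reg y then l else s.pc + 1 }
  | .jeq x y l => { s with pc := if s.reg x = s.reg y then l else s.pc + 1 }

/-- A configuration is halted if there is no instruction with the number `pc`. -/
def Halted (P : Program) (s : Config) : Prop := P.length ≤ s.pc

/-- One step of the program `P`; it does nothing in a halted configuration. -/
def step (P : Program) (w : ℕ) (s : Config) : Config :=
  match P[s.pc]? with
  | some i => i.exec w s
  | none => s

/-- The configuration after `t` steps, from a given initial memory and with all registers `0`. -/
def run (P : Program) (w : ℕ) (m : ℕ → ℕ) (t : ℕ) : Config :=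
  (step P w)^[t] { pc := 0, reg := fun _ => 0, mem := m }

end WordRAM

open Classical in
/-- The initial memory for the instance consisting of the graph `G` on `{0, …, n - 1}`, the cycle
on `N` vertices and the number `d`: cells `0, 1, 2` hold `n, N, d`, they are followed by the
adjacency matrix of `G`, row by row, and all other cells hold `0`. -/
noncomputable def inputMemory {n : ℕ} (G : SimpleGraph (Fin n)) (N d : ℕ) : ℕ → ℕ := fun a =>
  if a = 0 then n
  else if a = 1 then N
  else if a = 2 then d
  else if ∃ u v : Fin n, a = 3 + n * u.val + v.val ∧ G.Adj u v then 1
  else 0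

/-- The memory `m` holds a correct answer for the instance: cell `0` holds `1` and the cells
`1, …, n` hold the values of a non-contracting distortion `d` embedding of `G` into the cycle on
`{0, …, N - 1}`, or cell `0` holds `0` and there is no such embedding. -/
def IsCorrectAnswer {n : ℕ} (G : SimpleGraph (Fin n)) (N d : ℕ) (m : ℕ → ℕ) : Prop :=
  (m 0 = 1 ∧ ∃ F : Fin n → Fin N,
      IsNonContractingEmbedding G (SimpleGraph.cycleGraph N) d F ∧
      ∀ v : Fin n, m (1 + v.val) = (F v).val) ∨
  (m 0 = 0 ∧ ¬ ∃ F : Fin n → Fin N,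
      IsNonContractingEmbedding G (SimpleGraph.cycleGraph N) d F)

/-- The program `P` solves the problem of finding non-contracting embeddings into cycles within
`t n d` steps, where `n` is the number of vertices of the input graph and `d` is the distortion.
It does so on every machine whose words are long enough to hold the number `N` of vertices of the
cycle and the time bound, that is, to address the memory cells that can be used. -/
def SolvesCycleEmbedding (P : WordRAM.Program) (t : ℕ → ℕ → ℕ) : Prop :=
  ∀ (n N d w : ℕ) (G : SimpleGraph (Fin n)), G.Connected → 3 ≤ N → 1 ≤ d →
    t n d + N ≤ 2 ^ w →
    ∃ s ≤ t n d, WordRAM.Halted P (WordRAM.run P w (inputMemory G N d) s) ∧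
      IsCorrectAnswer G N d (WordRAM.run P w (inputMemory G N d) s).mem

/-- The problem is fixed-parameter tractable with parameter `d`: some program solves it in time
`f d * n ^ k` for a computable function `f` and a constant `k`. -/
def CycleEmbeddingFPT : Prop :=
  ∃ (P : WordRAM.Program) (f : ℕ → ℕ) (k : ℕ), Computable f ∧
    SolvesCycleEmbedding P (fun n d => f d * n ^ k)

/-!
# Embeddings of graphs into cycles by a search for closed trails of windows

Let `G` be a connected graph on `n` vertices. An embedding into the cycle with `N` vertices places
the vertices of `G` one after the other around the cycle. The idea is to sweep over the cycle with a
window that shows the vertex placed last and the `2 * d` positions before it. Whether an arrangement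
is an embedding of distortion `d` can be decided by looking at the windows alone: it is
non-contracting if consecutive vertices are at least as far apart as in `G` (the triangle inequality
gives the rest), and it stretches distances at most by `d` if the two ends of every edge are at most
`d` positions apart (`embedding_of_edges`), so that all neighbours of a vertex have to be in the
window when the vertex gets out of reach. This is the condition `WindowOk` on a single move of the
window.

A window may forget whether a vertex has been placed before, and so the search is for sequences of
moves in which vertices can be repeated. A `ClosedTrail` is such a sequence that returns to its first
window after one turn around the cycle. The set of the vertices that it visits is closed under taking
neighbours, by `ClosedTrail.exists_near`, and therefore contains all vertices, as `G` is connected.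
Hence it has at least `n` moves (`ClosedTrail.card_le`), and with exactly `n` moves no vertex is
repeated and the positions are an embedding (`ClosedTrail.exists_embedding`). Conversely, every
embedding gives a closed trail with `n` moves, and it can be rotated such that all gaps are at most
`d`, except for the last one that closes the trail (`exists_closedTrail`). So an embedding exists if
and only if there is a closed trail with `n` moves, and this is a shortest one.

A window is coded by its last vertex and `2 * d` digits in the base `B = 4 * d * (2 * d + 2)`, which
say how to get from each vertex of the window to the one before it: a nonzero digit is the number of
a vertex in the ball of radius `d` around the current one. If `G` has an embedding, then such a ball
has at most `2 * d * d + 1` vertices, because its image lies in an arc (`rank_le_of_embedding`); so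
the answer is negative if some ball has `B` vertices or more (`numberBalls_spec`).
For each of the `n * S` first windows, where `S = B ^ (2 * d)`, a dynamic program finds the least
number of vertices with which a cell, that is, a window with the position of its last vertex, can be
reached (`Reached`). Edges between cells increase the position, so one pass over the cells in
increasing order is enough (`reachPass_spec`). As gaps are at most `d`, positions are smaller than
`n * d`; this makes the number of cells, `n * d * (n * S)`, independent of `N`, which is only compared
with positions and gives the length of the last move. The answer is positive if a cell that is reached with `n` vertices can
be closed up (`mainPart_spec`). There are `d * B` moves from every cell, and the test of a move takes
`O(d ^ 2 * B)` steps, so that the time is `O(n ^ 3 * d ^ 2 * S ^ 2 * B ^ 4)`, and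
`S ^ 2 * B ^ 4 = B ^ (4 * d + 4)` (`mainPart_time_le`).

The program is written in a structured language with expressions, conditionals and bounded loops.
The language has a denotational semantics `Com.den`, in which the algorithm is verified, and is
compiled to the word RAM, with a running time that is determined by the bounds of the loops
(`Com.spec`, `Com.time_le`). Sums and products are reduced modulo the word size; `Sizes` collects the
inequalities that exclude overflows, and they follow from the assumption that words can hold the time
bound and `N` (`sizes_of_bound_le`).
-/

set_option linter.constructorNameAsVariable false

/-! ### A structured language for the word RAM -/

namespace CycleEmbedding

open WordRAM

/-- Arithmetic expressions over variables of type `ν` and memory cells. -/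
inductive Exp (ν : Type) : Type
  | var (v : ν) : Exp ν
  | lit (k : ℕ) : Exp ν
  | add (a b : Exp ν) : Exp ν
  | sub (a b : Exp ν) : Exp ν
  | mul (a b : Exp ν) : Exp ν
  | div (a b : Exp ν) : Exp ν
  | lt (a b : Exp ν) : Exp ν
  | eq (a b : Exp ν) : Exp ν
  | load (a : Exp ν) : Exp ν

/-- Structured commands. The command `loop i b c` runs `c` with `i = 0, 1, …, b - 1`, where `i` and
`b` are variables that `c` leaves alone. -/
inductive Com (ν : Type) : Type
  | skip : Com ν
  | assign (v : ν) (e : Exp ν) : Com ν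
  | store (a e : Exp ν) : Com ν
  | seq (c₁ c₂ : Com ν) : Com ν
  | ite (e : Exp ν) (c₁ c₂ : Com ν) : Com ν
  | loop (i b : ν) (c : Com ν) : Com ν

/-- A state of a structured program: the values of the variables and the memory. -/
@[ext] structure St (ν : Type) : Type where
  /-- values of the variables -/
  reg : ν → ℕ
  /-- contents of the memory cells -/
  mem : ℕ → ℕ

variable {ν : Type}

/-- Give the variable `v` the value `x`. -/
def St.set [DecidableEq ν] (s : St ν) (v : ν) (x : ℕ) : St ν :=
  { s with reg := Function.update s.reg v x }

@[simp] theorem St.set_mem [DecidableEq ν] (s : St ν) (v : ν) (x : ℕ) : (s.set v x).mem = s.mem := rfl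

theorem St.set_reg [DecidableEq ν] (s : St ν) (v u : ν) (x : ℕ) :
    (s.set v x).reg u = if u = v then x else s.reg u := by
  simp [St.set, Function.update_apply]

/-- The value of an expression. Sums and products are reduced modulo `L`, which is `2 ^ w` on a
machine with words of `w` bits; the other operations cannot leave the range of a word. -/
def Exp.eval (L : ℕ) (s : St ν) : Exp ν → ℕ
  | .var v => s.reg v
  | .lit k => k
  | .add a b => (a.eval L s + b.eval L s) % L
  | .sub a b => a.eval L s - b.eval L s
  | .mul a b => (a.eval L s * b.eval L s) % L
  | .div a b => a.eval L s / b.eval L s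
  | .lt a b => if a.eval L s < b.eval L s then 1 else 0
  | .eq a b => if a.eval L s = b.eval L s then 1 else 0
  | .load a => s.mem (a.eval L s)

section

variable [DecidableEq ν]

/-- The states at the head of a loop with index `i` and body `f`, started in the state `s`. -/
def loopState (i : ν) (f : St ν → St ν) (s : St ν) : ℕ → St ν
  | 0 => s.set i 0
  | k + 1 => (f (loopState i f s k)).set i (k + 1)

/-- The state after the execution of a command. -/
def Com.den (L : ℕ) : Com ν → St ν → St ν
  | .skip, s => s
  | .assign v e, s => s.set v (e.eval L s)
  | .store a e, s => { s with mem := Function.update s.mem (a.eval L s) (e.eval L s) }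
  | .seq c₁ c₂, s => c₂.den L (c₁.den L s)
  | .ite e c₁ c₂, s => if e.eval L s = 0 then c₂.den L s else c₁.den L s
  | .loop i b c, s => loopState i (c.den L) s (s.reg b)

/-- The variables a command may change. -/
def Com.writes : Com ν → List ν
  | .skip => []
  | .assign v _ => [v]
  | .store _ _ => []
  | .seq c₁ c₂ => c₁.writes ++ c₂.writes
  | .ite _ c₁ c₂ => c₁.writes ++ c₂.writes
  | .loop i _ c => i :: c.writes

theorem loopState_reg {i v : ν} {f : St ν → St ν} (hv : v ≠ i)
    (hf : ∀ s, (f s).reg v = s.reg v) (s : St ν) (k : ℕ) :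
    (loopState i f s k).reg v = s.reg v := by
  induction k with
  | zero => simp [loopState, St.set_reg, hv]
  | succ k ih => simp [loopState, St.set_reg, hv, hf, ih]

theorem loopState_reg_self {i : ν} {f : St ν → St ν} (s : St ν) (k : ℕ) :
    (loopState i f s k).reg i = k := by
  cases k <;> simp [loopState, St.set_reg]

theorem Com.den_reg (L : ℕ) (c : Com ν) {v : ν} (hv : v ∉ c.writes) (s : St ν) :
    (c.den L s).reg v = s.reg v := by
  induction c generalizing s with
  | skip => rfl
  | assign u e => simp [Com.writes] at hv; simp [Com.den, St.set_reg, hv]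
  | store a e => rfl
  | seq c₁ c₂ h₁ h₂ =>
    simp [Com.writes] at hv
    simp [Com.den, h₁ hv.1, h₂ hv.2]
  | ite e c₁ c₂ h₁ h₂ =>
    simp [Com.writes] at hv
    simp only [Com.den]
    split
    · exact h₂ hv.2 s
    · exact h₁ hv.1 s
  | loop i b c h =>
    simp [Com.writes] at hv
    exact loopState_reg hv.1 (h hv.2) s _

/-- The invariant rule for loops. -/
theorem Com.den_loop {L : ℕ} {i b : ν} {c : Com ν} {s : St ν} (I : ℕ → St ν → Prop)
    (hI : ∀ k s x, I k s → I k (s.set i x)) (h0 : I 0 s)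
    (hs : ∀ k s', k < s.reg b → s'.reg i = k →
      (∀ v, v ∉ (Com.loop i b c).writes → s'.reg v = s.reg v) → I k s' → I (k + 1) (c.den L s')) :
    I (s.reg b) ((Com.loop i b c).den L s) := by
  have key : ∀ k, k ≤ s.reg b → I k (loopState i (c.den L) s k) := by
    intro k
    induction k with
    | zero => intro _; exact hI _ _ _ h0
    | succ k ih =>
      intro hk
      refine hI _ _ _ (hs k _ hk (loopState_reg_self s k) ?_ (ih (by omega)))
      intro v hv
      simp [Com.writes] at hv
      exact loopState_reg hv.1 (c.den_reg L hv.2) s k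
  exact key _ le_rfl

end

/-- All literals are at most `8`, so that they fit into a word. -/
def Exp.small : Exp ν → Bool
  | .var _ => true
  | .lit k => decide (k ≤ 8)
  | .add a b => a.small && b.small
  | .sub a b => a.small && b.small
  | .mul a b => a.small && b.small
  | .div a b => a.small && b.small
  | .lt a b => a.small && b.small
  | .eq a b => a.small && b.small
  | .load a => a.small

/-- A syntactic condition on commands: the bounds of loops are among the variables in `par`, no
variable in `par` is changed, and the index of a loop is not changed by its body. -/
def Com.ok [DecidableEq ν] (par : ν → Bool) : Com ν → Bool
  | .skip => true
  | .assign v e => !par v && e.small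
  | .store a e => a.small && e.small
  | .seq c₁ c₂ => c₁.ok par && c₂.ok par
  | .ite e c₁ c₂ => e.small && (c₁.ok par && c₂.ok par)
  | .loop i b c => !par i && (par b && (!decide (i ∈ c.writes) && c.ok par))

/-- Variables in `par` keep their values. -/
theorem Com.not_mem_writes [DecidableEq ν] {par : ν → Bool} {c : Com ν}
    (hc : c.ok par) {v : ν} (hv : par v) : v ∉ c.writes := by
  induction c with
  | skip => simp [Com.writes]
  | assign u e =>
    simp [Com.ok] at hc
    simp only [Com.writes, List.mem_singleton]
    rintro rfl
    simp [hv] at hc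
  | store a e => simp [Com.writes]
  | seq c₁ c₂ h₁ h₂ => simp [Com.ok] at hc; simp [Com.writes, h₁ hc.1, h₂ hc.2]
  | ite e c₁ c₂ h₁ h₂ => simp [Com.ok] at hc; simp [Com.writes, h₁ hc.2.1, h₂ hc.2.2]
  | loop i b c h =>
    simp [Com.ok] at hc
    simp only [Com.writes, List.mem_cons, not_or]
    refine ⟨?_, h hc.2.2.2⟩
    rintro rfl
    simp [hv] at hc

/-! ### Compilation and running time -/

/-- The number of instructions of a compiled expression. -/
def Exp.len : Exp ν → ℕ
  | .var _ => 2
  | .lit _ => 1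
  | .add a b => a.len + b.len + 1
  | .sub a b => a.len + b.len + 1
  | .mul a b => a.len + b.len + 1
  | .div a b => a.len + b.len + 1
  | .lt a b => a.len + b.len + 4
  | .eq a b => a.len + b.len + 4
  | .load a => a.len + 1

/-- Code at address `o` that computes an expression into register `t`, with the registers above `t`
for intermediate results. -/
def Exp.code (loc : ν → ℕ) (o t : ℕ) : Exp ν → List Instr
  | .var v => [.const t 0, .add t t (loc v)]
  | .lit k => [.const t k]
  | .add a b => a.code loc o t ++ (b.code loc (o + a.len) (t + 1) ++ [.add t t (t + 1)])
  | .sub a b => a.code loc o t ++ (b.code loc (o + a.len) (t + 1) ++ [.sub t t (t + 1)])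
  | .mul a b => a.code loc o t ++ (b.code loc (o + a.len) (t + 1) ++ [.mul t t (t + 1)])
  | .div a b => a.code loc o t ++ (b.code loc (o + a.len) (t + 1) ++ [.div t t (t + 1)])
  | .lt a b => a.code loc o t ++ (b.code loc (o + a.len) (t + 1) ++
      [.jlt t (t + 1) (o + a.len + b.len + 3), .const t 0, .jmp (o + a.len + b.len + 4),
        .const t 1])
  | .eq a b => a.code loc o t ++ (b.code loc (o + a.len) (t + 1) ++
      [.jeq t (t + 1) (o + a.len + b.len + 3), .const t 0, .jmp (o + a.len + b.len + 4),
        .const t 1])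
  | .load a => a.code loc o t ++ [.load t t]

theorem Exp.length_code (loc : ν → ℕ) (e : Exp ν) (o t : ℕ) : (e.code loc o t).length = e.len := by
  induction e generalizing o t <;> simp_all [Exp.code, Exp.len] <;> omega

/-- The number of instructions of a compiled command. -/
def Com.len : Com ν → ℕ
  | .skip => 0
  | .assign _ e => e.len + 2
  | .store a e => a.len + (e.len + 1)
  | .seq c₁ c₂ => c₁.len + c₂.len
  | .ite e c₁ c₂ => e.len + (2 + (c₁.len + (1 + c₂.len)))
  | .loop _ _ c => 3 + (c.len + 3)

/-- Code at address `o` for a command. The variable `v` is kept in register `loc v`; the registers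
from `t` on are used for intermediate results. -/
def Com.code (loc : ν → ℕ) (t : ℕ) (o : ℕ) : Com ν → List Instr
  | .skip => []
  | .assign v e => e.code loc o t ++ [.const (loc v) 0, .add (loc v) (loc v) t]
  | .store a e => a.code loc o t ++ (e.code loc (o + a.len) (t + 1) ++ [.store t (t + 1)])
  | .seq c₁ c₂ => c₁.code loc t o ++ c₂.code loc t (o + c₁.len)
  | .ite e c₁ c₂ => e.code loc o t ++
      ([.const (t + 1) 0, .jeq t (t + 1) (o + e.len + 2 + c₁.len + 1)] ++
        (c₁.code loc t (o + e.len + 2) ++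
          ([.jmp (o + e.len + 2 + c₁.len + 1 + c₂.len)] ++
            c₂.code loc t (o + e.len + 2 + c₁.len + 1))))
  | .loop i b c =>
      [.const (loc i) 0, .jlt (loc i) (loc b) (o + 3), .jmp (o + 3 + c.len + 3)] ++
        (c.code loc t (o + 3) ++ [.const t 1, .add (loc i) (loc i) t, .jmp (o + 1)])

theorem Com.length_code (loc : ν → ℕ) (t : ℕ) (c : Com ν) (o : ℕ) :
    (c.code loc t o).length = c.len := by
  induction c generalizing o <;> simp_all [Com.code, Com.len, Exp.length_code] <;> omega

/-- A bound for the running time of a command, in terms of the values of the bounds of loops. -/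
def Com.time (ρ : ν → ℕ) : Com ν → ℕ
  | .skip => 0
  | .assign _ e => e.len + 2
  | .store a e => a.len + (e.len + 1)
  | .seq c₁ c₂ => c₁.time ρ + c₂.time ρ
  | .ite e c₁ c₂ => e.len + 3 + (c₁.time ρ + c₂.time ρ)
  | .loop _ b c => ρ b * (c.time ρ + 4) + 3

/-- The running time depends on the parameters only. -/
theorem Com.time_congr [DecidableEq ν] {par : ν → Bool} {c : Com ν} (hc : c.ok par) {ρ σ : ν → ℕ}
    (h : ∀ v, par v → ρ v = σ v) : c.time ρ = c.time σ := by
  induction c with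
  | skip => rfl
  | assign u e => rfl
  | store a e => rfl
  | seq c₁ c₂ h₁ h₂ => simp [Com.ok] at hc; simp [Com.time, h₁ hc.1, h₂ hc.2]
  | ite e c₁ c₂ h₁ h₂ => simp [Com.ok] at hc; simp [Com.time, h₁ hc.2.1, h₂ hc.2.2]
  | loop i b c ih => simp [Com.ok] at hc; simp [Com.time, ih hc.2.2.2, h b hc.2.1]

/-- The program `P` leads from one configuration to another in at most `k` steps. -/
def Steps (P : Program) (w k : ℕ) (s s' : Config) : Prop := ∃ t ≤ k, (step P w)^[t] s = s'

theorem Steps.refl (P : Program) (w : ℕ) (s : Config) : Steps P w 0 s s := ⟨0, le_rfl, rfl⟩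

theorem Steps.trans {P : Program} {w k l : ℕ} {s s' s'' : Config} (h : Steps P w k s s')
    (h' : Steps P w l s' s'') : Steps P w (k + l) s s'' := by
  obtain ⟨t, ht, rfl⟩ := h
  obtain ⟨t', ht', rfl⟩ := h'
  exact ⟨t' + t, by omega, Function.iterate_add_apply _ _ _ _⟩

theorem Steps.mono {P : Program} {w k l : ℕ} {s s' : Config} (h : Steps P w k s s') (hkl : k ≤ l) :
    Steps P w l s s' := by
  obtain ⟨t, ht, rfl⟩ := h
  exact ⟨t, ht.trans hkl, rfl⟩

theorem Steps.one {P : Program} {w : ℕ} {s : Config} {i : Instr} (h : P[s.pc]? = some i) :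
    Steps P w 1 s (i.exec w s) := ⟨1, le_rfl, by simp [step, h]⟩

theorem Steps.cons {P : Program} {w k : ℕ} {s s' : Config} {i : Instr} (h : P[s.pc]? = some i)
    (h' : Steps P w k (i.exec w s) s') : Steps P w (k + 1) s s' :=
  ((Steps.one h).trans h').mono (by omega)

/-- The list of instructions `l` stands at address `o` of the program `P`. -/
def CodeAt (P : Program) (o : ℕ) (l : List Instr) : Prop :=
  ∀ k i, l[k]? = some i → P[o + k]? = some i

theorem CodeAt.left {P : Program} {o : ℕ} {l l' : List Instr} (h : CodeAt P o (l ++ l')) :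
    CodeAt P o l := by
  intro k i hk
  refine h k i ?_
  rw [List.getElem?_append_left]
  · exact hk
  · exact (List.getElem?_eq_some_iff.1 hk).1

theorem CodeAt.right {P : Program} {o : ℕ} {l l' : List Instr} (h : CodeAt P o (l ++ l')) :
    CodeAt P (o + l.length) l' := by
  intro k i hk
  rw [add_assoc]
  refine h _ i ?_
  rw [List.getElem?_append_right (by omega)]
  simpa using hk

/-- A word fits into every register and every memory cell. -/
def Bounded (L : ℕ) (s : Config) : Prop := (∀ r, s.reg r < L) ∧ ∀ a, s.mem a < L

theorem Bounded.assign {w : ℕ} {s : Config} (h : Bounded (2 ^ w) s) (r x : ℕ) :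
    Bounded (2 ^ w) (s.assign w r x) := by
  refine ⟨fun r' => ?_, h.2⟩
  simp only [Config.assign, Function.update_apply]
  split
  · exact Nat.mod_lt _ (by positivity)
  · exact h.1 r'

/-- The configuration `s` represents the state `σ` of a structured program. -/
def Represents (loc : ν → ℕ) (s : Config) (σ : St ν) : Prop :=
  (∀ v, s.reg (loc v) = σ.reg v) ∧ s.mem = σ.mem

theorem CodeAt.head {P : Program} {o : ℕ} {i : Instr} {l : List Instr} {s : Config}
    (h : CodeAt P o (i :: l)) (hs : s.pc = o) : P[s.pc]? = some i := by
  simpa [hs] using h 0 i rfl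

theorem CodeAt.tail {P : Program} {o : ℕ} {i : Instr} {l : List Instr}
    (h : CodeAt P o (i :: l)) : CodeAt P (o + 1) l :=
  CodeAt.right (l := [i]) h

@[simp] theorem assign_pc (w : ℕ) (s : Config) (r x : ℕ) : (s.assign w r x).pc = s.pc + 1 := rfl

@[simp] theorem assign_mem (w : ℕ) (s : Config) (r x : ℕ) : (s.assign w r x).mem = s.mem := rfl

theorem assign_reg (w : ℕ) (s : Config) (r x r' : ℕ) :
    (s.assign w r x).reg r' = if r' = r then x % 2 ^ w else s.reg r' := by
  simp [Config.assign, Function.update_apply]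

/-- A run of `k` steps from `s` that moves the program counter from `o` to `o + k`, puts `x` into
register `t` and leaves the registers below `t` and the memory alone. -/
def Computes (P : Program) (w o t k x : ℕ) (s : Config) : Prop :=
  ∃ s', Steps P w k s s' ∧ s'.pc = o + k ∧ s'.reg t = x ∧
    (∀ r < t, s'.reg r = s.reg r) ∧ s'.mem = s.mem ∧ Bounded (2 ^ w) s'

/-- Two values computed one after the other, together with the code that follows. -/
def Computes₂ (P : Program) (w o t k x y : ℕ) (l : List Instr) (s : Config) : Prop :=
  ∃ s', Steps P w k s s' ∧ s'.pc = o + k ∧ s'.reg t = x ∧ s'.reg (t + 1) = y ∧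
    (∀ r < t, s'.reg r = s.reg r) ∧ s'.mem = s.mem ∧ Bounded (2 ^ w) s' ∧ CodeAt P (o + k) l

theorem Computes.pair {P : Program} {w : ℕ} {loc : ν → ℕ} {σ : St ν} {a b : Exp ν} {o t : ℕ}
    {l : List Instr} {s : Config} (hloc : ∀ v, loc v < t)
    (iha : CodeAt P o (a.code loc o t) → Computes P w o t a.len (a.eval (2 ^ w) σ) s)
    (ihb : ∀ s, CodeAt P (o + a.len) (b.code loc (o + a.len) (t + 1)) → s.pc = o + a.len →
      Bounded (2 ^ w) s → Represents loc s σ →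
      Computes P w (o + a.len) (t + 1) b.len (b.eval (2 ^ w) σ) s)
    (hP : CodeAt P o (a.code loc o t ++ (b.code loc (o + a.len) (t + 1) ++ l)))
    (hr : Represents loc s σ) :
    Computes₂ P w o t (a.len + b.len) (a.eval (2 ^ w) σ) (b.eval (2 ^ w) σ) l s := by
  obtain ⟨s₁, h₁, p₁, r₁, f₁, m₁, b₁⟩ := iha hP.left
  have hP' := hP.right
  rw [Exp.length_code] at hP'
  obtain ⟨s₂, h₂, p₂, r₂, f₂, m₂, b₂⟩ := ihb s₁ hP'.left p₁ b₁
    ⟨fun v => (f₁ _ (hloc v)).trans (hr.1 v), m₁.trans hr.2⟩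
  have hP'' := hP'.right
  rw [Exp.length_code, add_assoc] at hP''
  exact ⟨s₂, h₁.trans h₂, by omega, (f₂ t (by omega)).trans r₁, r₂,
    fun r hr => (f₂ r (by omega)).trans (f₁ r hr), m₂.trans m₁, b₂, hP''⟩

/-- An arithmetic instruction applied to two computed values. -/
theorem Computes₂.op {P : Program} {w o t k x y z : ℕ} {i : Instr} {s : Config}
    (h : Computes₂ P w o t k x y [i] s)
    (hi : ∀ s₁ : Config, s₁.reg t = x → s₁.reg (t + 1) = y → i.exec w s₁ = s₁.assign w t z) :
    Computes P w o t (k + 1) (z % 2 ^ w) s := by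
  obtain ⟨s₁, h₁, p, rx, ry, f, m, b, hc⟩ := h
  refine ⟨_, h₁.trans (.one (hc.head p)), ?_, ?_, ?_, ?_, ?_⟩ <;> rw [hi s₁ rx ry]
  · simp; omega
  · simp [assign_reg]
  · intro r hr
    simp [assign_reg, hr.ne, f r hr]
  · exact m
  · exact b.assign _ _

/-- The code of a comparison: the conditional jump `i` selects the result `0` or `1`. -/
theorem Computes₂.test {P : Program} {w o t k q x y : ℕ} (hw : 1 < 2 ^ w) {c : Prop} [Decidable c]
    {i : Instr} {s : Config}
    (h : Computes₂ P w o t k x y [i, .const t 0, .jmp (q + 4), .const t 1] s) (hq : q = o + k)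
    (hi : ∀ s₁ : Config, s₁.reg t = x → s₁.reg (t + 1) = y →
      i.exec w s₁ = { s₁ with pc := if c then q + 3 else s₁.pc + 1 }) :
    Computes P w o t (k + 4) (if c then 1 else 0) s := by
  obtain ⟨s₁, h₁, p, rx, ry, f, m, b, hl⟩ := h
  subst hq
  have e₁ := hi s₁ rx ry
  by_cases hc : c
  · refine ⟨Config.assign w { s₁ with pc := o + k + 3 } t 1, ?_, ?_, ?_, ?_, ?_, ?_⟩
    · refine (h₁.trans (Steps.cons (hl.head p) (k := 1) ?_)).mono (by omega)
      rw [e₁, if_pos hc]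
      exact Steps.one (hl.tail.tail.tail.head rfl)
    · simp; omega
    · simp [assign_reg, hc, Nat.mod_eq_of_lt hw]
    · intro r hr
      simp [assign_reg, hr.ne, f r hr]
    · exact m
    · exact Bounded.assign ⟨b.1, b.2⟩ _ _
  · refine ⟨{ (s₁.assign w t 0) with pc := o + k + 4 }, ?_, ?_, ?_, ?_, ?_, ?_⟩
    · refine (h₁.trans (Steps.cons (hl.head p) (k := 2) ?_)).mono (by omega)
      rw [e₁, if_neg hc]
      refine Steps.cons (hl.tail.head ?_) (Steps.one (hl.tail.tail.head ?_))
      · simp [p]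
      · simp [Instr.exec, p]
    · simp; omega
    · simp [assign_reg, hc]
    · intro r hr
      simp [assign_reg, hr.ne, f r hr]
    · exact m
    · exact ⟨(b.assign _ _).1, b.2⟩

/-- The correctness of compiled expressions. -/
theorem Exp.computes {P : Program} {w : ℕ} (hw : 8 < 2 ^ w) {loc : ν → ℕ} {σ : St ν} (e : Exp ν)
    (he : e.small) (o t : ℕ) (s : Config) (hP : CodeAt P o (e.code loc o t)) (hpc : s.pc = o)
    (hloc : ∀ v, loc v < t) (hs : Bounded (2 ^ w) s) (hr : Represents loc s σ) :
    Computes P w o t e.len (e.eval (2 ^ w) σ) s ∧ e.eval (2 ^ w) σ < 2 ^ w := by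
  suffices h : Computes P w o t e.len (e.eval (2 ^ w) σ) s by
    refine ⟨h, ?_⟩
    obtain ⟨s', -, -, h, -, -, b⟩ := h
    exact h ▸ b.1 t
  induction e generalizing o t s with
  | var v =>
    simp only [Exp.code] at hP
    refine ⟨_, Steps.cons (hP.head hpc) (Steps.one (hP.tail.head ?_)), ?_, ?_, ?_, ?_, ?_⟩
    · simp [Instr.exec, hpc]
    · simp [Instr.exec, hpc, Exp.len]
    · have := (hloc v).ne
      simp [Instr.exec, assign_reg, this, Exp.eval, hr.1 v]
      rw [← hr.1 v]
      exact Nat.mod_eq_of_lt (hs.1 _)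
    · intro r hr
      simp [Instr.exec, assign_reg, hr.ne]
    · rfl
    · exact (hs.assign _ _).assign _ _
  | lit k =>
    simp [Exp.small] at he
    refine ⟨_, Steps.one (hP.head hpc), ?_, ?_, ?_, ?_, ?_⟩
    · simp [Instr.exec, hpc, Exp.len]
    · simpa [Instr.exec, assign_reg, Exp.eval] using Nat.mod_eq_of_lt (by omega)
    · intro r hr
      simp [Instr.exec, assign_reg, hr.ne]
    · rfl
    · exact hs.assign _ _
  | add a b iha ihb =>
    simp [Exp.small] at he
    have h := Computes.pair hloc (fun h => iha he.1 o t s h hpc hloc hs hr)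
      (fun s h₁ h₂ h₃ h₄ => ihb he.2 _ _ s h₁ h₂ (fun v => (hloc v).trans t.lt_succ_self) h₃ h₄) hP hr
    exact h.op fun s₁ hx hy => by simp [Instr.exec, hx, hy]
  | mul a b iha ihb =>
    simp [Exp.small] at he
    have h := Computes.pair hloc (fun h => iha he.1 o t s h hpc hloc hs hr)
      (fun s h₁ h₂ h₃ h₄ => ihb he.2 _ _ s h₁ h₂ (fun v => (hloc v).trans t.lt_succ_self) h₃ h₄) hP hr
    exact h.op fun s₁ hx hy => by simp [Instr.exec, hx, hy]
  | sub a b iha ihb =>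
    simp [Exp.small] at he
    have h := Computes.pair hloc (fun h => iha he.1 o t s h hpc hloc hs hr)
      (fun s h₁ h₂ h₃ h₄ => ihb he.2 _ _ s h₁ h₂ (fun v => (hloc v).trans t.lt_succ_self) h₃ h₄) hP hr
    have hlt : a.eval (2 ^ w) σ < 2 ^ w := by
      obtain ⟨s', -, -, h, -, -, -, b, -⟩ := h
      exact h ▸ b.1 t
    rw [Exp.eval, ← Nat.mod_eq_of_lt ((Nat.sub_le _ (b.eval (2 ^ w) σ)).trans_lt hlt)]
    exact h.op fun s₁ hx hy => by simp [Instr.exec, hx, hy]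
  | div a b iha ihb =>
    simp [Exp.small] at he
    have h := Computes.pair hloc (fun h => iha he.1 o t s h hpc hloc hs hr)
      (fun s h₁ h₂ h₃ h₄ => ihb he.2 _ _ s h₁ h₂ (fun v => (hloc v).trans t.lt_succ_self) h₃ h₄) hP hr
    have hlt : a.eval (2 ^ w) σ < 2 ^ w := by
      obtain ⟨s', -, -, h, -, -, -, b, -⟩ := h
      exact h ▸ b.1 t
    rw [Exp.eval, ← Nat.mod_eq_of_lt ((Nat.div_le_self _ (b.eval (2 ^ w) σ)).trans_lt hlt)]
    exact h.op fun s₁ hx hy => by simp [Instr.exec, hx, hy]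
  | lt a b iha ihb =>
    simp [Exp.small] at he
    have h := Computes.pair hloc (fun h => iha he.1 o t s h hpc hloc hs hr)
      (fun s h₁ h₂ h₃ h₄ => ihb he.2 _ _ s h₁ h₂ (fun v => (hloc v).trans t.lt_succ_self) h₃ h₄) hP hr
    exact h.test (by omega) (by omega) fun s₁ hx hy => by simp [Instr.exec, hx, hy]
  | eq a b iha ihb =>
    simp [Exp.small] at he
    have h := Computes.pair hloc (fun h => iha he.1 o t s h hpc hloc hs hr)
      (fun s h₁ h₂ h₃ h₄ => ihb he.2 _ _ s h₁ h₂ (fun v => (hloc v).trans t.lt_succ_self) h₃ h₄) hP hr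
    exact h.test (by omega) (by omega) fun s₁ hx hy => by simp [Instr.exec, hx, hy]
  | load a iha =>
    obtain ⟨s₁, h₁, p₁, r₁, f₁, m₁, b₁⟩ := iha he o t s hP.left hpc hloc hs hr
    have hP' := hP.right
    rw [Exp.length_code] at hP'
    refine ⟨_, h₁.trans (Steps.one (hP'.head p₁)), ?_, ?_, ?_, ?_, ?_⟩
    · simp [Instr.exec, p₁, Exp.len]; omega
    · simp only [Instr.exec, assign_reg, if_true, Exp.eval, r₁, m₁, hr.2]
      rw [← hr.2]
      exact Nat.mod_eq_of_lt (hs.2 _)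
    · intro r hr
      simp [Instr.exec, assign_reg, hr.ne, f₁ r hr]
    · exact m₁
    · exact b₁.assign _ _

/-- The correctness of compiled commands, with their running time. -/
theorem Com.spec [DecidableEq ν] {P : Program} {w : ℕ} (hw : 8 < 2 ^ w) {loc : ν → ℕ} {t : ℕ}
    (hinj : Function.Injective loc) (hloc : ∀ v, loc v < t) {par : ν → Bool} (c : Com ν)
    (hok : c.ok par) (o : ℕ) (s : Config) (σ : St ν) (hP : CodeAt P o (c.code loc t o))
    (hpc : s.pc = o) (hs : Bounded (2 ^ w) s) (hr : Represents loc s σ) :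
    ∃ s', Steps P w (c.time σ.reg) s s' ∧ s'.pc = o + c.len ∧
      Represents loc s' (c.den (2 ^ w) σ) ∧ Bounded (2 ^ w) s' := by
  have hloc' : ∀ v, loc v < t + 1 := fun v => (hloc v).trans t.lt_succ_self
  induction c generalizing o s σ with
  | skip => exact ⟨s, .refl _ _ _, by simpa [Com.len] using hpc, hr, hs⟩
  | assign v e =>
    simp [Com.ok] at hok
    obtain ⟨⟨s₁, h₁, p₁, r₁, f₁, m₁, b₁⟩, hlt⟩ :=
      e.computes hw hok.2 o t s hP.left hpc hloc hs hr
    have hP' := hP.right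
    rw [Exp.length_code] at hP'
    refine ⟨_, h₁.trans (Steps.cons (hP'.head p₁) (Steps.one (hP'.tail.head ?_))), ?_, ⟨?_, ?_⟩, ?_⟩
    · simp [Instr.exec, p₁]
    · simp [Instr.exec, p₁, Com.len]; omega
    · intro u
      have h1 := (hloc v).ne'
      have h2 := f₁ _ (hloc u)
      by_cases huv : u = v
      · subst huv
        simp [Instr.exec, assign_reg, h1, r₁, Com.den, St.set_reg, Nat.mod_eq_of_lt hlt]
      · have : loc u ≠ loc v := fun h => huv (hinj h)
        simp [Instr.exec, assign_reg, this, h2, Com.den, St.set_reg, huv, hr.1 u]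
    · exact m₁.trans hr.2
    · exact (b₁.assign _ _).assign _ _
  | store a e =>
    simp [Com.ok] at hok
    have h := Computes.pair hloc (fun h => (a.computes hw hok.1 o t s h hpc hloc hs hr).1)
      (fun s h₁ h₂ h₃ h₄ => (e.computes hw hok.2 _ _ s h₁ h₂ hloc' h₃ h₄).1) hP hr
    obtain ⟨s₁, h₁, p, rx, ry, f, m, b, hl⟩ := h
    refine ⟨_, (h₁.trans (.one (hl.head p))), ?_, ⟨?_, ?_⟩, ?_⟩
    · simp [Instr.exec, p, Com.len]; omega
    · intro u
      simpa [Instr.exec, Com.den, f _ (hloc u)] using hr.1 u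
    · simp [Instr.exec, Com.den, m, rx, ry, hr.2]
    · refine ⟨b.1, fun x => ?_⟩
      simp only [Instr.exec, Function.update_apply]
      split
      · exact b.1 _
      · exact b.2 _
  | seq c₁ c₂ ih₁ ih₂ =>
    simp [Com.ok] at hok
    obtain ⟨s₁, h₁, p₁, r₁, b₁⟩ := ih₁ hok.1 o s σ hP.left hpc hs hr
    have hP' := hP.right
    rw [Com.length_code] at hP'
    obtain ⟨s₂, h₂, p₂, r₂, b₂⟩ := ih₂ hok.2 _ s₁ _ hP' p₁ b₁ r₁
    refine ⟨s₂, (h₁.trans h₂).mono ?_, ?_, r₂, b₂⟩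
    · rw [Com.time, Com.time_congr hok.2 fun v hv => c₁.den_reg _ (Com.not_mem_writes hok.1 hv) σ]
    · simp [p₂, Com.len]; omega
  | ite e c₁ c₂ ih₁ ih₂ =>
    simp [Com.ok] at hok
    obtain ⟨⟨s₁, h₁, p₁, r₁, f₁, m₁, b₁⟩, hlt⟩ :=
      e.computes hw hok.1 o t s hP.left hpc hloc hs hr
    have hP' := hP.right
    rw [Exp.length_code] at hP'
    have hPb := hP'.right
    have hPj := hPb.right
    have hPc := hPj.right
    simp only [Com.length_code, List.length_cons, List.length_nil, Nat.zero_add] at hPb hPj hPc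
    have hj := hP'.left.head p₁
    have hr₁ : ∀ q, Represents loc { (s₁.assign w (t + 1) 0) with pc := q } σ := fun q =>
      ⟨fun v => by simp [assign_reg, (hloc' v).ne, f₁ _ (hloc v), hr.1 v], m₁.trans hr.2⟩
    have hb₁ : ∀ q, Bounded (2 ^ w) { (s₁.assign w (t + 1) 0) with pc := q } := fun q =>
      ⟨(b₁.assign _ _).1, b₁.2⟩
    have hj' : P[(s₁.assign w (t + 1) 0).pc]? = _ := hP'.left.tail.head (by simp [p₁])
    have hne : ¬ t = t + 1 := by omega
    by_cases he : e.eval (2 ^ w) σ = 0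
    · obtain ⟨s₂, h₂, p₂, r₂, b₂⟩ := ih₂ hok.2.2 _ _ σ hPc rfl (hb₁ _) (hr₁ _)
      refine ⟨s₂, ((h₁.trans (Steps.cons hj (Steps.one hj'))).trans
        (l := c₂.time σ.reg) ?_).mono ?_, ?_, ?_, b₂⟩
      · simpa [Instr.exec, assign_reg, r₁, he, hne] using h₂
      · simp [Com.time]; omega
      · simp [p₂, Com.len]; omega
      · simpa [Com.den, he] using r₂
    · obtain ⟨s₂, h₂, p₂, r₂, b₂⟩ := ih₁ hok.2.1 _ _ σ hPb.left rfl (hb₁ _) (hr₁ _)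
      refine ⟨{ s₂ with pc := o + e.len + 2 + c₁.len + 1 + c₂.len },
        (((h₁.trans (Steps.cons hj (Steps.one hj'))).trans
        (l := c₁.time σ.reg) ?_).trans (Steps.one (hPj.head p₂))).mono ?_, ?_, ⟨?_, ?_⟩,
          ⟨b₂.1, b₂.2⟩⟩
      · simpa [Instr.exec, assign_reg, r₁, he, hne, p₁] using h₂
      · simp [Com.time]; omega
      · simp [Com.len]; omega
      · simpa [Com.den, he] using r₂.1
      · simpa [Com.den, he] using r₂.2
  | loop i b c ih =>
    simp [Com.ok] at hok
    obtain ⟨hi, hb, hic, hc⟩ := hok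
    have hPr := hP.right
    have hPl := hP.left
    have hPe := hPr.right
    simp only [Com.length_code, List.length_cons, List.length_nil, Nat.zero_add] at hPr hPe
    have hbi : b ≠ i := by
      rintro rfl
      simp [hb] at hi
    have hbc : b ∉ c.writes := Com.not_mem_writes hc hb
    have hbσ : σ.reg b < 2 ^ w := hr.1 b ▸ hs.1 (loc b)
    set f := c.den (2 ^ w)
    have key : ∀ k ≤ σ.reg b, ∃ s', Steps P w (1 + k * (c.time σ.reg + 4)) s s' ∧
        s'.pc = o + 1 ∧ Represents loc s' (loopState i f σ k) ∧ Bounded (2 ^ w) s' := by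
      intro k
      induction k with
      | zero =>
        intro _
        refine ⟨_, (Steps.one (hPl.head hpc)).mono (by omega), ?_, ⟨?_, ?_⟩, hs.assign _ _⟩
        · simp [Instr.exec, hpc]
        · intro u
          simp [Instr.exec, assign_reg, hinj.eq_iff, loopState, St.set_reg, hr.1]
        · exact hr.2
      | succ k ihk =>
        intro hk
        obtain ⟨s₁, h₁, p₁, r₁, b₁⟩ := ihk (by omega)
        have ei : s₁.reg (loc i) = k := (r₁.1 i).trans (loopState_reg_self _ _)
        have eb : s₁.reg (loc b) = σ.reg b :=
          (r₁.1 b).trans (loopState_reg hbi (c.den_reg _ hbc) _ _)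
        obtain ⟨s₂, h₂, p₂, r₂, b₂⟩ := ih hc (o + 3) { s₁ with pc := o + 3 } _ hPr.left rfl
          ⟨b₁.1, b₁.2⟩ r₁
        have h₁' := hPl.tail.head p₁
        have ei₂ : s₂.reg (loc i) = k :=
          (r₂.1 i).trans ((c.den_reg _ hic _).trans (loopState_reg_self _ _))
        have ht := (hloc i).ne
        refine ⟨_, (((h₁.trans (Steps.one h₁')).trans (l := c.time σ.reg) ?_).trans
          (Steps.cons (hPe.head p₂) (Steps.cons (hPe.tail.head ?_)
            (Steps.one (hPe.tail.tail.head ?_))))).mono ?_, ?_, ⟨?_, ?_⟩, ?_⟩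
        · rw [Com.time_congr hc (σ := (loopState i f σ k).reg)]
          · have : k < σ.reg b := by omega
            simpa [Instr.exec, ei, eb, this] using h₂
          · intro v hv
            refine (loopState_reg ?_ (c.den_reg _ (Com.not_mem_writes hc hv)) _ _).symm
            rintro rfl
            simp [hv] at hi
        · simp [Instr.exec, p₂]
        · simp [Instr.exec, p₂]
        · rw [Nat.succ_mul]; omega
        · simp [Instr.exec]
        · intro u
          have ht := (hloc u).ne
          simp only [Instr.exec, assign_reg, hinj.eq_iff, loopState, St.set_reg]
          split
          · simpa [ei₂] using Nat.mod_eq_of_lt (by omega)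
          · simp [r₂.1 u]
        · exact r₂.2
        · exact ⟨((b₂.assign _ _).assign _ _).1, b₂.2⟩
    obtain ⟨s₁, h₁, p₁, r₁, b₁⟩ := key _ le_rfl
    have ei : s₁.reg (loc i) = σ.reg b := (r₁.1 i).trans (loopState_reg_self _ _)
    have eb : s₁.reg (loc b) = σ.reg b :=
      (r₁.1 b).trans (loopState_reg hbi (c.den_reg _ hbc) _ _)
    refine ⟨{ s₁ with pc := o + 3 + c.len + 3 }, (h₁.trans
      (Steps.cons (hPl.tail.head p₁) (Steps.one (hPl.tail.tail.head ?_)))).mono ?_, ?_, r₁,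
        ⟨b₁.1, b₁.2⟩⟩
    · simp [Instr.exec, ei, eb, p₁]
    · simp [Com.time]; omega
    · simp [Com.len]; omega

end CycleEmbedding

namespace CycleEmbedding

/-! ### Distances in cycles and in connected graphs -/

theorem cycleGraph_adj_iff {N : ℕ} (hN : 3 ≤ N) (a b : Fin N) :
    (SimpleGraph.cycleGraph N).Adj a b ↔ a.val + 1 = b.val ∨ b.val + 1 = a.val ∨
      (a.val = 0 ∧ b.val + 1 = N) ∨ (b.val = 0 ∧ a.val + 1 = N) := by
  have key : ∀ u v : Fin N, (u - v).val = if u.val < v.val then N + u.val - v.val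
      else u.val - v.val := by
    intro u v
    have hu := u.2
    have hv := v.2
    rw [Fin.val_sub]
    split
    · rw [Nat.mod_eq_of_lt (by omega)]; omega
    · rw [Nat.mod_eq_sub_mod (by omega), Nat.mod_eq_of_lt (by omega)]; omega
  have ha := a.2
  have hb := b.2
  rw [SimpleGraph.cycleGraph_adj', key, key]
  split <;> split <;> omega

theorem cycleGraph_connected_of_le {N : ℕ} (hN : 3 ≤ N) :
    (SimpleGraph.cycleGraph N).Connected := by
  obtain ⟨k, rfl⟩ := Nat.exists_eq_add_of_le' hN
  exact SimpleGraph.cycleGraph_connected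

theorem cycleGraph_dist_le_of_add {N : ℕ} (hN : 3 ≤ N) (k : ℕ) (a b : Fin N)
    (h : a.val + k = b.val) : (SimpleGraph.cycleGraph N).dist a b ≤ k := by
  induction k generalizing b with
  | zero =>
    obtain rfl : a = b := Fin.ext h
    simp
  | succ k ih =>
    have hb := b.2
    let c : Fin N := ⟨a.val + k, by omega⟩
    have h₁ := ih c rfl
    have h₂ : (SimpleGraph.cycleGraph N).dist c b = 1 := by
      rw [SimpleGraph.dist_eq_one_iff_adj, cycleGraph_adj_iff hN]
      left
      simp only [c]
      omega
    have := (cycleGraph_connected_of_le hN).dist_triangle (u := a) (v := c) (w := b)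
    omega

/-- The distance in a cycle is the length of the shorter one of the two arcs. -/
theorem cycleGraph_dist {N : ℕ} (hN : 3 ≤ N) {a b : Fin N} (hab : a.val ≤ b.val) :
    (SimpleGraph.cycleGraph N).dist a b = min (b.val - a.val) (N - (b.val - a.val)) := by
  have hb := b.2
  have hc := cycleGraph_connected_of_le hN
  apply le_antisymm
  · refine le_min (cycleGraph_dist_le_of_add hN _ _ _ (by omega)) ?_
    have h₁ := cycleGraph_dist_le_of_add hN (N - 1 - b.val) b ⟨N - 1, by omega⟩ (by simp; omega)
    have h₂ := cycleGraph_dist_le_of_add hN a.val ⟨0, by omega⟩ a (by simp)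
    have h₃ : (SimpleGraph.cycleGraph N).dist ⟨0, by omega⟩ ⟨N - 1, by omega⟩ = 1 := by
      rw [SimpleGraph.dist_eq_one_iff_adj, cycleGraph_adj_iff hN]
      right; right; left
      simp; omega
    have h₄ := hc.dist_triangle (u := a) (v := ⟨0, by omega⟩) (w := b)
    have h₅ := hc.dist_triangle (u := ⟨0, by omega⟩) (v := ⟨N - 1, by omega⟩) (w := b)
    rw [SimpleGraph.dist_comm] at h₁ h₂
    omega
  · -- the length of the shorter arc from `a` changes by at most one along an edge
    have key : ∀ (u v : Fin N) (p : (SimpleGraph.cycleGraph N).Walk u v),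
        min ((v.val - a.val) + (a.val - v.val)) (N - ((v.val - a.val) + (a.val - v.val))) ≤
          min ((u.val - a.val) + (a.val - u.val)) (N - ((u.val - a.val) + (a.val - u.val))) +
            p.length := by
      intro u v p
      induction p with
      | nil => simp
      | @cons u w v h p ih =>
        rw [cycleGraph_adj_iff hN] at h
        have hu := u.2
        have hw := w.2
        have ha := a.2
        rw [SimpleGraph.Walk.length_cons]
        omega
    obtain ⟨p, hp⟩ := hc.exists_walk_length_eq_dist a b
    have := key a b p
    omega

theorem dist_lt_card {n : ℕ} {G : SimpleGraph (Fin n)} (hG : G.Connected) (u v : Fin n) :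
    G.dist u v < n := by
  obtain ⟨p, hp, h⟩ := hG.exists_path_of_dist u v
  simpa [h] using hp.length_lt

/-- The distance of two vertices of a graph on `{0, …, n - 1}`, given as natural numbers
(and `0` for numbers that are not vertices). -/
noncomputable def gdist {n : ℕ} (G : SimpleGraph (Fin n)) (x y : ℕ) : ℕ :=
  if h : x < n ∧ y < n then G.dist ⟨x, h.1⟩ ⟨y, h.2⟩ else 0

section gdist

variable {n : ℕ} {G : SimpleGraph (Fin n)}

theorem gdist_val (u v : Fin n) : gdist G u.val v.val = G.dist u v := by
  simp [gdist]

theorem gdist_of_lt {x y : ℕ} (hx : x < n) (hy : y < n) :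
    gdist G x y = G.dist ⟨x, hx⟩ ⟨y, hy⟩ := by
  simp [gdist, hx, hy]

theorem gdist_comm (x y : ℕ) : gdist G x y = gdist G y x := by
  unfold gdist
  by_cases hx : x < n <;> by_cases hy : y < n <;> simp [hx, hy]
  exact SimpleGraph.dist_comm

theorem gdist_self (x : ℕ) : gdist G x x = 0 := by
  unfold gdist
  split <;> simp

theorem gdist_triangle (hG : G.Connected) {x y z : ℕ} (hx : x < n) (hy : y < n) (hz : z < n) :
    gdist G x z ≤ gdist G x y + gdist G y z := by
  rw [gdist_of_lt hx hz, gdist_of_lt hx hy, gdist_of_lt hy hz]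
  exact hG.dist_triangle

theorem gdist_lt (hG : G.Connected) (x y : ℕ) (hn : 0 < n) : gdist G x y < n := by
  unfold gdist
  split
  · exact dist_lt_card hG _ _
  · exact hn

/-- A nonempty set of vertices of a connected graph that is closed under taking neighbours contains
all vertices. -/
theorem forall_of_closed (hG : G.Connected) {p : ℕ → Prop} {x : ℕ} (hx : x < n) (hp : p x)
    (h : ∀ y z, y < n → z < n → gdist G y z = 1 → p y → p z) {z : ℕ} (hz : z < n) : p z := by
  have key : ∀ u v : Fin n, G.Walk u v → p u.val → p v.val := by
    intro u v q
    induction q with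
    | nil => exact id
    | cons e q ih =>
      refine fun hu => ih (h _ _ (Fin.is_lt _) (Fin.is_lt _) ?_ hu)
      rwa [gdist_val, SimpleGraph.dist_eq_one_iff_adj]
  exact key ⟨x, hx⟩ ⟨z, hz⟩ (hG.preconnected _ _).some hp

end gdist

/-- A map into a cycle is an embedding of distortion `d` as soon as it does not stretch edges by
more than `d`, and does not contract distances. -/
theorem embedding_of_edges {n N d : ℕ} {G : SimpleGraph (Fin n)} (hG : G.Connected) (hN : 3 ≤ N)
    {F : Fin n → Fin N}
    (h₁ : ∀ u v, G.dist u v ≤ (SimpleGraph.cycleGraph N).dist (F u) (F v))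
    (h₂ : ∀ u v, G.Adj u v → (SimpleGraph.cycleGraph N).dist (F u) (F v) ≤ d) :
    IsNonContractingEmbedding G (SimpleGraph.cycleGraph N) d F := by
  refine fun u v => ⟨h₁ u v, ?_⟩
  have key : ∀ (u v : Fin n) (p : G.Walk u v),
      (SimpleGraph.cycleGraph N).dist (F u) (F v) ≤ d * p.length := by
    intro u v p
    induction p with
    | nil => simp
    | @cons u w v h p ih =>
      have := (cycleGraph_connected_of_le hN).dist_triangle (u := F u) (v := F w) (w := F v)
      have := h₂ u w h
      rw [SimpleGraph.Walk.length_cons, Nat.mul_succ]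
      omega
  obtain ⟨p, hp⟩ := hG.exists_walk_length_eq_dist u v
  exact hp ▸ key u v p

/-! ### Windows and their codes -/

/-- The digit number `j` of `c` in base `B`. -/
def digit (B c j : ℕ) : ℕ := c / B ^ j % B

/-- The vertex reached after reading `j` digits of the code `c` of a window, starting from the last
vertex `x`. A nonzero digit `k` leads from the current vertex `y` to the vertex that has number `k`
in the ball around `y`; the table `ball y k` holds the successor of this vertex. -/
def cur (B : ℕ) (ball : ℕ → ℕ → ℕ) (x c : ℕ) : ℕ → ℕ
  | 0 => x
  | j + 1 => if digit B c j = 0 then cur B ball x c j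
      else ball (cur B ball x c j) (digit B c j) - 1

/-- What the window with last vertex `x` and code `c` contains `j` positions before `x`: the
successor `y + 1` of a vertex `y`, or `0` for an empty position. -/
def slot (B : ℕ) (ball : ℕ → ℕ → ℕ) (x c : ℕ) : ℕ → ℕ
  | 0 => x + 1
  | j + 1 => if digit B c j = 0 then 0 else cur B ball x c (j + 1) + 1

/-- The code of the window after a move by `g` positions, where `i` is the number of the old last
vertex in the ball around the new one. The window has `2 * d` positions besides that of the last
vertex, and a move by more than `d` positions empties it. -/
def nextCode (B d c g i : ℕ) : ℕ :=
  if d < g then 0 else (c * B ^ g + i * B ^ (g - 1)) % B ^ (2 * d)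

theorem digit_mod {B W c j : ℕ} (hj : j < W) : digit B (c % B ^ W) j = digit B c j := by
  obtain ⟨k, rfl⟩ : ∃ k, W = j + (k + 1) := ⟨W - j - 1, by omega⟩
  rw [digit, digit, pow_add, Nat.mod_mul_right_div_self, pow_succ,
    Nat.mod_mod_of_dvd _ (Dvd.intro_left _ rfl)]

theorem digit_nextCode_lt {B d c g i j : ℕ} (hB : 0 < B) (hd : g ≤ d) (hj : j + 1 < g) :
    digit B (nextCode B d c g i) j = 0 := by
  rw [nextCode, if_neg (by omega), digit_mod (by omega)]
  obtain ⟨k, rfl⟩ : ∃ k, g = j + k + 2 := ⟨g - j - 2, by omega⟩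
  have : c * B ^ (j + k + 2) + i * B ^ (j + k + 2 - 1) = B ^ j * (B * (B ^ k * (c * B + i))) := by
    rw [show j + k + 2 - 1 = j + k + 1 by omega]
    ring
  rw [this, digit, Nat.mul_div_cancel_left _ (by positivity), Nat.mul_mod_right]

theorem digit_nextCode_self {B d c g i : ℕ} (hi : i < B) (hd : g + 1 ≤ d) :
    digit B (nextCode B d c (g + 1) i) g = i := by
  rw [nextCode, if_neg (by omega), digit_mod (by omega)]
  have : c * B ^ (g + 1) + i * B ^ (g + 1 - 1) = B ^ g * (B * c + i) := by
    rw [Nat.add_sub_cancel]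
    ring
  have hB : 0 < B := by omega
  rw [this, digit, Nat.mul_div_cancel_left _ (by positivity), Nat.mul_add_mod,
    Nat.mod_eq_of_lt hi]

theorem digit_nextCode_add {B d c g i j : ℕ} (hi : i < B) (hg : 1 ≤ g) (hd : g ≤ d)
    (hj : g + j < 2 * d) : digit B (nextCode B d c g i) (g + j) = digit B c j := by
  rw [nextCode, if_neg (by omega), digit_mod (by omega)]
  obtain ⟨k, rfl⟩ : ∃ k, g = k + 1 := ⟨g - 1, by omega⟩
  have : c * B ^ (k + 1) + i * B ^ (k + 1 - 1) = B ^ k * (B * c + i) := by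
    rw [Nat.add_sub_cancel]
    ring
  have hB : 0 < B := by omega
  rw [this, digit, digit, show k + 1 + j = k + (1 + j) by omega, pow_add, ← Nat.div_div_eq_div_mul,
    Nat.mul_div_cancel_left _ (by positivity), pow_add, pow_one, ← Nat.div_div_eq_div_mul,
    Nat.mul_add_div hB, Nat.div_eq_of_lt hi, add_zero]

theorem cur_nextCode_lt {B d c g i x j : ℕ} {ball : ℕ → ℕ → ℕ} (hB : 0 < B) (hd : g ≤ d)
    (hj : j < g) : cur B ball x (nextCode B d c g i) j = x := by
  induction j with
  | zero => rfl
  | succ j ih => rw [cur, digit_nextCode_lt hB hd hj, if_pos rfl, ih (by omega)]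

theorem cur_nextCode_add {B d c g i x y j : ℕ} {ball : ℕ → ℕ → ℕ} (hi : i < B) (hi0 : 1 ≤ i)
    (hball : ball y i = x + 1) (hg : 1 ≤ g) (hd : g ≤ d) (hj : g + j ≤ 2 * d) :
    cur B ball y (nextCode B d c g i) (g + j) = cur B ball x c j := by
  induction j with
  | zero =>
    obtain ⟨k, rfl⟩ : ∃ k, g = k + 1 := ⟨g - 1, by omega⟩
    rw [add_zero, cur, cur, digit_nextCode_self hi hd, if_neg (by omega),
      cur_nextCode_lt (by omega) hd (by omega), hball]
    rfl
  | succ j ih =>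
    rw [← add_assoc, cur, digit_nextCode_add hi hg hd (by omega), ih (by omega), cur]

theorem slot_nextCode_lt {B d c g i x j : ℕ} {ball : ℕ → ℕ → ℕ} (hB : 0 < B) (hd : g ≤ d)
    (hj0 : 1 ≤ j) (hj : j < g) : slot B ball x (nextCode B d c g i) j = 0 := by
  obtain ⟨k, rfl⟩ : ∃ k, j = k + 1 := ⟨j - 1, by omega⟩
  rw [slot, digit_nextCode_lt hB hd hj, if_pos rfl]

/-- A move by `g` positions shifts the contents of the window by `g`. -/
theorem slot_nextCode_add {B d c g i x y j : ℕ} {ball : ℕ → ℕ → ℕ} (hi : i < B) (hi0 : 1 ≤ i)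
    (hball : ball y i = x + 1) (hg : 1 ≤ g) (hd : g ≤ d) (hj : g + j ≤ 2 * d) :
    slot B ball y (nextCode B d c g i) (g + j) = slot B ball x c j := by
  have h := cur_nextCode_add (c := c) hi hi0 hball hg hd hj
  cases j with
  | zero =>
    obtain ⟨k, rfl⟩ : ∃ k, g = k + 1 := ⟨g - 1, by omega⟩
    rw [add_zero] at h ⊢
    rw [slot, slot, digit_nextCode_self hi hd, if_neg (by omega), h]
    rfl
  | succ j =>
    rw [← add_assoc] at h ⊢
    rw [slot, digit_nextCode_add hi hg hd (by omega), h, slot]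

theorem slot_zero_code {B x j : ℕ} {ball : ℕ → ℕ → ℕ} (hj : 1 ≤ j) : slot B ball x 0 j = 0 := by
  obtain ⟨k, rfl⟩ : ∃ k, j = k + 1 := ⟨j - 1, by omega⟩
  simp [slot, digit]

/-- The tables `idx` and `ball` number the vertices of every ball of radius `d` by `1, …, B - 1`:
`idx x y` is the number of `y` in the ball around `x`, and `ball x k` the successor of the vertex
number `k`, or `0` if there is none. -/
structure IsNumbering {n : ℕ} (G : SimpleGraph (Fin n)) (d B : ℕ) (idx ball : ℕ → ℕ → ℕ) :
    Prop where
  one_le : ∀ x < n, ∀ y < n, gdist G x y ≤ d → 1 ≤ idx x y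
  lt_base : ∀ x < n, ∀ y < n, idx x y < B
  ball_idx : ∀ x < n, ∀ y < n, gdist G x y ≤ d → ball x (idx x y) = y + 1
  ball_le : ∀ x < n, ∀ k < B, ball x k ≤ n

/-- An infinite sequence of vertices `x i` at positions `p i`, with the codes `c i` of windows. -/
structure Trail {n : ℕ} (G : SimpleGraph (Fin n)) (d B : ℕ) (idx : ℕ → ℕ → ℕ) (x p c : ℕ → ℕ) :
    Prop where
  lt_n : ∀ i, x i < n
  lt_succ : ∀ i, p i < p (i + 1)
  dist_le : ∀ i, gdist G (x i) (x (i + 1)) ≤ p (i + 1) - p i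
  code : ∀ i, c (i + 1) = nextCode B d (c i) (p (i + 1) - p i) (idx (x (i + 1)) (x i))

namespace Trail

variable {n : ℕ} {G : SimpleGraph (Fin n)} {d B : ℕ} {idx ball : ℕ → ℕ → ℕ} {x p c : ℕ → ℕ}

theorem strictMono (h : Trail G d B idx x p c) : StrictMono p := strictMono_nat_of_lt_succ h.lt_succ

theorem slot_succ (h : Trail G d B idx x p c) (hT : IsNumbering G d B idx ball) {i j : ℕ}
    (hd : p (i + 1) - p i ≤ d) (hj : p (i + 1) - p i + j ≤ 2 * d) :
    slot B ball (x (i + 1)) (c (i + 1)) (p (i + 1) - p i + j) = slot B ball (x i) (c i) j := by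
  have h₁ := h.lt_n i
  have h₂ := h.lt_n (i + 1)
  have h₃ : gdist G (x (i + 1)) (x i) ≤ d := by
    rw [gdist_comm]
    exact (h.dist_le i).trans hd
  have := h.lt_succ i
  rw [h.code]
  exact slot_nextCode_add (hT.lt_base _ h₂ _ h₁) (hT.one_le _ h₂ _ h₁ h₃)
    (hT.ball_idx _ h₂ _ h₁ h₃) (by omega) hd hj

/-- What a window contains is true, once the sequence is long enough. -/
theorem exists_of_slot (h : Trail G d B idx x p c) (hT : IsNumbering G d B idx ball)
    {j : ℕ} (hj : j ≤ 2 * d) {i u : ℕ} (hi : j ≤ i)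
    (hs : slot B ball (x i) (c i) j = u + 1) :
    ∃ i' ≤ i, x i' = u ∧ p i' + j = p i ∧ ∀ k, i' ≤ k → k < i → p (k + 1) - p k ≤ d := by
  induction j using Nat.strong_induction_on generalizing i with
  | _ j ih =>
    rcases Nat.eq_zero_or_pos j with rfl | hj0
    · exact ⟨i, le_rfl, by simpa [slot] using hs, rfl, by intros; omega⟩
    obtain ⟨i, rfl⟩ : ∃ k, i = k + 1 := ⟨i - 1, by omega⟩
    have hB : 0 < B := (Nat.zero_le _).trans_lt (hT.lt_base _ (h.lt_n 0) _ (h.lt_n 0))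
    have hp := h.lt_succ i
    by_cases hg : d < p (i + 1) - p i
    · rw [h.code, nextCode, if_pos hg, slot_zero_code hj0] at hs
      omega
    by_cases hjg : j < p (i + 1) - p i
    · rw [h.code, slot_nextCode_lt hB (by omega) hj0 hjg] at hs
      omega
    obtain ⟨k, hk⟩ : ∃ k, j = p (i + 1) - p i + k := ⟨j - (p (i + 1) - p i), by omega⟩
    rw [hk, h.slot_succ hT (by omega) (by omega)] at hs
    obtain ⟨i', h₁, h₂, h₃, h₄⟩ := ih k (by omega) (by omega) (by omega) hs
    refine ⟨i', by omega, h₂, by omega, fun l hl hl' => ?_⟩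
    rcases Nat.lt_succ_iff_lt_or_eq.1 hl' with h' | rfl
    · exact h₄ l hl h'
    · omega

/-- A vertex remains visible in the windows until it drops out on the left or a gap of more than
`d` positions occurs. -/
theorem slot_eq (h : Trail G d B idx x p c) (hT : IsNumbering G d B idx ball) {i i' : ℕ}
    (hi : i ≤ i') (hp : p i' ≤ p i + 2 * d) (hg : ∀ k, i ≤ k → k < i' → p (k + 1) - p k ≤ d) :
    slot B ball (x i') (c i') (p i' - p i) = x i + 1 := by
  induction i', hi using Nat.le_induction with
  | base => simp [slot]
  | succ k hk ih =>
    have h₁ := h.strictMono.monotone hk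
    have h₂ := h.lt_succ k
    rw [show p (k + 1) - p i = p (k + 1) - p k + (p k - p i) by omega,
      h.slot_succ hT (hg k hk (by omega)) (by omega)]
    exact ih (by omega) fun l hl hl' => hg l hl (by omega)

end Trail

end CycleEmbedding

namespace CycleEmbedding

/-! ### Closed trails and embeddings -/

/-- When the window with last vertex `x` and code `c` is moved by `g` positions, all neighbours have
been found of those vertices that are from now on more than `d` positions away. -/
def WindowOk {n : ℕ} (G : SimpleGraph (Fin n)) (d B : ℕ) (ball : ℕ → ℕ → ℕ) (x c g : ℕ) : Prop :=
  ∀ j ≤ d, d < g + j → ∀ y, slot B ball x c j = y + 1 → ∀ u < n, gdist G y u = 1 →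
    ∃ i ≤ j + d, slot B ball x c i = u + 1

/-- A permitted move from a window with last vertex `x` and code `c` to the vertex `y`, which is
placed `g` positions further; the new code is `c'`. -/
structure Move {n : ℕ} (G : SimpleGraph (Fin n)) (d B : ℕ) (idx ball : ℕ → ℕ → ℕ)
    (x c g y c' : ℕ) : Prop where
  dist_le : gdist G x y ≤ g
  windowOk : WindowOk G d B ball x c g
  code : c' = nextCode B d c g (idx y x)

/-- A sequence of `m` permitted moves around the cycle with `N` vertices, starting from the vertex
`x 0` at position `0` and returning to the same window at position `N`. -/
structure ClosedTrail {n : ℕ} (G : SimpleGraph (Fin n)) (d B : ℕ) (idx ball : ℕ → ℕ → ℕ) (N m : ℕ)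
    (x p c : ℕ → ℕ) : Prop where
  pos : 0 < m
  lt_n : ∀ i < m, x i < n
  start : p 0 = 0
  lt_N : p (m - 1) < N
  lt_succ : ∀ i, i + 1 < m → p i < p (i + 1)
  move : ∀ i, i + 1 < m →
    Move G d B idx ball (x i) (c i) (p (i + 1) - p i) (x (i + 1)) (c (i + 1))
  close : Move G d B idx ball (x (m - 1)) (c (m - 1)) (N - p (m - 1)) (x 0) (c 0)

/-- Positions `p 0, …, p (m - 1)` in a cycle of length `N`, continued periodically. -/
def unroll (N m : ℕ) (p : ℕ → ℕ) (i : ℕ) : ℕ := p (i % m) + N * (i / m)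

theorem unroll_add_mul {N m i k : ℕ} {p : ℕ → ℕ} (hm : 0 < m) :
    unroll N m p (i + m * k) = unroll N m p i + N * k := by
  rw [unroll, unroll, Nat.add_mul_mod_self_left, Nat.add_mul_div_left _ _ hm]
  ring

theorem unroll_of_lt {N m i : ℕ} {p : ℕ → ℕ} (hi : i < m) : unroll N m p i = p i := by
  rw [unroll, Nat.mod_eq_of_lt hi, Nat.div_eq_of_lt hi]
  rfl

theorem succ_mod_div {m : ℕ} (hm : 0 < m) (i : ℕ) :
    (i % m + 1 < m ∧ (i + 1) % m = i % m + 1 ∧ (i + 1) / m = i / m) ∨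
      (i % m = m - 1 ∧ (i + 1) % m = 0 ∧ (i + 1) / m = i / m + 1) := by
  have h₁ := Nat.mod_lt i hm
  have h₂ := Nat.mod_add_div i m
  by_cases h : i % m + 1 < m
  · left
    have h₃ : i + 1 = (i % m + 1) + m * (i / m) := by omega
    refine ⟨h, ?_, ?_⟩
    · rw [h₃, Nat.add_mul_mod_self_left, Nat.mod_eq_of_lt h]
    · rw [h₃, Nat.add_mul_div_left _ _ hm, Nat.div_eq_of_lt h, zero_add]
  · right
    have h₃ : i + 1 = m * (i / m + 1) := by rw [Nat.mul_succ]; omega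
    refine ⟨by omega, ?_, ?_⟩
    · rw [h₃, Nat.mul_mod_right]
    · rw [h₃, Nat.mul_div_cancel_left _ hm]

theorem unroll_succ {N m : ℕ} {p : ℕ → ℕ} (hm : 0 < m) (h0 : p 0 = 0) (i : ℕ) :
    unroll N m p (i + 1) = unroll N m p i + N - p (m - 1) ∧ i % m = m - 1 ∧ (i + 1) % m = 0 ∨
    (unroll N m p (i + 1) = p (i % m + 1) + N * (i / m) ∧ i % m + 1 < m ∧
      (i + 1) % m = i % m + 1) := by
  rcases succ_mod_div hm i with ⟨h₁, h₂, h₃⟩ | ⟨h₁, h₂, h₃⟩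
  · exact .inr ⟨by rw [unroll, h₂, h₃], h₁, h₂⟩
  · refine .inl ⟨?_, h₁, h₂⟩
    rw [unroll, unroll, h₁, h₂, h₃, h0, Nat.mul_succ]
    omega

theorem Trail.dist_le_of_le {n : ℕ} {G : SimpleGraph (Fin n)} (hG : G.Connected) {d B : ℕ}
    {idx : ℕ → ℕ → ℕ} {x p c : ℕ → ℕ} (h : Trail G d B idx x p c) {i j : ℕ} (hij : i ≤ j) :
    gdist G (x i) (x j) ≤ p j - p i := by
  induction j, hij using Nat.le_induction with
  | base => simp [gdist_self]
  | succ k hk ih =>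
    have h₁ := gdist_triangle hG (h.lt_n i) (h.lt_n k) (h.lt_n (k + 1))
    have h₂ := h.dist_le k
    have h₃ := h.lt_succ k
    have h₄ := h.strictMono.monotone hk
    omega

namespace ClosedTrail

variable {n : ℕ} {G : SimpleGraph (Fin n)} {d B N m : ℕ} {idx ball : ℕ → ℕ → ℕ} {x p c : ℕ → ℕ}

theorem unroll_move (h : ClosedTrail G d B idx ball N m x p c) (i : ℕ) :
    unroll N m p i < unroll N m p (i + 1) ∧
      Move G d B idx ball (x (i % m)) (c (i % m)) (unroll N m p (i + 1) - unroll N m p i)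
        (x ((i + 1) % m)) (c ((i + 1) % m)) := by
  have hN := h.lt_N
  rcases unroll_succ (N := N) h.pos h.start i with ⟨h₁, h₂, h₃⟩ | ⟨h₁, h₂, h₃⟩
  · rw [h₁, h₂, h₃]
    refine ⟨by omega, ?_⟩
    convert h.close using 1
    omega
  · have := h.lt_succ _ h₂
    rw [h₁, h₃, unroll]
    refine ⟨by omega, ?_⟩
    convert h.move _ h₂ using 1
    omega

theorem trail (h : ClosedTrail G d B idx ball N m x p c) :
    Trail G d B idx (fun i => x (i % m)) (unroll N m p) (fun i => c (i % m)) where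
  lt_n _ := h.lt_n _ (Nat.mod_lt _ h.pos)
  lt_succ i := (h.unroll_move i).1
  dist_le i := (h.unroll_move i).2.dist_le
  code i := (h.unroll_move i).2.code

/-- All neighbours of a vertex are found within `d` positions, since they have to be in the window
when the vertex goes out of reach. -/
theorem exists_near (h : ClosedTrail G d B idx ball N m x p c) (hT : IsNumbering G d B idx ball)
    {i u : ℕ} (hi : 2 * d ≤ i) (hu : u < n) (hadj : gdist G (x (i % m)) u = 1) :
    ∃ i', x (i' % m) = u ∧ unroll N m p i' ≤ unroll N m p i + d ∧
      unroll N m p i ≤ unroll N m p i' + d := by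
  have ht := h.trail
  have hmono := ht.strictMono
  obtain ⟨k, hk, hk'⟩ : ∃ k, unroll N m p k ≤ unroll N m p i + d ∧
      unroll N m p i + d < unroll N m p (k + 1) := by
    have hex : ∃ k, unroll N m p i + d < unroll N m p k :=
      ⟨unroll N m p i + d + 1, hmono.le_apply⟩
    have hspec := Nat.find_spec hex
    have hmin := fun {k} => Nat.find_min (m := k) hex
    rcases hf : Nat.find hex with _ | k
    · rw [hf] at hspec
      have := hmono.monotone (Nat.zero_le i)
      omega
    · rw [hf] at hspec
      exact ⟨k, not_lt.1 (hmin (hf ▸ Nat.lt_succ_self k)), hspec⟩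
  have hik : i ≤ k := by
    by_contra hlt
    have := hmono.monotone (show k + 1 ≤ i by omega)
    omega
  have hik' := hmono.monotone hik
  have hslot := ht.slot_eq hT hik (by omega) fun l hl hl' => by
    have := hmono.monotone hl
    have := hmono.monotone (show l + 1 ≤ k by omega)
    omega
  obtain ⟨j, hj, hs⟩ := (h.unroll_move k).2.windowOk _ (by omega) (by omega) _ hslot u hu hadj
  obtain ⟨i', -, h₁, h₂, -⟩ := ht.exists_of_slot hT (i := k) (by omega) (by omega) hs
  exact ⟨i', h₁, by omega, by omega⟩

/-- A closed trail visits all vertices. -/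
theorem exists_eq (h : ClosedTrail G d B idx ball N m x p c) (hT : IsNumbering G d B idx ball)
    (hG : G.Connected) {u : ℕ} (hu : u < n) : ∃ i < m, x i = u := by
  refine forall_of_closed hG (p := fun u => ∃ i < m, x i = u) (h.lt_n 0 h.pos) ⟨0, h.pos, rfl⟩ ?_ hu
  rintro y z - hz hyz ⟨i, hi, rfl⟩
  have hmod : (i + m * (2 * d)) % m = i := by rw [Nat.add_mul_mod_self_left, Nat.mod_eq_of_lt hi]
  obtain ⟨i', h₁, -, -⟩ := h.exists_near hT (i := i + m * (2 * d))
    (le_add_left (Nat.le_mul_of_pos_left _ h.pos)) hz (by rwa [hmod])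
  exact ⟨i' % m, Nat.mod_lt _ h.pos, h₁⟩

/-- A closed trail has at least `n` moves, so that those with `n` moves are shortest ones. -/
theorem card_le (h : ClosedTrail G d B idx ball N m x p c) (hT : IsNumbering G d B idx ball)
    (hG : G.Connected) : n ≤ m := by
  have hsub : Finset.range n ⊆ (Finset.range m).image x := by
    intro u hu
    obtain ⟨i, hi, rfl⟩ := h.exists_eq hT hG (Finset.mem_range.1 hu)
    exact Finset.mem_image_of_mem _ (Finset.mem_range.2 hi)
  simpa using (Finset.card_le_card hsub).trans Finset.card_image_le

/-- A closed trail with `n` moves visits every vertex once, and the positions of the vertices are a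
non-contracting embedding of distortion `d`. -/
theorem exists_embedding (h : ClosedTrail G d B idx ball N n x p c)
    (hT : IsNumbering G d B idx ball) (hG : G.Connected) (hN : 3 ≤ N) :
    Set.InjOn x (Set.Iio n) ∧ ∃ F : Fin n → Fin N,
      IsNonContractingEmbedding G (SimpleGraph.cycleGraph N) d F ∧
        ∀ v : Fin n, ∀ i < n, x i = v.val → (F v).val = p i := by
  have hpos := h.pos
  have ht := h.trail
  have hmono := ht.strictMono
  have hinj : Set.InjOn x (Set.Iio n) := by
    have himg : (Finset.range n).image x = Finset.range n := by
      ext u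
      simp only [Finset.mem_image, Finset.mem_range]
      exact ⟨fun ⟨i, hi, hu⟩ => hu ▸ h.lt_n i hi, fun hu => h.exists_eq hT hG hu⟩
    have hcard : ((Finset.range n).image x).card = (Finset.range n).card := by rw [himg]
    have := Finset.card_image_iff.1 hcard
    simpa [Set.Iio] using this
  refine ⟨hinj, ?_⟩
  have hp : ∀ i < n, p i < N := by
    intro i hi
    have := hmono.monotone (show i ≤ n - 1 by omega)
    rw [unroll_of_lt hi, unroll_of_lt (by omega)] at this
    exact this.trans_lt h.lt_N
  choose f hf hxf using fun v : Fin n => h.exists_eq hT hG v.2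
  have hd : ∀ i j, i ≤ j → j < n → gdist G (x i) (x j) ≤ p j - p i ∧
      gdist G (x i) (x j) ≤ N - (p j - p i) ∧ p i ≤ p j := by
    intro i j hij hj
    have h₁ := ht.dist_le_of_le hG hij
    have h₂ := ht.dist_le_of_le hG (show j ≤ i + n * 1 by omega)
    have h₃ := hmono.monotone hij
    have h₄ := hp j hj
    rw [unroll_add_mul hpos] at h₂
    simp only [Nat.add_mul_mod_self_left] at h₂
    simp only [unroll_of_lt hj, unroll_of_lt (hij.trans_lt hj), Nat.mod_eq_of_lt hj,
      Nat.mod_eq_of_lt (hij.trans_lt hj)] at h₁ h₂ h₃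
    rw [gdist_comm] at h₂
    omega
  let F : Fin n → Fin N := fun v => ⟨p (f v), hp _ (hf v)⟩
  have hdist : ∀ u v, p (f u) ≤ p (f v) → (SimpleGraph.cycleGraph N).dist (F u) (F v) =
      min (p (f v) - p (f u)) (N - (p (f v) - p (f u))) := fun u v huv => cycleGraph_dist hN huv
  have hle : ∀ u v, p (f u) ≤ p (f v) → f u ≤ f v := by
    intro u v huv
    by_contra hlt
    have := hmono (not_le.1 hlt)
    rw [unroll_of_lt (hf u), unroll_of_lt (hf v)] at this
    omega
  refine ⟨F, embedding_of_edges hG hN ?_ ?_, ?_⟩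
  · intro u v
    wlog huv : p (f u) ≤ p (f v) generalizing u v
    · rw [SimpleGraph.dist_comm, SimpleGraph.dist_comm (u := F u)]
      exact this v u (by omega)
    have := hd _ _ (hle u v huv) (hf v)
    rw [hxf, hxf, gdist_val] at this
    rw [hdist u v huv]
    omega
  · intro u v
    wlog huv : p (f u) ≤ p (f v) generalizing u v
    · rw [SimpleGraph.adj_comm, SimpleGraph.dist_comm]
      exact this v u (by omega)
    intro hadj
    rw [hdist u v huv]
    have hmod : (f u + n * (2 * d)) % n = f u := by
      rw [Nat.add_mul_mod_self_left, Nat.mod_eq_of_lt (hf u)]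
    obtain ⟨i', h₁, h₂, h₃⟩ := h.exists_near hT (i := f u + n * (2 * d)) (u := v.val)
      (le_add_left (Nat.le_mul_of_pos_left _ hpos)) v.2
      (by rw [hmod, hxf, gdist_val, SimpleGraph.dist_eq_one_iff_adj]; exact hadj)
    have h₄ : i' % n = f v := hinj (Nat.mod_lt _ hpos) (hf v) (h₁.trans (hxf v).symm)
    rw [unroll_add_mul hpos, unroll_of_lt (hf u), unroll, h₄] at h₂ h₃
    have h₅ := hp _ (hf u)
    have h₆ := hp _ (hf v)
    rcases lt_trichotomy (i' / n) (2 * d) with hlt | heq | hlt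
    · have := Nat.mul_le_mul_left N hlt
      rw [Nat.mul_succ] at this
      omega
    · rw [heq] at h₂ h₃
      omega
    · have := Nat.mul_le_mul_left N hlt
      rw [Nat.mul_succ] at this
      omega
  · intro v i hi hx
    rw [← hinj (hf v) hi ((hxf v).trans hx.symm)]

end ClosedTrail

end CycleEmbedding

namespace CycleEmbedding

/-! ### From embeddings to closed trails -/

/-- The vertices of a graph in the order in which an embedding into the cycle with `N` vertices
arranges them, with their positions, counted from that of the vertex `x 0`. -/
structure Arrangement {n : ℕ} (G : SimpleGraph (Fin n)) (N d : ℕ) (x p : ℕ → ℕ) : Prop where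
  lt_n : ∀ i < n, x i < n
  exists_eq : ∀ u < n, ∃ i < n, x i = u
  start : p 0 = 0
  lt : ∀ i j, i < j → j < n → p i < p j
  lt_N : ∀ i < n, p i < N
  dist_le : ∀ i j, i < j → j < n → gdist G (x i) (x j) ≤ min (p j - p i) (N - (p j - p i))
  edge : ∀ i j, i < j → j < n → gdist G (x i) (x j) = 1 → min (p j - p i) (N - (p j - p i)) ≤ d

/-- The length of the arc from `a` to `b` in the cycle with `N` vertices, in positive direction. -/
def arc (N a b : ℕ) : ℕ := if a ≤ b then b - a else b + N - a

/-- The arrangement of the vertices that starts from a given vertex `v₀`. -/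
theorem exists_arrangement {n N d : ℕ} {G : SimpleGraph (Fin n)} (hG : G.Connected) (hN : 3 ≤ N)
    {F : Fin n → Fin N} (hF : IsNonContractingEmbedding G (SimpleGraph.cycleGraph N) d F)
    (v₀ : Fin n) : ∃ x p, Arrangement G N d x p ∧
      ∀ i < n, ∃ v : Fin n, x i = v.val ∧ p i = arc N (F v₀).val (F v).val := by
  have hn : 0 < n := v₀.pos
  have hinj : Function.Injective F := by
    intro u v huv
    have := (hF u v).1
    rw [huv, SimpleGraph.dist_self, Nat.le_zero] at this
    exact (hG.dist_eq_zero_iff).1 this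
  set q : Fin n → ℕ := fun v => arc N (F v₀).val (F v).val with hq
  have hqN : ∀ v, q v < N := by
    intro v
    have := (F v).2
    have := (F v₀).2
    simp only [hq, arc]
    split <;> omega
  have hqinj : Function.Injective q := by
    intro u v huv
    have := (F u).2
    have := (F v).2
    apply hinj
    apply Fin.ext
    simp only [hq, arc] at huv
    split at huv <;> split at huv <;> omega
  have hqdist : ∀ u v, q u ≤ q v → (SimpleGraph.cycleGraph N).dist (F u) (F v) =
      min (q v - q u) (N - (q v - q u)) := by
    intro u v huv
    have h₀ := (F v₀).2
    have h₁ := (F u).2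
    have h₂ := (F v).2
    rcases le_total (F u).val (F v).val with h | h
    · rw [cycleGraph_dist hN h]
      simp only [hq, arc] at huv ⊢
      split_ifs at huv ⊢ <;> omega
    · rw [SimpleGraph.dist_comm, cycleGraph_dist hN h]
      simp only [hq, arc] at huv ⊢
      split_ifs at huv ⊢ <;> omega
  have hcard : (Finset.univ.image q).card = n := by
    rw [Finset.card_image_of_injective _ hqinj, Finset.card_univ, Fintype.card_fin]
  set e := (Finset.univ.image q).orderEmbOfFin hcard with he
  have hex : ∀ i, ∃ v, q v = e i := by
    intro i
    obtain ⟨v, -, hv⟩ := Finset.mem_image.1 (Finset.orderEmbOfFin_mem _ hcard i)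
    exact ⟨v, hv⟩
  choose y hy using hex
  have hsurj : ∀ v, ∃ i, y i = v := by
    intro v
    have : q v ∈ Set.range e := by
      rw [he, Finset.range_orderEmbOfFin]
      simp
    obtain ⟨i, hi⟩ := this
    exact ⟨i, hqinj ((hy i).trans hi)⟩
  have hmono : ∀ i j : Fin n, i < j → q (y i) < q (y j) := by
    intro i j hij
    rw [hy, hy]
    exact e.strictMono hij
  refine ⟨fun i => if h : i < n then (y ⟨i, h⟩).val else 0,
    fun i => if h : i < n then q (y ⟨i, h⟩) else 0, ⟨?_, ?_, ?_, ?_, ?_, ?_, ?_⟩, ?_⟩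
  · intro i hi
    simp [hi]
  · intro u hu
    obtain ⟨i, hi⟩ := hsurj ⟨u, hu⟩
    exact ⟨i.val, i.2, by simp [hi]⟩
  · obtain ⟨i, hi⟩ := hsurj v₀
    have h₀ : q v₀ = 0 := by simp [hq, arc]
    rcases Nat.eq_zero_or_pos i.val with h | h
    · obtain rfl : i = ⟨0, hn⟩ := Fin.ext h
      simpa [hn, hi] using h₀
    · have := hmono ⟨0, hn⟩ i h
      rw [hi] at this
      omega
  · intro i j hij hj
    have hi : i < n := hij.trans hj
    simpa [hi, hj] using hmono ⟨i, hi⟩ ⟨j, hj⟩ hij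
  · intro i hi
    simpa [hi] using hqN _
  · intro i j hij hj
    have hi : i < n := hij.trans hj
    have := (hF (y ⟨i, hi⟩) (y ⟨j, hj⟩)).1
    rw [hqdist _ _ (hmono ⟨i, hi⟩ ⟨j, hj⟩ hij).le] at this
    simpa [hi, hj, gdist_val] using this
  · intro i j hij hj hadj
    have hi : i < n := hij.trans hj
    have := (hF (y ⟨i, hi⟩) (y ⟨j, hj⟩)).2
    rw [hqdist _ _ (hmono ⟨i, hi⟩ ⟨j, hj⟩ hij).le] at this
    simp only [hi, hj, gdist_val, dif_pos] at hadj
    rw [hadj, mul_one] at this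
    simpa [hi, hj, gdist_val] using this
  · intro i hi
    exact ⟨y ⟨i, hi⟩, by simp [hi], by simp [hi, hq]⟩

/-- There is an arrangement in which only the gap between the last and the first vertex may have
more than `d` positions: two such gaps would cut the graph into two parts without an edge between
them. -/
theorem exists_arrangement_gap_le {n N d : ℕ} {G : SimpleGraph (Fin n)} (hG : G.Connected)
    (hN : 3 ≤ N) {F : Fin n → Fin N}
    (hF : IsNonContractingEmbedding G (SimpleGraph.cycleGraph N) d F) :
    ∃ x p, Arrangement G N d x p ∧ ∀ i, i + 1 < n → p (i + 1) - p i ≤ d := by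
  obtain ⟨v⟩ := hG.nonempty
  have arc_self : ∀ a, arc N a a = 0 := fun a => by simp [arc]
  by_cases h : ∃ v₀, ∀ v, v ≠ v₀ → d < arc N (F v).val (F v₀).val
  · obtain ⟨v₀, h₀⟩ := h
    obtain ⟨x, p, hA, hxp⟩ := exists_arrangement hG hN hF v₀
    refine ⟨x, p, hA, fun i hi => ?_⟩
    by_contra hlt
    have hlast : ∀ j, 0 < j → j < n → p j + d < N := by
      intro j hj hjn
      obtain ⟨u, hu, hpu⟩ := hxp j hjn
      have hne : u ≠ v₀ := by
        rintro rfl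
        have := hA.lt 0 j hj hjn
        rw [hpu, arc_self] at this
        omega
      have := h₀ u hne
      have := hA.lt 0 j hj hjn
      have := (F u).2
      have := (F v₀).2
      simp only [arc] at *
      split at hpu <;> split at * <;> omega
    have hsub : ∀ k < n, k ≤ i := by
      intro k hk
      have hpart : ∃ k' < n, x k' = x k ∧ k' ≤ i := by
        refine forall_of_closed hG (p := fun u => ∃ k' < n, x k' = u ∧ k' ≤ i)
          (hA.lt_n 0 (by omega)) ⟨0, by omega, rfl, by omega⟩ ?_ (hA.lt_n k hk)
        rintro y z hy hz hyz ⟨k', hk', rfl, hki⟩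
        obtain ⟨l, hl, rfl⟩ := hA.exists_eq z hz
        refine ⟨l, hl, rfl, ?_⟩
        by_contra hil
        have h₁ := hA.edge k' l (by omega) hl hyz
        have h₂ : p k' ≤ p i := by
          rcases hki.eq_or_lt with rfl | h
          · exact le_rfl
          · exact (hA.lt _ _ h (by omega)).le
        have h₃ : p (i + 1) ≤ p l := by
          rcases (show i + 1 ≤ l by omega).eq_or_lt with rfl | h
          · exact le_rfl
          · exact (hA.lt _ _ h (by omega)).le
        have h₄ := hlast l (by omega) hl
        omega
      obtain ⟨k', hk', hx, hki⟩ := hpart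
      -- the vertices of an arrangement are distinct, as there are only `n` of them
      have hcard : Set.InjOn x (Finset.range n) := by
        refine Finset.injOn_of_surjOn_of_card_le x (t := Finset.range n)
          (fun j hj => by simpa using hA.lt_n j (by simpa using hj)) ?_ le_rfl
        intro u hu
        obtain ⟨j, hj, rfl⟩ := hA.exists_eq u (by simpa using hu)
        exact ⟨j, by simpa using hj, rfl⟩
      have := hcard (by simpa using hk') (by simpa using hk) hx
      omega
    have := hsub (i + 1) hi
    omega
  · push Not at h
    obtain ⟨x, p, hA, hxp⟩ := exists_arrangement hG hN hF v
    refine ⟨x, p, hA, fun i hi => ?_⟩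
    by_contra hlt
    obtain ⟨u, hu, hpu⟩ := hxp (i + 1) hi
    obtain ⟨u', hne, hu'⟩ := h u
    obtain ⟨k, hk, hxk⟩ := hA.exists_eq u'.val u'.2
    obtain ⟨u'', hu'', hpu''⟩ := hxp k hk
    obtain rfl : u'' = u' := Fin.ext (hu''.symm.trans hxk)
    have h₁ := (F u).2
    have h₂ := (F u'').2
    have h₃ := (F v).2
    have h₄ := hA.lt i (i + 1) (by omega) hi
    have h₅ := hA.lt_N k hk
    have h₆ : k ≤ i ∧ p k ≤ p i ∨ k = i + 1 ∨ p (i + 1) < p k := by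
      rcases lt_trichotomy k i with h | rfl | h
      · exact .inl ⟨h.le, (hA.lt _ _ h (by omega)).le⟩
      · exact .inl ⟨le_rfl, le_rfl⟩
      · rcases (show i + 1 ≤ k by omega).eq_or_lt with rfl | h
        · exact .inr (.inl rfl)
        · exact .inr (.inr (hA.lt _ _ h hk))
    rcases h₆ with h₆ | rfl | h₆
    · simp only [arc] at *
      split at hpu <;> split at hpu'' <;> split at hu' <;> omega
    · exact hne (Fin.ext (hxk.symm.trans hu))
    · simp only [arc] at *
      split at hpu <;> split at hpu'' <;> split at hu' <;> omega

/-- The codes of the windows along a sequence of vertices that starts with an empty window. -/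
def codeSeq (B d : ℕ) (idx : ℕ → ℕ → ℕ) (x p : ℕ → ℕ) : ℕ → ℕ
  | 0 => 0
  | i + 1 => nextCode B d (codeSeq B d idx x p i) (p (i + 1) - p i) (idx (x (i + 1)) (x i))

theorem nextCode_lt {B d c g i : ℕ} (hB : 0 < B) : nextCode B d c g i < B ^ (2 * d) := by
  unfold nextCode
  split
  · positivity
  · exact Nat.mod_lt _ (by positivity)

/-- The code of a window forgets what has dropped out of it, so that the codes along a periodic
sequence become periodic. -/
theorem codeSeq_add {B d N m : ℕ} {idx : ℕ → ℕ → ℕ} {x p : ℕ → ℕ} (hB : 0 < B)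
    (hx : ∀ i, x (i + m) = x i) (hp : ∀ i, p (i + m) = p i + N) (hlt : ∀ i, p i < p (i + 1))
    {i : ℕ} (hi : 2 * d < i) :
    codeSeq B d idx x p (i + m) = codeSeq B d idx x p i := by
  have key : ∀ i, codeSeq B d idx x p (i + m) ≡ codeSeq B d idx x p i
      [MOD B ^ min (2 * d) (p i - p 0)] := by
    intro i
    induction i with
    | zero => simpa using Nat.modEq_one
    | succ i ih =>
      have h₁ : p (i + 1 + m) - p (i + m) = p (i + 1) - p i := by
        rw [hp, hp]
        omega
      have h₂ := hlt i
      rw [show i + 1 + m = i + m + 1 by omega] at *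
      rw [codeSeq, codeSeq, h₁, show i + m + 1 = i + 1 + m by omega, hx, hx, nextCode, nextCode]
      split
      · rfl
      · have hdvd : B ^ min (2 * d) (p (i + 1) - p 0) ∣ B ^ (2 * d) := pow_dvd_pow _ (min_le_left _ _)
        refine ((Nat.mod_modEq _ _).of_dvd hdvd).trans
          (Nat.ModEq.trans ?_ ((Nat.mod_modEq _ _).of_dvd hdvd).symm)
        refine Nat.ModEq.add_right _ ?_
        refine (Nat.ModEq.mul_right' (B ^ (p (i + 1) - p i)) ih).of_dvd ?_
        rw [← pow_add]
        exact pow_dvd_pow _ (by omega)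
  have hmono : StrictMono p := strictMono_nat_of_lt_succ hlt
  have hple : i ≤ p i - p 0 := by
    have : ∀ k, k ≤ p k - p 0 := by
      intro k
      induction k with
      | zero => simp
      | succ k ih => have := hlt k; have := hmono.monotone (Nat.zero_le k); omega
    exact this i
  have h := key i
  rw [min_eq_left (by omega)] at h
  obtain ⟨k, rfl⟩ : ∃ k, i = k + 1 := ⟨i - 1, by omega⟩
  refine Nat.ModEq.eq_of_lt_of_lt h ?_ ?_
  · rw [show k + 1 + m = k + m + 1 by omega]
    exact nextCode_lt hB
  · exact nextCode_lt hB

/-- Every embedding gives rise to a closed trail with `n` moves. -/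
theorem exists_closedTrail {n N d B : ℕ} {G : SimpleGraph (Fin n)} {idx ball : ℕ → ℕ → ℕ}
    (hG : G.Connected) (hN : 3 ≤ N) (hT : IsNumbering G d B idx ball) {F : Fin n → Fin N}
    (hF : IsNonContractingEmbedding G (SimpleGraph.cycleGraph N) d F) :
    ∃ x p c, ClosedTrail G d B idx ball N n x p c ∧ (∀ i, i + 1 < n → p (i + 1) - p i ≤ d) ∧
      ∀ i, c i < B ^ (2 * d) := by
  obtain ⟨x, p, hA, hgap⟩ := exists_arrangement_gap_le hG hN hF
  obtain ⟨v⟩ := hG.nonempty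
  have hn : 0 < n := v.pos
  have hB : 0 < B := (Nat.zero_le _).trans_lt (hT.lt_base _ v.2 _ v.2)
  have hlast := hA.lt_N (n - 1) (by omega)
  set X : ℕ → ℕ := fun i => x (i % n) with hX
  set P := unroll N n p with hP
  set C := codeSeq B d idx X P with hC
  have hstep : ∀ i, P i < P (i + 1) ∧ gdist G (X i) (X (i + 1)) ≤ P (i + 1) - P i := by
    intro i
    rcases unroll_succ (N := N) hn hA.start i with ⟨h₁, h₂, h₃⟩ | ⟨h₁, h₂, h₃⟩
    · simp only [hP, hX, h₁, h₂, h₃]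
      refine ⟨by omega, ?_⟩
      rcases Nat.eq_zero_or_pos (n - 1) with h₀ | h₀
      · simp [h₀, gdist_self]
      · have := hA.dist_le 0 (n - 1) h₀ (by omega)
        rw [hA.start, gdist_comm] at this
        omega
    · have h₄ := hA.lt _ _ (Nat.lt_add_one (i % n)) h₂
      have h₅ := hA.dist_le _ _ (Nat.lt_add_one (i % n)) h₂
      simp only [hP, hX, h₁, h₃]
      rw [unroll]
      refine ⟨by omega, ?_⟩
      omega
  have ht : Trail G d B idx X P C :=
    ⟨fun i => hA.lt_n _ (Nat.mod_lt _ hn), fun i => (hstep i).1, fun i => (hstep i).2,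
      fun i => rfl⟩
  have hmono := ht.strictMono
  have hnear : ∀ i u, n ≤ i → u < n → gdist G (X i) u = 1 →
      ∃ i', X i' = u ∧ P i' ≤ P i + d ∧ P i ≤ P i' + d := by
    intro i u hi hu hadj
    obtain ⟨s, hs, rfl⟩ := hA.exists_eq u hu
    have hr : i % n < n := Nat.mod_lt _ hn
    obtain ⟨q, hq⟩ : ∃ q, i / n = q + 1 :=
      ⟨i / n - 1, by have := Nat.div_pos hi hn; omega⟩
    have hXs : ∀ t, X (s + n * t) = x s := fun t => by
      simp [hX, Nat.add_mul_mod_self_left, Nat.mod_eq_of_lt hs]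
    have hPs : ∀ t, P (s + n * t) = p s + N * t := fun t => by
      rw [hP, unroll_add_mul hn, unroll_of_lt hs]
    have hPi : P i = p (i % n) + N * q + N := by
      rw [hP, unroll, hq, Nat.mul_succ]
      omega
    have h₁ := hA.lt_N _ hr
    have h₂ := hA.lt_N _ hs
    rcases lt_trichotomy (i % n) s with h | h | h
    · have h₃ := hA.edge _ _ h hs hadj
      have h₄ := hA.lt _ _ h hs
      rcases min_le_iff.1 h₃ with h₃ | h₃
      · exact ⟨s + n * (q + 1), hXs _, by rw [hPs, hPi, Nat.mul_succ]; omega,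
          by rw [hPs, hPi, Nat.mul_succ]; omega⟩
      · exact ⟨s + n * q, hXs _, by rw [hPs, hPi]; omega, by rw [hPs, hPi]; omega⟩
    · simp only [hX, h, gdist_self] at hadj
      omega
    · rw [gdist_comm] at hadj
      have h₃ := hA.edge _ _ h hr hadj
      have h₄ := hA.lt _ _ h hr
      rcases min_le_iff.1 h₃ with h₃ | h₃
      · exact ⟨s + n * (q + 1), hXs _, by rw [hPs, hPi, Nat.mul_succ]; omega,
          by rw [hPs, hPi, Nat.mul_succ]; omega⟩
      · exact ⟨s + n * (q + 2), hXs _, by rw [hPs, hPi, Nat.mul_add]; omega,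
          by rw [hPs, hPi, Nat.mul_add]; omega⟩
  have hmove : ∀ i, n + 2 * d ≤ i →
      Move G d B idx ball (X i) (C i) (P (i + 1) - P i) (X (i + 1)) (C (i + 1)) := by
    refine fun i hi => ⟨ht.dist_le i, ?_, rfl⟩
    intro j hj hgj y hs u hu hadj
    obtain ⟨i', hi', rfl, hp, hg⟩ := ht.exists_of_slot hT (i := i) (by omega) (by omega) hs
    have hsub : i - i' ≤ P i - P i' := by
      obtain ⟨k, rfl⟩ := Nat.exists_eq_add_of_le hi'
      have : ∀ k, k ≤ P (i' + k) - P i' := by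
        intro k
        induction k with
        | zero => simp
        | succ k ih =>
          have h₁ := ht.lt_succ (i' + k)
          have h₂ := hmono.monotone (show i' ≤ i' + k by omega)
          rw [← add_assoc]
          omega
      have := this k
      omega
    obtain ⟨l, rfl, h₁, h₂⟩ := hnear i' u (by omega) hu hadj
    have h₃ := ht.lt_succ i
    have hli : l ≤ i := by
      by_contra hlt
      have := hmono.monotone (show i + 1 ≤ l by omega)
      omega
    refine ⟨P i - P l, by omega, ht.slot_eq hT hli (by omega) ?_⟩
    intro k hk hki
    by_contra hlt
    rcases le_or_gt i' k with h | h
    · exact hlt (hg k h hki)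
    · have := hmono.monotone (show k + 1 ≤ i' by omega)
      have := hmono.monotone hk
      omega
  have hK : n + 2 * d ≤ n * (2 * d + 1) := by
    rw [Nat.mul_succ]
    have := Nat.le_mul_of_pos_left (2 * d) hn
    omega
  set K := n * (2 * d + 1) with hKdef
  have hXK : ∀ i, X (K + i) = X i := fun i => by
    simp only [hX, hKdef, add_comm, Nat.add_mul_mod_self_left]
  have hPK : ∀ i, P (K + i) = P i + N * (2 * d + 1) := fun i => by
    rw [hKdef, add_comm, hP, unroll_add_mul hn]
  have hXx : ∀ i < n, X i = x i := fun i hi => by simp [hX, Nat.mod_eq_of_lt hi]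
  have hPp : ∀ i < n, P i = p i := fun i hi => unroll_of_lt hi
  refine ⟨x, p, fun i => C (K + i), ⟨hn, hA.lt_n, hA.start, hlast,
    fun i hi => hA.lt _ _ (Nat.lt_succ_self i) hi, ?_, ?_⟩, hgap, ?_⟩
  · intro i hi
    have := hmove (K + i) (by omega)
    rw [add_assoc, hXK, hXK, hPK, hPK, hXx _ hi, hXx _ (by omega), hPp _ hi, hPp _ (by omega),
      Nat.add_sub_add_right] at this
    exact this
  · have := hmove (K + (n - 1)) (by omega)
    have hPn : P n = N := by
      have := unroll_add_mul (N := N) (i := 0) (k := 1) (p := p) hn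
      rw [unroll_of_lt hn, hA.start] at this
      simpa using this
    have hK' : 2 * d < K + 0 := by omega
    have hCn : C (K + n) = C (K + 0) := by
      refine codeSeq_add (N := N) hB (fun i => by simp [hX]) (fun i => ?_) ht.lt_succ hK'
      have := unroll_add_mul (N := N) (i := i) (k := 1) (p := p) hn
      simpa using this
    rw [add_assoc, Nat.sub_add_cancel hn, hXK, hXK, hPK, hPK, hXx (n - 1) (by omega),
      hPp (n - 1) (by omega), Nat.add_sub_add_right, hPn, hCn] at this
    simpa [hX] using this
  · intro i
    show C (K + i) < _
    obtain ⟨k, hk⟩ : ∃ k, K + i = k + 1 := ⟨K + i - 1, by omega⟩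
    rw [hk]
    exact nextCode_lt hB

end CycleEmbedding

namespace CycleEmbedding

/-! ### The program -/

/-- The variables of the program. Those of the first line are parameters, with their values given by
`HasParams`. -/
inductive Var : Type
  | n | N | d | W | W1 | d1 | B | S | off | nn | nd | nS | RS | dB | dB1
  | i | j | k | l | m | e | f | z
  | x | y | c | t | g | b | v | q | r | p | cnt | done | x0 | c0 | cur | cc | dig | nc | ok | fnd | u | res
  deriving DecidableEq

/-- The register that holds a variable. -/
def Var.loc (a : Var) : ℕ := a.ctorIdx

theorem Var.loc_lt (a : Var) : a.loc < 45 := by cases a <;> decide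

theorem Var.loc_injective : Function.Injective Var.loc := by
  have h : ∀ a : Var, Var.ofNat a.loc = a := fun a => by cases a <;> rfl
  exact fun a b hab => by rw [← h a, hab, h b]

instance {ν : Type} : Add (Exp ν) := ⟨.add⟩
instance {ν : Type} : Sub (Exp ν) := ⟨.sub⟩
instance {ν : Type} : Mul (Exp ν) := ⟨.mul⟩
instance {ν : Type} : Div (Exp ν) := ⟨.div⟩

section eval

variable {ν : Type} (L : ℕ) (s : St ν)

theorem eval_var (v : ν) : (Exp.var v).eval L s = s.reg v := rfl
theorem eval_lit (k : ℕ) : (Exp.lit k : Exp ν).eval L s = k := rfl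
theorem eval_add (a b : Exp ν) : (a + b).eval L s = (a.eval L s + b.eval L s) % L := rfl
theorem eval_sub (a b : Exp ν) : (a - b).eval L s = a.eval L s - b.eval L s := rfl
theorem eval_mul (a b : Exp ν) : (a * b).eval L s = (a.eval L s * b.eval L s) % L := rfl
theorem eval_div (a b : Exp ν) : (a / b).eval L s = a.eval L s / b.eval L s := rfl
theorem eval_lt (a b : Exp ν) :
    (Exp.lt a b).eval L s = if a.eval L s < b.eval L s then 1 else 0 := rfl
theorem eval_eq (a b : Exp ν) :
    (Exp.eq a b).eval L s = if a.eval L s = b.eval L s then 1 else 0 := rfl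
theorem eval_load (a : Exp ν) : (Exp.load a).eval L s = s.mem (a.eval L s) := rfl

end eval

/-- Assignment to a variable. -/
infix:35 " ≔ " => Com.assign
/-- Composition of commands. -/
infixr:30 " ;; " => Com.seq

local notation "var" => Exp.var (ν := Var)
local notation "lit" => Exp.lit (ν := Var)

/-- The address of the entry `i` of the array `a`, when the arrays start at `o`. The eight arrays
are interleaved. -/
def cell (o a i : ℕ) : ℕ := o + (8 * i + a)

/-- The array `a` in a memory in which the arrays start at `o`. -/
def arr (o : ℕ) (m : ℕ → ℕ) (a i : ℕ) : ℕ := m (cell o a i)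

/-- The address of an entry of an array, as an expression. -/
def cellExp (a : ℕ) (e : Exp Var) : Exp Var := var .off + (lit 8 * e + lit a)

/-- The entry of an array. -/
def ld (a : ℕ) (e : Exp Var) : Exp Var := .load (cellExp a e)

/-- Assign a value to the entry of an array. -/
def st (a : ℕ) (e x : Exp Var) : Com Var := .store (cellExp a e) x

/-- The remainder of a division. -/
def rem (a b : Exp Var) : Exp Var := a - a / b * b

/-! The arrays are: 0 the distances, 1 and 2 the numberings of the balls, 3 the contents of a
window, 4 the numbers of vertices placed, 5 the predecessors of cells, 6 the powers of the base. -/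

/-- Read `n`, `N` and `d`. -/
def readInput : Com Var :=
  .n ≔ .load (lit 0) ;; .N ≔ .load (lit 1) ;; .d ≔ .load (lit 2) ;; .W ≔ var .d + var .d ;;
  .W1 ≔ var .W + lit 1 ;; .d1 ≔ var .d + lit 1 ;; .B ≔ lit 8 * (var .d * var .d1) ;; .S ≔ lit 1

/-- Compute the number `S` of codes. -/
def powerLoop : Com Var := .loop .i .W (.S ≔ var .S * var .B)

/-- Compute the bounds of loops, and the start of the arrays. -/
def deriveParams : Com Var :=
  .nn ≔ var .n * var .n ;; .off ≔ lit 3 + var .nn ;; .nS ≔ var .n * var .S ;;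
  .nd ≔ var .n * var .d ;; .RS ≔ var .nd * var .nS ;; .dB ≔ var .d * var .B ;;
  .dB1 ≔ var .d1 * var .B

/-- Tabulate the powers of the base. -/
def powTable : Com Var :=
  .t ≔ lit 1 ;; .loop .j .d (st 6 (var .j) (var .t) ;; .t ≔ var .t * var .B)

/-- Distances along paths without inner vertices. -/
def distInit : Com Var :=
  .loop .e .nn (.x ≔ var .e / var .n ;; .y ≔ rem (var .e) (var .n) ;;
    .ite (.eq (var .x) (var .y)) (st 0 (var .e) (lit 0))
      (.ite (.load (lit 3 + var .e)) (st 0 (var .e) (lit 1)) (st 0 (var .e) (var .n))))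

/-- The algorithm of Floyd and Warshall. -/
def floydWarshall : Com Var :=
  .loop .m .n (.loop .e .nn (.x ≔ var .e / var .n ;; .y ≔ rem (var .e) (var .n) ;;
    .t ≔ ld 0 (var .x * var .n + var .m) + ld 0 (var .m * var .n + var .y) ;;
    .ite (.lt (var .t) (ld 0 (var .e))) (st 0 (var .e) (var .t)) .skip))

/-- Number the vertices of all balls of radius `d`. A ball with too many vertices ends the search,
since then there is no embedding. -/
def numberBalls : Com Var :=
  .loop .e .nn (.x ≔ var .e / var .n ;; .y ≔ rem (var .e) (var .n) ;;
    .ite (var .y) .skip (.cnt ≔ lit 0) ;;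
    .ite (.lt (var .d) (ld 0 (var .e))) .skip (.cnt ≔ var .cnt + lit 1 ;;
      .ite (.lt (var .cnt) (var .B))
        (st 1 (var .e) (var .cnt) ;; st 2 (var .x * var .B + var .cnt) (var .y + lit 1))
        (.done ≔ lit 1)))

/-- Mark all cells as not reached. -/
def clearCells : Com Var := .loop .e .RS (st 4 (var .e) (lit 0))

/-- Compute the position, the last vertex and the code that belong to the cell `e`. -/
def unpack : Com Var :=
  .r ≔ var .e / var .S ;; .c ≔ rem (var .e) (var .S) ;; .p ≔ var .r / var .n ;;
  .x ≔ rem (var .r) (var .n)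

/-- Compute the contents of the window with last vertex `x` and code `c`. -/
def decode : Com Var :=
  .cur ≔ var .x ;; .cc ≔ var .c ;; st 3 (lit 0) (var .x + lit 1) ;;
  .loop .j .W (.q ≔ var .cc / var .B ;; .dig ≔ var .cc - var .q * var .B ;; .cc ≔ var .q ;;
    .ite (var .dig)
      (.cur ≔ ld 2 (var .cur * var .B + var .dig) - lit 1 ;;
        st 3 (var .j + lit 1) (var .cur + lit 1))
      (st 3 (var .j + lit 1) (lit 0)))

/-- Look for the vertex `u - 1` among the first `j + d` entries of the window. -/
def findInWindow : Com Var :=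
  .fnd ≔ lit 0 ;; .loop .l .W1 (.ite (.lt (var .j + var .d) (var .l)) .skip
    (.ite (.eq (ld 3 (var .l)) (var .u)) (.fnd ≔ lit 1) .skip))

/-- Test whether the window may be moved by `g` positions. -/
def checkWindow : Com Var :=
  .ok ≔ lit 1 ;; .loop .i .dB1 (.j ≔ var .i / var .B ;; .k ≔ rem (var .i) (var .B) ;;
    .y ≔ ld 3 (var .j) ;;
    .ite (.lt (var .d) (var .g + var .j)) (.ite (var .y) (.y ≔ var .y - lit 1 ;;
      .u ≔ ld 2 (var .y * var .B + var .k) ;;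
      .ite (var .u) (.ite (.eq (ld 0 (var .y * var .n + (var .u - lit 1))) (lit 1))
        (findInWindow ;; .ite (var .fnd) .skip (.ok ≔ lit 0)) .skip) .skip) .skip) .skip)

/-- Compute the code of the window after a move by `g ≤ d` positions to the vertex `v`. -/
def newCode : Com Var :=
  .t ≔ ld 6 (var .g - lit 1) ;;
  .nc ≔ var .c * (var .t * var .B) + ld 1 (var .v * var .n + var .x) * var .t ;;
  .nc ≔ rem (var .nc) (var .S)

/-- Record that the cell `r` can be reached from the cell `e`. -/
def relaxCell : Com Var :=
  .t ≔ ld 4 (var .r) ;;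
  .ite (.eq (var .t) (lit 0) + .lt (var .cnt + lit 1) (var .t))
    (st 4 (var .r) (var .cnt + lit 1) ;; st 5 (var .r) (var .e)) .skip

/-- Try the move number `f` from the cell `e`. -/
def tryMove : Com Var :=
  .g ≔ var .f / var .B + lit 1 ;; .b ≔ rem (var .f) (var .B) ;;
  .v ≔ ld 2 (var .x * var .B + var .b) ;;
  .ite (var .v) (.v ≔ var .v - lit 1 ;; .q ≔ var .p + var .g ;;
    .ite (.lt (var .q) (var .N) * (.lt (var .q) (var .nd) *
        (lit 1 - .lt (var .g) (ld 0 (var .x * var .n + var .v)))))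
      (checkWindow ;; .ite (var .ok) (newCode ;;
        .r ≔ (var .q * var .n + var .v) * var .S + var .nc ;; relaxCell) .skip) .skip) .skip

/-- Find the least numbers of vertices with which the cells can be reached. -/
def reachPass : Com Var :=
  .loop .e .RS (.cnt ≔ ld 4 (var .e) ;;
    .ite (var .cnt) (unpack ;; decode ;; .loop .f .dB tryMove) .skip)

/-- Write the embedding that ends with the cell before `res`. -/
def writeOutput : Com Var :=
  .store (lit 0) (lit 1) ;; .r ≔ var .res - lit 1 ;;
  .loop .i .n (.t ≔ var .r / var .S ;; .u ≔ var .t / var .n ;; .y ≔ rem (var .t) (var .n) ;;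
    .store (lit 1 + var .y) (var .u) ;; .r ≔ ld 5 (var .r))

/-- Look for a cell that is reached with `n` vertices and from which the start is reached, and keep
its successor in `res`. -/
def closePass : Com Var :=
  .loop .e .RS (.ite (.eq (var .done) (lit 0) * .eq (ld 4 (var .e)) (var .n))
    (unpack ;; decode ;; .g ≔ var .N - var .p ;; .v ≔ var .x0 ;;
      .ite (.lt (var .g) (ld 0 (var .x * var .n + var .v))) .skip
        (checkWindow ;; .ite (var .ok)
          (.ite (.lt (var .d) (var .g)) (.nc ≔ lit 0) newCode ;;
            .ite (.eq (var .nc) (var .c0)) (.done ≔ lit 1 ;; .res ≔ var .e + lit 1) .skip) .skip)) .skip)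

/-- Search for an embedding that starts with the window number `z`. -/
def searchFrom : Com Var :=
  .x0 ≔ var .z / var .S ;; .c0 ≔ rem (var .z) (var .S) ;; clearCells ;; st 4 (var .z) (lit 1) ;;
  reachPass ;; closePass

/-- The computation after the parameters are known. -/
def mainPart : Com Var :=
  .store (lit 0) (lit 0) ;; powTable ;; distInit ;; floydWarshall ;; numberBalls ;;
  .loop .z .nS (.ite (var .done) .skip searchFrom) ;; .ite (var .res) writeOutput .skip

/-- The variables that the main part does not change. -/
def isParam : Var → Bool
  | .n | .N | .d | .W | .W1 | .d1 | .B | .S | .off | .nn | .nd | .nS | .RS | .dB | .dB1 => true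
  | _ => false

theorem readInput_ok : readInput.ok (fun _ => false) = true := by decide
theorem powerLoop_ok : powerLoop.ok (fun v => v = .W) = true := by decide
theorem deriveParams_ok : deriveParams.ok (fun _ => false) = true := by decide
theorem mainPart_ok : mainPart.ok isParam = true := by decide

/-- The program. -/
def program : WordRAM.Program :=
  readInput.code Var.loc 45 0 ++ (powerLoop.code Var.loc 45 readInput.len ++
    (deriveParams.code Var.loc 45 (readInput.len + powerLoop.len) ++
      mainPart.code Var.loc 45 (readInput.len + powerLoop.len + deriveParams.len)))

/-! ### States of the main part -/

/-- The base `B` of the codes of windows. It is larger than the number of vertices of a ball of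
radius `d` in a graph that has an embedding of distortion `d`, which is at most `2 * d * d + 1`. -/
def base (d : ℕ) : ℕ := 4 * d * (2 * d + 2)

/-- The parameters of the computation, and a length of words that suffices for it. -/
structure Sizes (n N d B S L : ℕ) : Prop where
  n_pos : 1 ≤ n
  d_pos : 1 ≤ d
  three_le : 3 ≤ N
  base_ge : 2 * d * d + 3 ≤ B
  base_ge' : 2 * d + 2 ≤ B
  S_eq : S = B ^ (2 * d)
  cells : 3 + n * n + 8 * (n * d * (n * S)) + 8 < L
  codes : 2 * (S * S) < L
  N_lt : N + 2 * n + 2 * d + 2 < L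

/-- The values of the parameters in a state of the main part. -/
structure HasParams (n N d B S : ℕ) (s : St Var) : Prop where
  hn : s.reg .n = n
  hN : s.reg .N = N
  hd : s.reg .d = d
  hW : s.reg .W = 2 * d
  hW1 : s.reg .W1 = 2 * d + 1
  hd1 : s.reg .d1 = d + 1
  hB : s.reg .B = B
  hS : s.reg .S = S
  hoff : s.reg .off = 3 + n * n
  hnn : s.reg .nn = n * n
  hnd : s.reg .nd = n * d
  hnS : s.reg .nS = n * S
  hRS : s.reg .RS = n * d * (n * S)
  hdB : s.reg .dB = d * B
  hdB1 : s.reg .dB1 = (d + 1) * B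

theorem HasParams.of_eq {n N d B S : ℕ} {s s' : St Var} (h : HasParams n N d B S s)
    (hs : ∀ v, isParam v → s'.reg v = s.reg v) : HasParams n N d B S s' := by
  constructor <;> rw [hs _ rfl]
  exacts [h.hn, h.hN, h.hd, h.hW, h.hW1, h.hd1, h.hB, h.hS, h.hoff, h.hnn, h.hnd, h.hnS, h.hRS,
    h.hdB, h.hdB1]

theorem HasParams.den {n N d B S : ℕ} {s : St Var} (h : HasParams n N d B S s) {L : ℕ}
    {c : Com Var} (hc : c.ok isParam) : HasParams n N d B S (c.den L s) :=
  h.of_eq fun _ hv => c.den_reg L (Com.not_mem_writes hc hv) s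

/-- The memories `m` and `m'` differ only in the arrays with numbers in `K`. -/
def Unchanged (K : List ℕ) (o : ℕ) (m m' : ℕ → ℕ) : Prop :=
  ∀ q, (q < o ∨ (q - o) % 8 ∉ K) → m' q = m q

theorem Unchanged.refl (K : List ℕ) (o : ℕ) (m : ℕ → ℕ) : Unchanged K o m m := fun _ _ => rfl

theorem Unchanged.trans {K : List ℕ} {o : ℕ} {m m' m'' : ℕ → ℕ} (h : Unchanged K o m m')
    (h' : Unchanged K o m' m'') : Unchanged K o m m'' := fun q hq => (h' q hq).trans (h q hq)

theorem Unchanged.arr {K : List ℕ} {o : ℕ} {m m' : ℕ → ℕ} (h : Unchanged K o m m') {a : ℕ}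
    (ha : a < 8) (haK : a ∉ K) : arr o m' a = arr o m a := by
  funext i
  refine h _ (.inr ?_)
  rwa [cell, Nat.add_sub_cancel_left, Nat.mul_add_mod, Nat.mod_eq_of_lt ha]

theorem Unchanged.update {K : List ℕ} {o a i x : ℕ} {m m' : ℕ → ℕ} (h : Unchanged K o m m')
    (ha : a < 8) (haK : a ∈ K) : Unchanged K o m (Function.update m' (cell o a i) x) := by
  intro q hq
  rw [Function.update_of_ne, h q hq]
  rintro rfl
  rcases hq with hq | hq
  · simp [cell] at hq
  · rw [cell, Nat.add_sub_cancel_left, Nat.mul_add_mod, Nat.mod_eq_of_lt ha] at hq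
    exact hq haK

theorem arr_update (o a i x : ℕ) (m : ℕ → ℕ) :
    arr o (Function.update m (cell o a i) x) a = Function.update (arr o m a) i x := by
  funext j
  simp only [arr, Function.update_apply, cell]
  congr 1
  simp

theorem arr_update_of_ne {o a a' i x : ℕ} {m : ℕ → ℕ} (h : a ≠ a') (ha : a < 8) (ha' : a' < 8) :
    arr o (Function.update m (cell o a i) x) a' = arr o m a' := by
  funext j
  simp only [arr, cell]
  rw [Function.update_of_ne]
  omega

theorem arr_update_low {o q x : ℕ} {m : ℕ → ℕ} (h : q < o) (a : ℕ) :
    arr o (Function.update m q x) a = arr o m a := by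
  funext j
  simp only [arr, cell]
  rw [Function.update_of_ne]
  omega

theorem eval_cellExp {L : ℕ} {s : St Var} {a : ℕ} {e : Exp Var}
    (h : cell (s.reg .off) a (e.eval L s) < L) :
    (cellExp a e).eval L s = cell (s.reg .off) a (e.eval L s) := by
  simp only [cell] at *
  simp only [cellExp, eval_add, eval_mul, eval_var, eval_lit]
  rw [Nat.mod_eq_of_lt (a := 8 * _) (by omega), Nat.mod_eq_of_lt (a := 8 * _ + _) (by omega),
    Nat.mod_eq_of_lt h]

theorem eval_ld {L : ℕ} {s : St Var} {a : ℕ} {e : Exp Var}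
    (h : cell (s.reg .off) a (e.eval L s) < L) :
    (ld a e).eval L s = arr (s.reg .off) s.mem a (e.eval L s) := by
  rw [ld, eval_load, eval_cellExp h, arr]

theorem den_st {L : ℕ} {s : St Var} {a : ℕ} {e x : Exp Var}
    (h : cell (s.reg .off) a (e.eval L s) < L) :
    (st a e x).den L s =
      ⟨s.reg, Function.update s.mem (cell (s.reg .off) a (e.eval L s)) (x.eval L s)⟩ := by
  rw [st, Com.den, eval_cellExp h]

theorem eval_rem {L : ℕ} {s : St Var} {a b : Exp Var} (h : a.eval L s < L) :
    (rem a b).eval L s = a.eval L s % b.eval L s := by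
  rw [rem, eval_sub, eval_mul, eval_div, Nat.mod_eq_of_lt, Nat.mod_eq_sub_div_mul]
  exact (Nat.div_mul_le_self _ _).trans_lt h

end CycleEmbedding

namespace CycleEmbedding

/-! ### Computing the distances -/

theorem flat_div {i j n : ℕ} (hj : j < n) : (i * n + j) / n = i := by
  rw [mul_comm, Nat.mul_add_div (by omega), Nat.div_eq_of_lt hj, add_zero]

theorem flat_mod {i j n : ℕ} (hj : j < n) : (i * n + j) % n = j := by
  rw [Nat.mul_add_mod', Nat.mod_eq_of_lt hj]

theorem flat_lt {i j n a : ℕ} (hi : i < a) (hj : j < n) : i * n + j < a * n := by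
  have := Nat.mul_le_mul_right n hi
  rw [Nat.succ_mul] at this
  omega

theorem flat_eq (k n : ℕ) : k / n * n + k % n = k := Nat.div_add_mod' k n

/-- The matrices in the algorithm of Floyd and Warshall: after `m` rounds, paths may have their inner
vertices in `{0, …, m - 1}`. -/
def fw (D : ℕ → ℕ → ℕ) : ℕ → ℕ → ℕ → ℕ
  | 0 => D
  | m + 1 => fun i j => min (fw D m i j) (fw D m i m + fw D m m j)

theorem fw_self {D : ℕ → ℕ → ℕ} (hD : ∀ i, D i i = 0) (m i : ℕ) : fw D m i i = 0 := by
  induction m with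
  | zero => exact hD i
  | succ m ih => simp [fw, ih]

theorem fw_le {D : ℕ → ℕ → ℕ} (m i j : ℕ) : fw D m i j ≤ D i j := by
  induction m with
  | zero => exact le_rfl
  | succ m ih => exact (min_le_left _ _).trans ih

theorem fw_triangle {D : ℕ → ℕ → ℕ} (hD : ∀ i, D i i = 0) {m k : ℕ} (hk : k < m) (i j : ℕ) :
    fw D m i j ≤ fw D m i k + fw D m k j := by
  induction m generalizing i j with
  | zero => omega
  | succ m ih =>
    have h₀ := fw_self hD m m
    simp only [fw]
    rcases Nat.lt_succ_iff_lt_or_eq.1 hk with hk | rfl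
    · have h₁ := ih hk i j
      have h₂ := ih hk i m
      have h₃ := ih hk m j
      omega
    · omega

/-- The matrix from which the algorithm of Floyd and Warshall starts. The number `n` stands for an
infinite distance, since all distances in a connected graph are smaller. -/
noncomputable def initDist {n : ℕ} (G : SimpleGraph (Fin n)) (i j : ℕ) : ℕ :=
  if i = j then 0 else if gdist G i j = 1 then 1 else n

/-- After `n` rounds, the distances are those of the graph. -/
theorem fw_eq_gdist {n : ℕ} {G : SimpleGraph (Fin n)} (hG : G.Connected) {i j : ℕ} (hi : i < n)
    (hj : j < n) : fw (initDist G) n i j = gdist G i j := by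
  have hself : ∀ i, initDist G i i = 0 := fun i => by simp [initDist]
  apply le_antisymm
  · have key : ∀ (u v : Fin n) (p : G.Walk u v), fw (initDist G) n u.val v.val ≤ p.length := by
      intro u v p
      induction p with
      | nil => simp [fw_self hself]
      | @cons u w v h p ih =>
        have h₁ := fw_triangle hself w.2 u.val v.val
        have h₂ := fw_le (D := initDist G) n u.val w.val
        have h₃ : initDist G u.val w.val ≤ 1 := by
          have : gdist G u.val w.val = 1 := by rwa [gdist_val, SimpleGraph.dist_eq_one_iff_adj]
          rw [initDist, if_pos this]
          split
          · omega
          · exact le_rfl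
        rw [SimpleGraph.Walk.length_cons]
        omega
    obtain ⟨p, hp⟩ := hG.exists_walk_length_eq_dist ⟨i, hi⟩ ⟨j, hj⟩
    rw [gdist_of_lt hi hj, ← hp]
    exact key _ _ p
  · have key : ∀ m ≤ n, ∀ i < n, ∀ j < n, gdist G i j ≤ fw (initDist G) m i j := by
      intro m
      induction m with
      | zero =>
        intro _ i hi j hj
        simp only [fw, initDist]
        have := gdist_lt hG i j (by omega)
        split_ifs with h₁ h₂
        · rw [h₁, gdist_self]
        · exact h₂.le
        · exact this.le
      | succ m ih =>
        intro hm i hi j hj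
        have h₁ := ih (by omega) i hi j hj
        have h₂ := ih (by omega) i hi m (by omega)
        have h₃ := ih (by omega) m (by omega) j hj
        have h₄ := gdist_triangle hG hi (show m < n by omega) hj
        simp only [fw]
        omega
    exact key n le_rfl i hi j hj

namespace Sizes

variable {n N d B S L : ℕ}

theorem nn_le (h : Sizes n N d B S L) : n * n ≤ n * d * (n * S) := by
  have h₁ := h.n_pos
  have h₂ := h.d_pos
  have h₃ : 1 ≤ S := by
    rw [h.S_eq]
    exact Nat.one_le_pow _ _ (by have := h.base_ge; omega)
  exact Nat.mul_le_mul (Nat.le_mul_of_pos_right _ h₂) (Nat.le_mul_of_pos_right _ h₃)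

theorem B_pos (h : Sizes n N d B S L) : 0 < B := by
  have := h.base_ge
  omega

theorem S_pos (h : Sizes n N d B S L) : 0 < S := by
  rw [h.S_eq]
  exact Nat.pow_pos h.B_pos

theorem pow_le (h : Sizes n N d B S L) {k : ℕ} (hk : k ≤ 2 * d) : B ^ k ≤ S := by
  rw [h.S_eq]
  exact Nat.pow_le_pow_right h.B_pos hk

theorem B_le (h : Sizes n N d B S L) : B ≤ S := by
  have := h.d_pos
  simpa using h.pow_le (k := 1) (by omega)

theorem nB_le (h : Sizes n N d B S L) : n * B ≤ n * d * (n * S) := by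
  have h₁ := h.n_pos
  have h₂ := h.d_pos
  exact Nat.mul_le_mul (Nat.le_mul_of_pos_right _ h₂)
    (h.B_le.trans (Nat.le_mul_of_pos_left _ h₁))

theorem S_le (h : Sizes n N d B S L) : S ≤ n * d * (n * S) := by
  have h₁ := h.n_pos
  have h₂ := h.d_pos
  rw [← mul_assoc]
  exact Nat.le_mul_of_pos_left _ (by positivity)

theorem cell_lt (h : Sizes n N d B S L) {a i : ℕ} (ha : a < 8) (hi : i < n * d * (n * S)) :
    cell (3 + n * n) a i < L := by
  have := h.cells
  rw [cell]
  omega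

end Sizes

section

variable {n N d B S L : ℕ} {s : St Var}

theorem den_seq (c₁ c₂ : Com Var) (s : St Var) :
    (c₁ ;; c₂).den L s = c₂.den L (c₁.den L s) := rfl

/-- The invariant rule for loops that do not change the parameters. -/
theorem loop_rule {i b : Var} {c : Com Var} {K : ℕ} (hok : (Com.loop i b c).ok isParam)
    (hp : HasParams n N d B S s) (hK : s.reg b = K) (I : ℕ → St Var → Prop)
    (hI : ∀ k s x, I k s → I k (s.set i x)) (h0 : I 0 s)
    (hs : ∀ k s', k < K → s'.reg i = k → HasParams n N d B S s' →
      (∀ v, v ∉ (Com.loop i b c).writes → s'.reg v = s.reg v) → I k s' → I (k + 1) (c.den L s')) :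
    I K ((Com.loop i b c).den L s) := by
  rw [← hK]
  exact Com.den_loop I hI h0 fun k s' hk hi hfr h =>
    hs k s' (hK ▸ hk) hi (hp.of_eq fun v hv => hfr v (Com.not_mem_writes hok hv)) hfr h

theorem powTable_spec (hz : Sizes n N d B S L) (hp : HasParams n N d B S s) :
    Unchanged [6] (3 + n * n) s.mem (powTable.den L s).mem ∧
      ∀ i < d, arr (3 + n * n) (powTable.den L s).mem 6 i = B ^ i := by
  have hcodes := hz.codes
  have hB := hz.B_pos
  let I : ℕ → St Var → Prop := fun k s' => s'.reg .t = B ^ k ∧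
    Unchanged [6] (3 + n * n) s.mem s'.mem ∧ ∀ i < k, arr (3 + n * n) s'.mem 6 i = B ^ i
  have hS : S ≤ S * S := Nat.le_mul_self S
  suffices h : I d (powTable.den L s) from h.2
  have hp₁ : HasParams n N d B S (s.set .t 1) := hp.of_eq fun v hv => by
    rw [St.set_reg, if_neg]
    rintro rfl
    exact absurd hv (by decide)
  refine loop_rule (s := s.set .t 1) (by decide) hp₁ hp₁.hd I ?_ ?_ ?_
  · rintro k s' x ⟨h₁, h₂, h₃⟩
    exact ⟨by simpa [St.set_reg] using h₁, h₂, h₃⟩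
  · exact ⟨by simp [St.set_reg], Unchanged.refl _ _ _, by simp⟩
  · rintro k s' hk hj hp' hfr ⟨h₁, h₂, h₃⟩
    have ho := hp'.hoff
    have hB' := hp'.hB
    have hkS : k < n * d * (n * S) := by
      have := hz.S_le
      have := hz.pow_le (k := k) (by omega)
      have := Nat.lt_pow_self (n := k) (show 1 < B by have := hz.base_ge; omega)
      omega
    rw [Com.den, den_st (by rw [ho, eval_var, hj]; exact hz.cell_lt (by decide) hkS)]
    simp only [Com.den, eval_var, ho, hj, eval_mul, h₁, hB']
    refine ⟨?_, ?_, ?_⟩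
    · have := hz.pow_le (k := k + 1) (by omega)
      simp only [St.set_reg, if_true]
      rw [← pow_succ, Nat.mod_eq_of_lt (by omega)]
    · exact h₂.update (by decide) (by simp)
    · intro i hi
      simp only [St.set_mem, arr_update, Function.update_apply]
      split
      · subst_vars; rfl
      · exact h₃ i (by omega)

/-- The adjacency matrix of `G` stands in the memory cells from `3` on. -/
def HasInput {n : ℕ} (G : SimpleGraph (Fin n)) (m : ℕ → ℕ) : Prop :=
  ∀ i < n, ∀ j < n, m (3 + (i * n + j)) = if gdist G i j = 1 then 1 else 0

theorem den_quot_rem (hz : Sizes n N d B S L) (hp : HasParams n N d B S s) {e : ℕ}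
    (he : s.reg .e = e) (hlt : e < n * n) (c : Com Var) :
    (.x ≔ .var .e / .var .n ;; .y ≔ rem (.var .e) (.var .n) ;; c).den L s =
      c.den L ((s.set .x (e / n)).set .y (e % n)) := by
  have := hz.cells
  rw [den_seq, den_seq]
  congr 1
  simp only [Com.den]
  rw [eval_rem]
  · simp [eval_var, eval_div, St.set_reg, he, hp.hn]
  · simp [eval_var, St.set_reg, he]
    omega

/-- Before the first round, the table holds the lengths of the paths without inner vertices. -/
theorem distInit_spec {G : SimpleGraph (Fin n)} (hz : Sizes n N d B S L)
    (hp : HasParams n N d B S s) (hin : HasInput G s.mem) :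
    Unchanged [0] (3 + n * n) s.mem (distInit.den L s).mem ∧
      ∀ e < n * n, arr (3 + n * n) (distInit.den L s).mem 0 e = initDist G (e / n) (e % n) := by
  have hn := hz.n_pos
  have hcells := hz.cells
  have hnn := hz.nn_le
  let I : ℕ → St Var → Prop := fun k s' =>
    Unchanged [0] (3 + n * n) s.mem s'.mem ∧
      ∀ e < k, arr (3 + n * n) s'.mem 0 e = initDist G (e / n) (e % n)
  suffices h : I (n * n) (distInit.den L s) from h
  refine loop_rule (by decide) hp hp.hnn I (fun k s' x h => h) ⟨Unchanged.refl _ _ _, by simp⟩ ?_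
  · rintro k s' hk he hp' hfr ⟨h₂, h₃⟩
    rw [den_quot_rem hz hp' he hk]
    set s₁ := (s'.set .x (k / n)).set .y (k % n) with hs₁
    have ho : s₁.reg .off = 3 + n * n := by simp [hs₁, St.set_reg, hp'.hoff]
    have e₁ : s₁.reg .e = k := by simp [hs₁, St.set_reg, he]
    have hst : ∀ x : Exp Var, (st 0 (.var .e) x).den L s₁ =
        ⟨s₁.reg, Function.update s'.mem (cell (3 + n * n) 0 k) (x.eval L s₁)⟩ := fun x => by
      rw [den_st, eval_var, ho, e₁]
      · rfl
      · rw [eval_var, ho, e₁]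
        exact hz.cell_lt (by decide) (by omega)
    have hx : (Com.den L (.ite (.eq (.var .x) (.var .y)) (st 0 (.var .e) (.lit 0))
        (.ite (.load (.lit 3 + .var .e)) (st 0 (.var .e) (.lit 1)) (st 0 (.var .e) (.var .n)))) s₁) =
        ⟨s₁.reg, Function.update s'.mem (cell (3 + n * n) 0 k) (initDist G (k / n) (k % n))⟩ := by
      have h₄ := hin (k / n) (Nat.div_lt_of_lt_mul hk) (k % n) (Nat.mod_lt _ hn)
      rw [flat_eq, ← h₂ _ (.inl (by omega))] at h₄
      have h₅ : (Exp.load (.lit 3 + .var .e)).eval L s₁ = s'.mem (3 + k) := by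
        rw [eval_load, eval_add, eval_lit, eval_var, e₁, Nat.mod_eq_of_lt (by omega)]
        rfl
      simp only [Com.den, hst, h₅, h₄, eval_eq, eval_var, eval_lit, initDist]
      simp only [hs₁, St.set_reg]
      by_cases h₆ : k / n = k % n
      · simp [h₆]
      · by_cases h₇ : gdist G (k / n) (k % n) = 1
        · simp [h₆, h₇]
        · simp [h₆, h₇, hp'.hn]
    rw [hx]
    refine ⟨h₂.update (by decide) (by simp), fun e he => ?_⟩
    simp only [arr_update, Function.update_apply]
    split
    · subst_vars; rfl
    · exact h₃ e (by omega)

theorem HasParams.set {v : Var} (hp : HasParams n N d B S s) (hv : isParam v = false) (x : ℕ) :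
    HasParams n N d B S (s.set v x) :=
  hp.of_eq fun u hu => by
    rw [St.set_reg, if_neg]
    rintro rfl
    rw [hv] at hu
    exact absurd hu (by decide)

theorem floydWarshall_spec {G : SimpleGraph (Fin n)} (hG : G.Connected) (hz : Sizes n N d B S L)
    (hp : HasParams n N d B S s)
    (hD : ∀ e < n * n, arr (3 + n * n) s.mem 0 e = initDist G (e / n) (e % n)) :
    Unchanged [0] (3 + n * n) s.mem (floydWarshall.den L s).mem ∧
      ∀ e < n * n, arr (3 + n * n) (floydWarshall.den L s).mem 0 e = gdist G (e / n) (e % n) := by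
  have hn := hz.n_pos
  have hcells := hz.cells
  have hnn := hz.nn_le
  have hN := hz.N_lt
  have hself : ∀ i, initDist G i i = 0 := fun i => by simp [initDist]
  have hle : ∀ m i j, fw (initDist G) m i j ≤ n := fun m i j => (fw_le _ _ _).trans (by
    rw [initDist]
    split_ifs <;> omega)
  let I : ℕ → St Var → Prop := fun k s' =>
    Unchanged [0] (3 + n * n) s.mem s'.mem ∧
      ∀ e < n * n, arr (3 + n * n) s'.mem 0 e = fw (initDist G) k (e / n) (e % n)
  suffices h : I n (floydWarshall.den L s) from
    ⟨h.1, fun e he => by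
      rw [h.2 e he, fw_eq_gdist hG (Nat.div_lt_of_lt_mul he) (Nat.mod_lt _ hn)]⟩
  refine loop_rule (by decide) hp hp.hn I (fun k s' x h => h) ⟨Unchanged.refl _ _ _, hD⟩ ?_
  rintro m s₀ hm hm₀ hp₀ hfr₀ ⟨hu₀, hD₀⟩
  let J : ℕ → St Var → Prop := fun k s' =>
    Unchanged [0] (3 + n * n) s.mem s'.mem ∧
      ∀ e < n * n, arr (3 + n * n) s'.mem 0 e =
        fw (initDist G) (if e < k then m + 1 else m) (e / n) (e % n)
  suffices h : J (n * n) (Com.den L _ s₀) from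
    ⟨h.1, fun e he => by rw [h.2 e he, if_pos he]⟩
  refine loop_rule (by decide) hp₀ hp₀.hnn J (fun k s' x h => h) ⟨hu₀, by simpa using hD₀⟩ ?_
  rintro k s' hk he hp' hfr ⟨h₂, h₃⟩
  rw [den_quot_rem hz hp' he hk]
  have hx : k / n < n := Nat.div_lt_of_lt_mul hk
  have hy : k % n < n := Nat.mod_lt _ hn
  set s₁ := (s'.set .x (k / n)).set .y (k % n) with hs₁
  have hp₁ : HasParams n N d B S s₁ := (hp'.set rfl _).set rfl _
  have hm₁ : s₁.reg .m = m := by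
    simp [hs₁, St.set_reg, hfr .m (by decide), hm₀]
  have hx₁ : s₁.reg .x = k / n := by simp [hs₁, St.set_reg]
  have hy₁ : s₁.reg .y = k % n := by simp [hs₁, St.set_reg]
  have he₁ : s₁.reg .e = k := by simp [hs₁, St.set_reg, he]
  have hlt₁ := flat_lt hx hm
  have hlt₂ := flat_lt hm hy
  -- row and column `m` do not change in round `m`
  have hrow : ∀ j, ∀ b : Bool, fw (initDist G) (if b then m + 1 else m) m j = fw (initDist G) m m j := by
    intro j b
    have := fw_self hself m m
    cases b <;> simp [fw, this]
  have hcol : ∀ j, ∀ b : Bool, fw (initDist G) (if b then m + 1 else m) j m = fw (initDist G) m j m := by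
    intro j b
    have := fw_self hself m m
    cases b <;> simp [fw, this]
  have l₁ : (ld 0 (.var .x * .var .n + .var .m)).eval L s₁ = fw (initDist G) m (k / n) m := by
    have h : (Exp.var Var.x * .var .n + .var .m).eval L s₁ = k / n * n + m := by
      simp only [eval_add, eval_mul, eval_var, hx₁, hm₁, hp₁.hn]
      rw [Nat.mod_eq_of_lt (a := _ * _) (by omega), Nat.mod_eq_of_lt (by omega)]
    rw [eval_ld, h, hp₁.hoff]
    · have := h₃ _ hlt₁
      rw [flat_div hm, flat_mod hm] at this
      exact this.trans (by simpa using hcol (k / n) (decide (k / n * n + m < k)))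
    · rw [h, hp₁.hoff]
      exact hz.cell_lt (by decide) (by omega)
  have l₂ : (ld 0 (.var .m * .var .n + .var .y)).eval L s₁ = fw (initDist G) m m (k % n) := by
    have h : (Exp.var Var.m * .var .n + .var .y).eval L s₁ = m * n + k % n := by
      simp only [eval_add, eval_mul, eval_var, hy₁, hm₁, hp₁.hn]
      rw [Nat.mod_eq_of_lt (a := _ * _) (by omega), Nat.mod_eq_of_lt (by omega)]
    rw [eval_ld, h, hp₁.hoff]
    · have := h₃ _ hlt₂
      rw [flat_div hy, flat_mod hy] at this
      exact this.trans (by simpa using hrow (k % n) (decide (m * n + k % n < k)))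
    · rw [h, hp₁.hoff]
      exact hz.cell_lt (by decide) (by omega)
  have le₁ := hle m (k / n) m
  have le₂ := hle m m (k % n)
  rw [den_seq, Com.den, eval_add, l₁, l₂, Nat.mod_eq_of_lt (by omega)]
  set t := fw (initDist G) m (k / n) m + fw (initDist G) m m (k % n) with ht
  have hcell : cell (3 + n * n) 0 k < L := hz.cell_lt (by decide) (by omega)
  have e₁ : (s₁.set .t t).reg .e = k := by simp [St.set_reg, he₁]
  have e₂ : (s₁.set .t t).reg .off = 3 + n * n := by simp [St.set_reg, hp₁.hoff]
  have e₃ : (s₁.set .t t).reg .t = t := by simp [St.set_reg]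
  have hk₃ := h₃ k hk
  rw [if_neg (lt_irrefl k)] at hk₃
  rw [Com.den, eval_lt, eval_ld (by rw [eval_var, e₁, e₂]; exact hcell),
    den_st (by rw [eval_var, e₁, e₂]; exact hcell)]
  simp only [eval_var, e₁, e₂, e₃, St.set_mem, show s₁.mem = s'.mem from rfl, hk₃]
  by_cases h : t < fw (initDist G) m (k / n) (k % n)
  · rw [if_pos h, if_neg one_ne_zero]
    refine ⟨h₂.update (by decide) (by simp), fun e he' => ?_⟩
    simp only [arr_update, Function.update_apply]
    split
    · subst e
      rw [if_pos (by omega)]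
      exact (min_eq_right h.le).symm
    · rw [h₃ e he']
      congr 1
      exact if_congr (by omega) rfl rfl
  · rw [if_neg h, if_pos rfl]
    refine ⟨h₂, fun e he' => ?_⟩
    show arr _ s'.mem 0 e = _
    by_cases hek : e = k
    · subst e
      rw [hk₃, if_pos (by omega)]
      exact (min_eq_left (by omega)).symm
    · rw [h₃ e he']
      congr 1
      exact if_congr (by omega) rfl rfl

end

end CycleEmbedding

namespace CycleEmbedding

/-! ### Numbering the vertices of balls -/

/-- The number of vertices smaller than `y` in the ball of radius `d` around `x`. -/
noncomputable def rank {n : ℕ} (G : SimpleGraph (Fin n)) (d x y : ℕ) : ℕ :=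
  ((Finset.range y).filter fun z => gdist G x z ≤ d).card

section rank

variable {n : ℕ} {G : SimpleGraph (Fin n)} {d x y y' : ℕ}

theorem rank_zero : rank G d x 0 = 0 := by simp [rank]

theorem rank_succ_of_le (h : gdist G x y ≤ d) : rank G d x (y + 1) = rank G d x y + 1 := by
  rw [rank, Finset.range_add_one, Finset.filter_insert, if_pos h, Finset.card_insert_of_notMem]
  · rfl
  · simp

theorem rank_succ_of_lt (h : d < gdist G x y) : rank G d x (y + 1) = rank G d x y := by
  rw [rank, Finset.range_add_one, Finset.filter_insert, if_neg (by omega)]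
  rfl

theorem rank_mono (h : y ≤ y') : rank G d x y ≤ rank G d x y' :=
  Finset.card_le_card (Finset.filter_subset_filter _ (Finset.range_mono h))

theorem rank_le : rank G d x y ≤ y :=
  (Finset.card_filter_le _ _).trans (Finset.card_range y).le

/-- If there is an embedding, the balls of radius `d` have at most `2 * d * d + 1` vertices, since
they are mapped into arcs of radius `d * d`. -/
theorem rank_le_of_embedding {N : ℕ} (hG : G.Connected) (hN : 3 ≤ N) {F : Fin n → Fin N}
    (hF : IsNonContractingEmbedding G (SimpleGraph.cycleGraph N) d F) (hx : x < n) :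
    rank G d x n ≤ 2 * d * d + 1 := by
  have hinj : Function.Injective F := by
    intro u v huv
    have := (hF u v).1
    rw [huv, SimpleGraph.dist_self, Nat.le_zero] at this
    exact (hG.dist_eq_zero_iff).1 this
  have ha := (F ⟨x, hx⟩).2
  let q : ℕ → ℕ := fun z => if h : z < n then arc N (F ⟨x, hx⟩).val (F ⟨z, h⟩).val else 0
  have hq : ∀ z (h : z < n), q z = arc N (F ⟨x, hx⟩).val (F ⟨z, h⟩).val := fun z h => dif_pos h
  have hle : ∀ z, z < n → gdist G x z ≤ d → q z < N ∧ (q z ≤ d * d ∨ N ≤ q z + d * d) := by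
    intro z hz hd
    have h₁ := (hF ⟨x, hx⟩ ⟨z, hz⟩).2
    rw [gdist_of_lt hx hz] at hd
    have h₃ := h₁.trans (Nat.mul_le_mul_left d hd)
    have hb := (F ⟨z, hz⟩).2
    rw [hq z hz]
    rcases le_total (F ⟨x, hx⟩).val (F ⟨z, hz⟩).val with h | h
    · rw [cycleGraph_dist hN h] at h₃
      simp only [arc]
      split_ifs <;> omega
    · rw [SimpleGraph.dist_comm, cycleGraph_dist hN h] at h₃
      simp only [arc]
      split_ifs <;> omega
  have hqinj : ∀ y z, y < n → z < n → q y = q z → y = z := by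
    intro y z hy hz hyz
    rw [hq y hy, hq z hz] at hyz
    have h₁ := (F ⟨y, hy⟩).2
    have h₂ := (F ⟨z, hz⟩).2
    have : F ⟨y, hy⟩ = F ⟨z, hz⟩ := by
      apply Fin.ext
      simp only [arc] at hyz
      split_ifs at hyz <;> omega
    simpa using hinj this
  have key := Finset.card_le_card_of_injOn (s := (Finset.range n).filter fun z => gdist G x z ≤ d)
    (t := Finset.range (2 * d * d + 1))
    (fun z => if q z ≤ d * d then d * d + q z else q z + d * d - N) ?_ ?_
  · rwa [Finset.card_range] at key
  · intro z hz
    simp only [Finset.coe_filter, Finset.mem_range, Set.mem_ofPred_eq] at hz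
    have := hle z hz.1 hz.2
    have e : 2 * d * d = 2 * (d * d) := by ring
    simp only [Finset.coe_range, Set.mem_Iio]
    split_ifs <;> omega
  · intro y hy z hz hyz
    simp only [Finset.coe_filter, Finset.mem_range, Set.mem_ofPred_eq] at hy hz
    have h₁ := hle y hy.1 hy.2
    have h₂ := hle z hz.1 hz.2
    refine hqinj y z hy.1 hz.1 ?_
    simp only at hyz
    split_ifs at hyz <;> omega

end rank

section

variable {n N d B S L : ℕ} {s : St Var}

/-- The contents of the tables after the first `k` pairs of vertices have been treated, as long as no
ball has had too many vertices. -/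
structure PartialNumbering (G : SimpleGraph (Fin n)) (d B k : ℕ) (a₁ a₂ : ℕ → ℕ) : Prop where
  idx : ∀ e < n * n, a₁ e = if e < k ∧ gdist G (e / n) (e % n) ≤ d then
    rank G d (e / n) (e % n + 1) else 0
  lt_base : ∀ e < k, gdist G (e / n) (e % n) ≤ d → rank G d (e / n) (e % n + 1) < B
  ball : ∀ e < k, gdist G (e / n) (e % n) ≤ d →
    a₂ (e / n * B + rank G d (e / n) (e % n + 1)) = e % n + 1
  ball_le : ∀ x < n, ∀ j < B, a₂ (x * B + j) ≤ n

theorem PartialNumbering.isNumbering {G : SimpleGraph (Fin n)} {a₁ a₂ : ℕ → ℕ} (hB : 0 < B)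
    (h : PartialNumbering G d B (n * n) a₁ a₂) :
    IsNumbering G d B (fun x y => a₁ (x * n + y)) (fun x k => a₂ (x * B + k)) where
  one_le x hx y hy hd := by
    have hlt := flat_lt hx hy
    have := h.idx _ hlt
    rw [flat_div hy, flat_mod hy, if_pos ⟨hlt, hd⟩, rank_succ_of_le hd] at this
    omega
  lt_base x hx y hy := by
    have hlt := flat_lt hx hy
    have h₁ := h.idx _ hlt
    have h₂ := h.lt_base _ hlt
    rw [flat_div hy, flat_mod hy] at h₁ h₂
    rw [h₁]
    split_ifs with h₃
    · exact h₂ h₃.2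
    · exact hB
  ball_idx x hx y hy hd := by
    have hlt := flat_lt hx hy
    have h₁ := h.idx _ hlt
    have h₂ := h.ball _ hlt
    rw [flat_div hy, flat_mod hy] at h₁ h₂
    rw [if_pos ⟨hlt, hd⟩] at h₁
    show a₂ (x * B + a₁ (x * n + y)) = y + 1
    rw [h₁, h₂ hd]
  ball_le := h.ball_le

/-- Vertices outside of the ball get no number. -/
theorem PartialNumbering.skip {G : SimpleGraph (Fin n)} {a₁ a₂ : ℕ → ℕ} {k : ℕ}
    (h : PartialNumbering G d B k a₁ a₂) (hd : d < gdist G (k / n) (k % n)) :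
    PartialNumbering G d B (k + 1) a₁ a₂ where
  idx e he := by
    rw [h.idx e he]
    refine if_congr ⟨fun h => ⟨by omega, h.2⟩, fun h' => ⟨?_, h'.2⟩⟩ rfl rfl
    by_contra hlt
    obtain rfl : e = k := by omega
    omega
  lt_base e he hd' := h.lt_base e (by
    by_contra hlt
    obtain rfl : e = k := by omega
    omega) hd'
  ball e he hd' := h.ball e (by
    by_contra hlt
    obtain rfl : e = k := by omega
    omega) hd'
  ball_le := h.ball_le

/-- The vertex `k % n` gets the next number in the ball around `k / n`. -/
theorem PartialNumbering.add {G : SimpleGraph (Fin n)} {a₁ a₂ : ℕ → ℕ} {k : ℕ} (hk : k < n * n)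
    (h : PartialNumbering G d B k a₁ a₂) (hd : gdist G (k / n) (k % n) ≤ d)
    (hB : rank G d (k / n) (k % n + 1) < B) :
    PartialNumbering G d B (k + 1)
      (Function.update a₁ k (rank G d (k / n) (k % n + 1)))
      (Function.update a₂ (k / n * B + rank G d (k / n) (k % n + 1)) (k % n + 1)) where
  idx e he := by
    rw [Function.update_apply, h.idx e he]
    by_cases hek : e = k
    · subst hek
      rw [if_pos rfl, if_pos ⟨by omega, hd⟩]
    · rw [if_neg hek]
      exact if_congr (and_congr_left fun _ => by omega) rfl rfl
  lt_base e he hd' := by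
    by_cases hek : e = k
    · exact hek ▸ hB
    · exact h.lt_base e (by omega) hd'
  ball e he hd' := by
    by_cases hek : e = k
    · rw [hek, Function.update_self]
    · rw [Function.update_of_ne, h.ball e (by omega) hd']
      intro heq
      -- different vertices have different numbers
      have h₁ := h.lt_base e (by omega) hd'
      have h₂ : e / n = k / n := by
        have := congrArg (· / B) heq
        simpa only [flat_div h₁, flat_div hB] using this
      have h₃ : rank G d (e / n) (e % n + 1) = rank G d (k / n) (k % n + 1) := by
        have := congrArg (· % B) heq
        simpa only [flat_mod h₁, flat_mod hB] using this
      have h₄ : e % n < k % n := by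
        have h₅ := flat_eq e n
        have h₆ := flat_eq k n
        rw [h₂] at h₅
        omega
      have h₅ := rank_mono (G := G) (d := d) (x := k / n) (Nat.succ_le_of_lt h₄)
      rw [h₂, rank_succ_of_le hd] at h₃
      rw [Nat.succ_eq_add_one] at h₅
      omega
  ball_le x hx j hj := by
    rw [Function.update_apply]
    split
    · have : k % n < n := Nat.mod_lt _ (by omega)
      omega
    · exact h.ball_le x hx j hj

/-- Either some ball has at least `B` vertices, or all balls of radius `d` are numbered. -/
theorem numberBalls_spec {G : SimpleGraph (Fin n)} (hz : Sizes n N d B S L)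
    (hp : HasParams n N d B S s) (hdone : s.reg .done = 0)
    (hD : ∀ e < n * n, arr (3 + n * n) s.mem 0 e = gdist G (e / n) (e % n))
    (h₁ : ∀ e, arr (3 + n * n) s.mem 1 e = 0) (h₂ : ∀ e, arr (3 + n * n) s.mem 2 e = 0) :
    Unchanged [1, 2] (3 + n * n) s.mem (numberBalls.den L s).mem ∧
      ((numberBalls.den L s).reg .done ≠ 0 → ∃ x < n, B ≤ rank G d x n) ∧
      ((numberBalls.den L s).reg .done = 0 → PartialNumbering G d B (n * n)
        (arr (3 + n * n) (numberBalls.den L s).mem 1)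
        (arr (3 + n * n) (numberBalls.den L s).mem 2)) := by
  have hn := hz.n_pos
  have hcells := hz.cells
  have hnn := hz.nn_le
  have hN := hz.N_lt
  have hnB := hz.nB_le
  let I : ℕ → St Var → Prop := fun k s' =>
    (k % n ≠ 0 → s'.reg .cnt = rank G d (k / n) (k % n)) ∧
    Unchanged [1, 2] (3 + n * n) s.mem s'.mem ∧
      (s'.reg .done ≠ 0 → ∃ x < n, B ≤ rank G d x n) ∧
      (s'.reg .done = 0 → PartialNumbering G d B k
        (arr (3 + n * n) s'.mem 1) (arr (3 + n * n) s'.mem 2))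
  suffices h : I (n * n) (numberBalls.den L s) from h.2
  refine loop_rule (by decide) hp hp.hnn I ?_ ?_ ?_
  · exact fun k s' x h => by simpa [I, St.set_reg] using h
  · refine ⟨by simp, Unchanged.refl _ _ _, fun h => absurd hdone h, fun _ => ?_⟩
    have e₁ : arr (3 + n * n) s.mem 1 = fun _ => 0 := funext h₁
    have e₂ : arr (3 + n * n) s.mem 2 = fun _ => 0 := funext h₂
    rw [e₁, e₂]
    constructor <;> simp
  rintro k s' hk he hp' hfr ⟨hcnt, hun, hd1, hd0⟩
  rw [den_quot_rem hz hp' he hk, den_seq]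
  have hx : k / n < n := Nat.div_lt_of_lt_mul hk
  have hy : k % n < n := Nat.mod_lt _ hn
  set s₁ := Com.den L (.ite (.var .y) .skip (.cnt ≔ .lit 0)) ((s'.set .x (k / n)).set .y (k % n))
    with hs₁
  have hs₁' : s₁ = (((s'.set .x (k / n)).set .y (k % n)).set .cnt (rank G d (k / n) (k % n))) := by
    rw [hs₁]
    simp only [Com.den, eval_var, St.set_reg, if_true, eval_lit]
    by_cases h : k % n = 0
    · rw [if_pos h, h, rank_zero]
    · rw [if_neg h, ← hcnt h]
      ext v
      · simp only [St.set_reg]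
        by_cases hv : v = .cnt
        · subst hv; simp
        · simp [hv]
      · rfl
  clear_value s₁
  have hp₁ : HasParams n N d B S s₁ := by
    rw [hs₁']
    exact ((hp'.set rfl _).set rfl _).set rfl _
  have hx₁ : s₁.reg .x = k / n := by simp [hs₁', St.set_reg]
  have hy₁ : s₁.reg .y = k % n := by simp [hs₁', St.set_reg]
  have he₁ : s₁.reg .e = k := by simp [hs₁', St.set_reg, he]
  have hc₁ : s₁.reg .cnt = rank G d (k / n) (k % n) := by simp [hs₁', St.set_reg]
  have hdone₁ : s₁.reg .done = s'.reg .done := by simp [hs₁', St.set_reg]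
  have hm₁ : s₁.mem = s'.mem := by rw [hs₁']; rfl
  have hnext : (k + 1) % n ≠ 0 → (k + 1) / n = k / n ∧ (k + 1) % n = k % n + 1 := by
    intro h
    rcases succ_mod_div hn k with ⟨-, h₁, h₂⟩ | ⟨-, h₁, -⟩
    · exact ⟨h₂, h₁⟩
    · exact absurd h₁ h
  have hcell : ∀ a < 8, cell (3 + n * n) a k < L := fun a ha => hz.cell_lt ha (by omega)
  have hld : (ld 0 (.var .e)).eval L s₁ = gdist G (k / n) (k % n) := by
    rw [eval_ld, hp₁.hoff, eval_var, he₁, hm₁, hun.arr (by decide) (by decide), hD k hk]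
    rw [hp₁.hoff, eval_var, he₁]
    exact hcell 0 (by decide)
  rw [Com.den, eval_lt, eval_var, hp₁.hd, hld]
  by_cases hd : d < gdist G (k / n) (k % n)
  · rw [if_pos hd, if_neg one_ne_zero, Com.den]
    refine ⟨fun h => ?_, hm₁ ▸ hun, by rwa [hdone₁], fun h => ?_⟩
    · rw [(hnext h).1, (hnext h).2, hc₁, rank_succ_of_lt hd]
    · rw [hm₁]
      exact (hd0 (hdone₁ ▸ h)).skip hd
  · rw [if_neg hd, if_pos rfl]
    rw [not_lt] at hd
    have hr := rank_succ_of_le hd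
    have hrn := rank_le (G := G) (d := d) (x := k / n) (y := k % n)
    set ρ := rank G d (k / n) (k % n + 1) with hρ
    have hev : (Exp.var Var.cnt + .lit 1).eval L s₁ = ρ := by
      rw [eval_add, eval_var, eval_lit, hc₁, hr, Nat.mod_eq_of_lt (by omega)]
    rw [den_seq, Com.den, hev]
    set s₂ := s₁.set .cnt ρ with hs₂
    have hp₂ : HasParams n N d B S s₂ := hp₁.set rfl _
    have hc₂ : s₂.reg .cnt = ρ := by simp [hs₂, St.set_reg]
    have hx₂ : s₂.reg .x = k / n := by simp [hs₂, St.set_reg, hx₁]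
    have hy₂ : s₂.reg .y = k % n := by simp [hs₂, St.set_reg, hy₁]
    have he₂ : s₂.reg .e = k := by simp [hs₂, St.set_reg, he₁]
    have hd₂ : s₂.reg .done = s'.reg .done := by simp [hs₂, St.set_reg, hdone₁]
    have hm₂ : s₂.mem = s'.mem := hm₁
    clear_value s₂
    rw [Com.den, eval_lt, eval_var, eval_var, hc₂, hp₂.hB]
    by_cases hB : ρ < B
    · have hst := den_st (L := L) (s := s₂) (a := 1) (e := .var .e) (x := .var .cnt)
        (by rw [eval_var, hp₂.hoff, he₂]; exact hcell 1 (by decide))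
      rw [if_pos hB, if_neg one_ne_zero, den_seq, hst]
      simp only [eval_var, hp₂.hoff, he₂, hc₂, hm₂]
      set s₃ : St Var := ⟨s₂.reg, Function.update s'.mem (cell (3 + n * n) 1 k) ρ⟩ with hs₃
      have hlt := flat_lt hx hB
      have ha : (Exp.var Var.x * .var .B + .var .cnt).eval L s₃ = k / n * B + ρ := by
        simp only [hs₃, eval_add, eval_mul, eval_var, hx₂, hc₂, hp₂.hB]
        rw [Nat.mod_eq_of_lt (a := _ * _) (by omega), Nat.mod_eq_of_lt (by omega)]
      have hv : (Exp.var Var.y + .lit 1).eval L s₃ = k % n + 1 := by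
        simp only [hs₃, eval_add, eval_lit, eval_var, hy₂]
        rw [Nat.mod_eq_of_lt (by omega)]
      have ho : s₃.reg .off = 3 + n * n := hp₂.hoff
      rw [den_st (by rw [ho, ha]; exact hz.cell_lt (by decide) (by omega)), ho, ha, hv]
      refine ⟨fun h => ?_, ?_, ?_, ?_⟩
      · rw [(hnext h).1, (hnext h).2]
        exact hc₂
      · exact (hun.update (by decide) (by simp)).update (by decide) (by simp)
      · exact fun h => hd1 (hd₂ ▸ h)
      · intro h
        simp only [arr_update, hs₃, arr_update_of_ne (show (2 : ℕ) ≠ 1 by decide) (show 2 < 8 by decide)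
          (show 1 < 8 by decide), arr_update_of_ne (show (1 : ℕ) ≠ 2 by decide)
          (show 1 < 8 by decide) (show 2 < 8 by decide)]
        exact (hd0 (hd₂ ▸ h)).add hk hd hB
    · rw [if_neg hB, if_pos rfl, Com.den, eval_lit]
      refine ⟨fun h => ?_, ?_, fun _ => ?_, fun h => ?_⟩
      · rw [(hnext h).1, (hnext h).2]
        simpa [St.set_reg] using hc₂
      · rw [St.set_mem, hm₂]
        exact hun
      · exact ⟨k / n, hx, (not_lt.1 hB).trans (rank_mono hy)⟩
      · simp [St.set_reg] at h

end

end CycleEmbedding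

namespace CycleEmbedding

/-! ### Windows in the memory -/

theorem cur_lt {n : ℕ} {G : SimpleGraph (Fin n)} {d B : ℕ} {idx ball : ℕ → ℕ → ℕ}
    (hT : IsNumbering G d B idx ball) {x : ℕ} (hx : x < n) (c j : ℕ) : cur B ball x c j < n := by
  have hB : 0 < B := (Nat.zero_le _).trans_lt (hT.lt_base _ hx _ hx)
  induction j with
  | zero => exact hx
  | succ j ih =>
    rw [cur]
    split
    · exact ih
    · have := hT.ball_le _ ih (digit B c j) (Nat.mod_lt _ hB)
      omega

theorem slot_lt {n : ℕ} {G : SimpleGraph (Fin n)} {d B : ℕ} {idx ball : ℕ → ℕ → ℕ}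
    (hT : IsNumbering G d B idx ball) {x : ℕ} (hx : x < n) {c j y : ℕ}
    (h : slot B ball x c j = y + 1) : y < n := by
  cases j with
  | zero =>
    rw [slot] at h
    omega
  | succ j =>
    rw [slot] at h
    split at h
    · omega
    · have := cur_lt hT hx c (j + 1)
      omega

/-- The memory contains the distances, the numberings of the balls and the powers of the base. -/
structure HasTables {n : ℕ} (G : SimpleGraph (Fin n)) (d B : ℕ) (idx ball : ℕ → ℕ → ℕ)
    (m : ℕ → ℕ) : Prop where
  dist : ∀ x < n, ∀ y < n, arr (3 + n * n) m 0 (x * n + y) = gdist G x y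
  idx_eq : ∀ x y, arr (3 + n * n) m 1 (x * n + y) = idx x y
  ball_eq : ∀ x k, arr (3 + n * n) m 2 (x * B + k) = ball x k
  pow : ∀ i < d, arr (3 + n * n) m 6 i = B ^ i

section

variable {n N d B S L : ℕ} {s : St Var} {G : SimpleGraph (Fin n)} {idx ball : ℕ → ℕ → ℕ}

/-- The tables are the arrays 0, 1, 2 and 6. -/
theorem HasTables.of_unchanged {K : List ℕ} {m m' : ℕ → ℕ} (h : HasTables G d B idx ball m)
    (hu : Unchanged K (3 + n * n) m m') (h₀ : 0 ∉ K) (h₁ : 1 ∉ K) (h₂ : 2 ∉ K) (h₆ : 6 ∉ K) :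
    HasTables G d B idx ball m' where
  dist := by rw [hu.arr (by decide) h₀]; exact h.dist
  idx_eq := by rw [hu.arr (by decide) h₁]; exact h.idx_eq
  ball_eq := by rw [hu.arr (by decide) h₂]; exact h.ball_eq
  pow := by rw [hu.arr (by decide) h₆]; exact h.pow

theorem Sizes.d_lt (h : Sizes n N d B S L) : 2 * d + 1 < n * d * (n * S) := by
  have := h.S_le
  have := h.B_le
  have := h.base_ge'
  omega

/-- Evaluation of a row-major index that stays in range. -/
theorem eval_index {a b c : Exp Var} {i k j : ℕ} (ha : a.eval L s = i) (hb : b.eval L s = k)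
    (hc : c.eval L s = j) (h : i * k + j < L) : (a * b + c).eval L s = i * k + j := by
  rw [eval_add, eval_mul, ha, hb, hc, Nat.mod_eq_of_lt (a := i * k) (by omega), Nat.mod_eq_of_lt h]

theorem eval_ld_of_eq {a : ℕ} {e : Exp Var} {i : ℕ} (hz : Sizes n N d B S L)
    (hp : HasParams n N d B S s) (ha : a < 8) (he : e.eval L s = i) (hi : i < n * d * (n * S)) :
    (ld a e).eval L s = arr (3 + n * n) s.mem a i := by
  rw [eval_ld, he, hp.hoff]
  rw [he, hp.hoff]
  exact hz.cell_lt ha hi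

theorem den_st_of_eq {a : ℕ} {e x : Exp Var} {i y : ℕ} (hz : Sizes n N d B S L)
    (hp : HasParams n N d B S s) (ha : a < 8) (he : e.eval L s = i) (hi : i < n * d * (n * S))
    (hx : x.eval L s = y) :
    (st a e x).den L s = ⟨s.reg, Function.update s.mem (cell (3 + n * n) a i) y⟩ := by
  rw [den_st, he, hp.hoff, hx]
  rw [he, hp.hoff]
  exact hz.cell_lt ha hi

theorem den_assign_seq (v : Var) (e : Exp Var) (c : Com Var) (s : St Var) :
    (v ≔ e ;; c).den L s = c.den L (s.set v (e.eval L s)) := rfl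

theorem HasParams.of_reg {s' : St Var} (hp : HasParams n N d B S s) (h : s'.reg = s.reg) :
    HasParams n N d B S s' := hp.of_eq fun v _ => by rw [h]

/-- The array 3 receives the contents of the window. -/
theorem decode_spec (hz : Sizes n N d B S L) (hp : HasParams n N d B S s)
    (hT : HasTables G d B idx ball s.mem) (hnum : IsNumbering G d B idx ball) {x c : ℕ}
    (hx : s.reg .x = x) (hxn : x < n) (hc : s.reg .c = c) (hcS : c < S) :
    Unchanged [3] (3 + n * n) s.mem (decode.den L s).mem ∧
      ∀ j ≤ 2 * d, arr (3 + n * n) (decode.den L s).mem 3 j = slot B ball x c j := by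
  have hcells := hz.cells
  have hNL := hz.N_lt
  have hd := hz.d_lt
  have hSR := hz.S_le
  have hnB := hz.nB_le
  let I : ℕ → St Var → Prop := fun k s' => s'.reg .cc = c / B ^ k ∧
    s'.reg .cur = cur B ball x c k ∧ Unchanged [3] (3 + n * n) s.mem s'.mem ∧
      ∀ j ≤ k, arr (3 + n * n) s'.mem 3 j = slot B ball x c j
  suffices h : I (2 * d) (decode.den L s) from h.2.2
  rw [decode, den_seq, den_seq, den_seq, Com.den, Com.den, eval_var, eval_var]
  set s₁ := (s.set .cur (s.reg .x)).set .cc ((s.set .cur (s.reg .x)).reg .c) with hs₁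
  have hp₁ : HasParams n N d B S s₁ := (hp.set rfl _).set rfl _
  have hm₁ : s₁.mem = s.mem := rfl
  have hcur₁ : s₁.reg .cur = x := by simp [hs₁, St.set_reg, hx]
  have hcc₁ : s₁.reg .cc = c := by simp [hs₁, St.set_reg, hc]
  have hx₁ : s₁.reg .x = x := by simp [hs₁, St.set_reg, hx]
  clear_value s₁
  rw [den_st_of_eq (i := 0) (y := x + 1) hz hp₁ (by decide) rfl (by omega)
    (by rw [eval_add, eval_var, eval_lit, hx₁, Nat.mod_eq_of_lt (by omega)]), hm₁]
  have hp₂ : HasParams n N d B S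
      ⟨s₁.reg, Function.update s.mem (cell (3 + n * n) 3 0) (x + 1)⟩ := hp₁.of_reg rfl
  refine loop_rule (by decide) hp₂ hp₂.hW I ?_ ?_ ?_
  · rintro k s' y ⟨h₁, h₂, h₃⟩
    exact ⟨by simpa [St.set_reg] using h₁, by simpa [St.set_reg] using h₂, h₃⟩
  · refine ⟨by simpa using hcc₁, hcur₁, (Unchanged.refl _ _ _).update (by decide) (by simp), ?_⟩
    rintro j hj
    obtain rfl : j = 0 := by omega
    rw [arr_update, Function.update_self, slot]
  rintro k s' hk hj hp' hfr ⟨h₁, h₂, h₃, h₄⟩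
  have hcL : c / B ^ k < L := (Nat.div_le_self _ _).trans_lt (by omega)
  have hcc : c / B ^ k / B = c / B ^ (k + 1) := by rw [Nat.div_div_eq_div_mul, pow_succ]
  have hq : c / B ^ (k + 1) * B ≤ c / B ^ k := hcc ▸ Nat.div_mul_le_self _ _
  have hdig : c / B ^ k - c / B ^ (k + 1) * B = digit B c k := by
    rw [digit, Nat.mod_eq_sub_div_mul, hcc]
  rw [den_seq, den_seq, den_seq]
  set s₂ := Com.den L (.cc ≔ .var .q) (Com.den L (.dig ≔ .var .cc - .var .q * .var .B)
    (Com.den L (.q ≔ .var .cc / .var .B) s')) with hs₂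
  have hp₂ : HasParams n N d B S s₂ :=
    ((hp'.den (by decide)).den (by decide)).den (by decide)
  have hm₂ : s₂.mem = s'.mem := rfl
  have hcc₂ : s₂.reg .cc = c / B ^ (k + 1) := by
    simp [hs₂, Com.den, St.set_reg, eval_var, eval_div, h₁, hp'.hB, hcc]
  have hcur₂ : s₂.reg .cur = cur B ball x c k := by
    simp [hs₂, Com.den, St.set_reg, h₂]
  have hj₂ : s₂.reg .j = k := by simp [hs₂, Com.den, St.set_reg, hj]
  have hdig₂ : s₂.reg .dig = digit B c k := by
    simp [hs₂, Com.den, St.set_reg, eval_var, eval_div, eval_sub, eval_mul, h₁, hp'.hB, hcc]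
    rw [Nat.mod_eq_of_lt (by omega), hdig]
  clear_value s₂
  have hcurn := cur_lt hnum hxn c k
  have hcurn' := cur_lt hnum hxn c (k + 1)
  have hB : digit B c k < B := Nat.mod_lt _ hz.B_pos
  rw [Com.den, eval_var, hdig₂]
  have hjev : ∀ s₃ : St Var, s₃.reg .j = k → (Exp.var Var.j + .lit 1).eval L s₃ = k + 1 := by
    intro s₃ h
    rw [eval_add, eval_var, eval_lit, h, Nat.mod_eq_of_lt (by omega)]
  by_cases h0 : digit B c k = 0
  · rw [if_pos h0, den_st_of_eq hz hp₂ (by decide) (hjev _ hj₂) (by omega) rfl, hm₂]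
    refine ⟨hcc₂, ?_, h₃.update (by decide) (by simp), fun j hj => ?_⟩
    · rw [cur, if_pos h0]
      exact hcur₂
    · simp only [arr_update, Function.update_apply, eval_lit]
      split
      · subst j
        rw [slot, if_pos h0]
      · exact h₄ j (by omega)
  · have hlt := flat_lt hcurn hB
    have hld : (ld 2 (.var .cur * .var .B + .var .dig)).eval L s₂ =
        ball (cur B ball x c k) (digit B c k) := by
      rw [eval_ld_of_eq hz hp₂ (by decide)
        (eval_index (by rw [eval_var, hcur₂]) (by rw [eval_var, hp₂.hB])
          (by rw [eval_var, hdig₂]) (by omega)) (by omega), hm₂, h₃.arr (by decide) (by decide)]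
      exact hT.ball_eq _ _
    rw [if_neg h0, den_seq, Com.den, eval_sub, hld, eval_lit]
    have hcurs : ball (cur B ball x c k) (digit B c k) - 1 = cur B ball x c (k + 1) := by
      rw [cur, if_neg h0]
    rw [hcurs]
    set s₃ := s₂.set .cur (cur B ball x c (k + 1)) with hs₃
    have hp₃ : HasParams n N d B S s₃ := hp₂.set rfl _
    have hcur₃ : s₃.reg .cur = cur B ball x c (k + 1) := by simp [hs₃, St.set_reg]
    rw [den_st_of_eq (i := k + 1) (y := cur B ball x c (k + 1) + 1) hz hp₃ (by decide)
      (hjev _ (by simp [hs₃, St.set_reg, hj₂])) (by omega)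
      (by rw [eval_add, eval_var, eval_lit, hcur₃, Nat.mod_eq_of_lt (by omega)]),
      show s₃.mem = s'.mem from hm₂]
    refine ⟨by simp [hs₃, St.set_reg, hcc₂], hcur₃, h₃.update (by decide) (by simp),
      fun j hj => ?_⟩
    simp only [arr_update, Function.update_apply]
    split
    · subst j
      rw [slot, if_neg h0]
    · exact h₄ j (by omega)

theorem findInWindow_spec (hz : Sizes n N d B S L) (hp : HasParams n N d B S s) {j u : ℕ}
    (hj : s.reg .j = j) (hjd : j ≤ d) (hu : s.reg .u = u) :
    (findInWindow.den L s).mem = s.mem ∧ ((findInWindow.den L s).reg .fnd ≠ 0 ↔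
      ∃ i ≤ j + d, arr (3 + n * n) s.mem 3 i = u) := by
  have hd := hz.d_lt
  have hNL := hz.N_lt
  let I : ℕ → St Var → Prop := fun k s' => s'.mem = s.mem ∧
    (s'.reg .fnd ≠ 0 ↔ ∃ i < k, i ≤ j + d ∧ arr (3 + n * n) s.mem 3 i = u)
  suffices h : I (2 * d + 1) (findInWindow.den L s) by
    refine ⟨h.1, h.2.trans ⟨fun ⟨i, _, h₁, h₂⟩ => ⟨i, h₁, h₂⟩, fun ⟨i, h₁, h₂⟩ => ?_⟩⟩
    exact ⟨i, by omega, h₁, h₂⟩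
  rw [findInWindow, den_seq, Com.den, eval_lit]
  have hp₁ : HasParams n N d B S (s.set .fnd 0) := hp.set rfl _
  refine loop_rule (by decide) hp₁ hp₁.hW1 I ?_ ⟨rfl, by simp [St.set_reg]⟩ ?_
  · rintro k s' x ⟨h₁, h₂⟩
    exact ⟨h₁, by simpa [St.set_reg] using h₂⟩
  rintro k s' hk hl hp' hfr ⟨h₁, h₂⟩
  have hj' : s'.reg .j = j := by
    rw [hfr .j (by decide)]
    simp [St.set_reg, hj]
  have hu' : s'.reg .u = u := by
    rw [hfr .u (by decide)]
    simp [St.set_reg, hu]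
  rw [Com.den, eval_lt, eval_add, eval_var, eval_var, eval_var, hj', hp'.hd, hl,
    Nat.mod_eq_of_lt (by omega)]
  by_cases hlt : j + d < k
  · rw [if_pos hlt, if_neg one_ne_zero]
    refine ⟨h₁, h₂.trans ⟨fun ⟨i, hi, h⟩ => ⟨i, by omega, h⟩, fun ⟨i, hi, h⟩ => ⟨i, ?_, h⟩⟩⟩
    have := h.1
    omega
  · rw [if_neg hlt, if_pos rfl, Com.den, eval_eq,
      eval_ld_of_eq hz hp' (by decide) (by rw [eval_var, hl]) (by omega), eval_var, hu', h₁]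
    by_cases h : arr (3 + n * n) s.mem 3 k = u
    · rw [if_pos h, if_neg one_ne_zero]
      refine ⟨h₁, ?_⟩
      simp only [Com.den, eval_lit, St.set_reg, if_true]
      exact ⟨fun _ => ⟨k, by omega, by omega, h⟩, fun _ => one_ne_zero⟩
    · rw [if_neg h, if_pos rfl]
      refine ⟨h₁, h₂.trans ⟨fun ⟨i, hi, h⟩ => ⟨i, by omega, h⟩, fun ⟨i, hi, hi'⟩ => ⟨i, ?_, hi'⟩⟩⟩
      by_contra hik
      obtain rfl : i = k := by omega
      exact h hi'.2

/-- The pairs of an entry of the window and a number in a ball run through all neighbours of the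
vertices of the window, so the test decides `WindowOk`. -/
theorem checkWindow_spec (hz : Sizes n N d B S L) (hp : HasParams n N d B S s)
    (hT : HasTables G d B idx ball s.mem) (hnum : IsNumbering G d B idx ball) {x c g : ℕ}
    (hxn : x < n) (hw : ∀ j ≤ 2 * d, arr (3 + n * n) s.mem 3 j = slot B ball x c j)
    (hg : s.reg .g = g) (hgN : g ≤ N) :
    (checkWindow.den L s).mem = s.mem ∧
      ((checkWindow.den L s).reg .ok ≠ 0 ↔ WindowOk G d B ball x c g) := by
  have hd := hz.d_lt
  have hNL := hz.N_lt
  have hcells := hz.cells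
  have hnB := hz.nB_le
  have hnn := hz.nn_le
  have hd1 := hz.d_pos
  have hdB : (d + 1) * B < L := by
    have h₁ : (d + 1) * B ≤ B * B := Nat.mul_le_mul_right _ (by have := hz.base_ge'; omega)
    have h₂ := Nat.mul_le_mul hz.B_le hz.B_le
    have := hz.codes
    omega
  let P : ℕ → ℕ → Prop := fun j b => d < g + j → ∀ y, slot B ball x c j = y + 1 →
    ∀ u, ball y b = u + 1 → gdist G y u = 1 → ∃ i ≤ j + d, slot B ball x c i = u + 1
  let I : ℕ → St Var → Prop := fun k s' => s'.mem = s.mem ∧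
    (s'.reg .ok ≠ 0 ↔ ∀ i < k, P (i / B) (i % B))
  suffices h : I ((d + 1) * B) (checkWindow.den L s) by
    refine ⟨h.1, h.2.trans ⟨fun h j hj hgj y hy u hu hyu => ?_, fun h i hi hgj y hy u hu hyu => ?_⟩⟩
    · have hyn := slot_lt hnum hxn hy
      have hB := hnum.lt_base y hyn u hu
      have hlt := flat_lt (show j < d + 1 by omega) hB
      have := h _ hlt
      rw [flat_div hB, flat_mod hB] at this
      exact this hgj y hy u (hnum.ball_idx y hyn u hu (by omega)) hyu
    · have hyn := slot_lt hnum hxn hy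
      have hB := Nat.mod_lt i hz.B_pos
      have := hnum.ball_le y hyn _ hB
      have hjd : i / B < d + 1 := Nat.div_lt_of_lt_mul (by rwa [mul_comm])
      exact h (i / B) (by omega) hgj y hy u (by omega) hyu
  rw [checkWindow, den_seq, Com.den, eval_lit]
  have hp₁ : HasParams n N d B S (s.set .ok 1) := hp.set rfl _
  refine loop_rule (by decide) hp₁ hp₁.hdB1 I ?_ ⟨rfl, by simp [St.set_reg]⟩ ?_
  · rintro k s' x ⟨h₁, h₂⟩
    exact ⟨h₁, by simpa [St.set_reg] using h₂⟩
  rintro k s' hk hi hp' hfr ⟨h₁, h₂⟩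
  have hjd : k / B < d + 1 := Nat.div_lt_of_lt_mul (by rwa [mul_comm])
  have hbB := Nat.mod_lt k hz.B_pos
  have hgs' : s'.reg .g = g := by
    rw [hfr .g (by decide)]
    simp [St.set_reg, hg]
  -- it is enough to decide the condition number `k`
  have next : ∀ s'' : St Var, s''.mem = s.mem → s''.reg .ok = s'.reg .ok → P (k / B) (k % B) →
      I (k + 1) s'' := fun s'' hm hok hP => by
    refine ⟨hm, ?_⟩
    rw [hok, h₂]
    refine ⟨fun h i hi => ?_, fun h i hi => h i (by omega)⟩
    rcases Nat.lt_succ_iff_lt_or_eq.1 hi with hi | rfl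
    · exact h i hi
    · exact hP
  rw [den_seq, den_seq, den_seq]
  set s₁ := Com.den L (.k ≔ rem (.var .i) (.var .B)) (Com.den L (.j ≔ .var .i / .var .B) s')
    with hs₁
  have hp₁ : HasParams n N d B S s₁ := (hp'.den (by decide)).den (by decide)
  have hm₁ : s₁.mem = s.mem := h₁
  have hj₁ : s₁.reg .j = k / B := by
    simp [hs₁, Com.den, St.set_reg, eval_div, eval_var, hi, hp'.hB]
  have hk₁ : s₁.reg .k = k % B := by
    simp only [hs₁, Com.den]
    rw [eval_rem]
    · simp [St.set_reg, eval_var, hi, hp'.hB]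
    · simp [St.set_reg, eval_var, hi]
      omega
  have hg₁ : s₁.reg .g = g := by simp [hs₁, Com.den, St.set_reg, hgs']
  have hok₁ : s₁.reg .ok = s'.reg .ok := by simp [hs₁, Com.den, St.set_reg]
  clear_value s₁
  rw [Com.den, eval_ld_of_eq hz hp₁ (by decide) (by rw [eval_var, hj₁]) (by omega), hm₁,
    hw _ (by omega)]
  set s₂ := s₁.set .y (slot B ball x c (k / B)) with hs₂
  have hp₂ : HasParams n N d B S s₂ := hp₁.set rfl _
  have hm₂ : s₂.mem = s.mem := hm₁
  have hy₂ : s₂.reg .y = slot B ball x c (k / B) := by simp [hs₂, St.set_reg]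
  have hj₂ : s₂.reg .j = k / B := by simp [hs₂, St.set_reg, hj₁]
  have hk₂ : s₂.reg .k = k % B := by simp [hs₂, St.set_reg, hk₁]
  have hg₂ : s₂.reg .g = g := by simp [hs₂, St.set_reg, hg₁]
  have hok₂ : s₂.reg .ok = s'.reg .ok := by simp [hs₂, St.set_reg, hok₁]
  clear_value s₂
  rw [Com.den, eval_lt, eval_add, eval_var, eval_var, eval_var, hp₂.hd, hg₂, hj₂,
    Nat.mod_eq_of_lt (by omega)]
  by_cases hgj : d < g + k / B
  swap
  · rw [if_neg hgj, if_pos rfl]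
    exact next _ hm₂ hok₂ fun h => absurd h hgj
  rw [if_pos hgj, if_neg one_ne_zero, Com.den, eval_var, hy₂]
  by_cases hy0 : slot B ball x c (k / B) = 0
  · rw [if_pos hy0]
    exact next _ hm₂ hok₂ fun _ y hy => by omega
  obtain ⟨y, hy⟩ := Nat.exists_eq_succ_of_ne_zero hy0
  rw [Nat.succ_eq_add_one] at hy
  have hyn := slot_lt hnum hxn hy
  rw [if_neg hy0, den_assign_seq, eval_sub, eval_var, hy₂, hy, eval_lit,
    Nat.add_sub_cancel]
  set s₃ := s₂.set .y y with hs₃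
  have hp₃ : HasParams n N d B S s₃ := hp₂.set rfl _
  have hm₃ : s₃.mem = s.mem := hm₂
  have hy₃ : s₃.reg .y = y := by simp [hs₃, St.set_reg]
  have hj₃ : s₃.reg .j = k / B := by simp [hs₃, St.set_reg, hj₂]
  have hk₃ : s₃.reg .k = k % B := by simp [hs₃, St.set_reg, hk₂]
  have hok₃ : s₃.reg .ok = s'.reg .ok := by simp [hs₃, St.set_reg, hok₂]
  clear_value s₃
  have hlt := flat_lt hyn hbB
  rw [den_assign_seq, eval_ld_of_eq hz hp₃ (by decide) (eval_index (by rw [eval_var, hy₃])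
    (by rw [eval_var, hp₃.hB]) (by rw [eval_var, hk₃]) (by omega)) (by omega), hm₃, hT.ball_eq]
  set s₄ := s₃.set .u (ball y (k % B)) with hs₄
  have hp₄ : HasParams n N d B S s₄ := hp₃.set rfl _
  have hm₄ : s₄.mem = s.mem := hm₃
  have hy₄ : s₄.reg .y = y := by simp [hs₄, St.set_reg, hy₃]
  have hj₄ : s₄.reg .j = k / B := by simp [hs₄, St.set_reg, hj₃]
  have hu₄ : s₄.reg .u = ball y (k % B) := by simp [hs₄, St.set_reg]
  have hok₄ : s₄.reg .ok = s'.reg .ok := by simp [hs₄, St.set_reg, hok₃]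
  clear_value s₄
  rw [Com.den, eval_var, hu₄]
  by_cases hu0 : ball y (k % B) = 0
  · rw [if_pos hu0]
    refine next _ hm₄ hok₄ fun _ y' hy' u hu => ?_
    obtain rfl : y = y' := by omega
    omega
  obtain ⟨u, hu⟩ := Nat.exists_eq_succ_of_ne_zero hu0
  rw [Nat.succ_eq_add_one] at hu
  have hun : u < n := by have := hnum.ball_le y hyn _ hbB; omega
  have hlt' := flat_lt hyn hun
  rw [if_neg hu0, Com.den, eval_eq, eval_lit, eval_ld_of_eq hz hp₄ (by decide)
    (eval_index (by rw [eval_var, hy₄]) (by rw [eval_var, hp₄.hn])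
      (by rw [eval_sub, eval_var, eval_lit, hu₄, hu, Nat.add_sub_cancel]) (by omega)) (by omega),
    hm₄, hT.dist _ hyn _ hun]
  by_cases hyu : gdist G y u = 1
  swap
  · rw [if_neg hyu, if_pos rfl]
    refine next _ hm₄ hok₄ fun _ y' hy' u' hu' hyu' => ?_
    obtain rfl : y = y' := by omega
    obtain rfl : u = u' := by omega
    exact absurd hyu' hyu
  rw [if_pos hyu, if_neg one_ne_zero, den_seq]
  have hf := findInWindow_spec hz hp₄ hj₄ (by omega) hu₄
  have hok₅ := findInWindow.den_reg L (v := .ok) (by decide) s₄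
  rw [hm₄, hu] at hf
  set s₅ := findInWindow.den L s₄ with hs₅
  have hfound : s₅.reg .fnd ≠ 0 ↔ ∃ i ≤ k / B + d, slot B ball x c i = u + 1 := by
    refine hf.2.trans ⟨fun ⟨i, hi, h⟩ => ⟨i, hi, ?_⟩, fun ⟨i, hi, h⟩ => ⟨i, hi, ?_⟩⟩
    · rwa [hw _ (by omega)] at h
    · rwa [hw _ (by omega)]
  rw [Com.den, eval_var]
  by_cases hfnd : s₅.reg .fnd = 0
  · rw [if_pos hfnd, Com.den, eval_lit]
    refine ⟨hf.1, ⟨fun h => absurd (by simp [St.set_reg]) h, fun h => ?_⟩⟩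
    exact absurd hfnd (hfound.2 (h k (by omega) hgj y hy u hu hyu))
  · rw [if_neg hfnd]
    refine next _ hf.1 (hok₅.trans hok₄) fun _ y' hy' u' hu' _ => ?_
    obtain rfl : y = y' := by omega
    obtain rfl : u = u' := by omega
    exact hfound.1 hfnd

theorem newCode_spec (hz : Sizes n N d B S L) (hp : HasParams n N d B S s)
    (hT : HasTables G d B idx ball s.mem) (hnum : IsNumbering G d B idx ball) {x c g v : ℕ}
    (hx : s.reg .x = x) (hxn : x < n) (hv : s.reg .v = v) (hvn : v < n) (hc : s.reg .c = c)
    (hcS : c < S) (hg : s.reg .g = g) (hg1 : 1 ≤ g) (hgd : g ≤ d) :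
    (newCode.den L s).mem = s.mem ∧
      (newCode.den L s).reg .nc = nextCode B d c g (idx v x) := by
  have hd := hz.d_lt
  have hcodes := hz.codes
  have hcells := hz.cells
  have hnn := hz.nn_le
  have hlt := flat_lt hvn hxn
  have hi := hnum.lt_base v hvn x hxn
  obtain ⟨h, rfl⟩ : ∃ h, g = h + 1 := ⟨g - 1, by omega⟩
  have hpow := hz.pow_le (k := h + 1) (by omega)
  have hpow' : B ^ h * B = B ^ (h + 1) := (pow_succ _ _).symm
  have h₁ : c * B ^ (h + 1) + idx v x * B ^ h < S * S := by
    have h₂ : idx v x * B ^ h + 1 ≤ B ^ (h + 1) := by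
      rw [pow_succ, mul_comm]
      exact Nat.mul_lt_mul_of_pos_left hi (Nat.pow_pos hz.B_pos)
    have h₃ : (c + 1) * B ^ (h + 1) ≤ S * S := Nat.mul_le_mul hcS hpow
    rw [Nat.succ_mul] at h₃
    omega
  have h₂ := Nat.le_mul_self S
  rw [newCode, den_assign_seq,
    eval_ld_of_eq (i := h) hz hp (by decide) (by rw [eval_sub, eval_var, hg]; rfl) (by omega),
    hT.pow _ (by omega)]
  set s₁ := s.set .t (B ^ h) with hs₁
  have hp₁ : HasParams n N d B S s₁ := hp.set rfl _
  have ht₁ : s₁.reg .t = B ^ h := by simp [hs₁, St.set_reg]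
  have hx₁ : s₁.reg .x = x := by simp [hs₁, St.set_reg, hx]
  have hv₁ : s₁.reg .v = v := by simp [hs₁, St.set_reg, hv]
  have hc₁ : s₁.reg .c = c := by simp [hs₁, St.set_reg, hc]
  have hm₁ : s₁.mem = s.mem := rfl
  clear_value s₁
  have hld := eval_ld_of_eq (i := v * n + x) hz hp₁ (a := 1) (by decide)
    (eval_index (a := .var .v) (b := .var .n) (c := .var .x) (by rw [eval_var, hv₁])
      (by rw [eval_var, hp₁.hn]) (by rw [eval_var, hx₁]) (by omega)) (by omega)
  rw [hm₁, hT.idx_eq] at hld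
  rw [den_assign_seq, eval_add, eval_mul, eval_mul, eval_mul, hld, eval_var, eval_var, eval_var, hc₁, ht₁,
    hp₁.hB, hpow', Nat.mod_eq_of_lt (a := B ^ (h + 1)) (by omega),
    Nat.mod_eq_of_lt (a := c * B ^ (h + 1)) (by omega),
    Nat.mod_eq_of_lt (a := idx v x * B ^ h) (by omega), Nat.mod_eq_of_lt (by omega), Com.den,
    eval_rem (by simp [eval_var, St.set_reg]; omega)]
  refine ⟨hm₁, ?_⟩
  simp only [St.set_reg, eval_var, if_true]
  rw [if_neg (by decide), hp₁.hS, nextCode, if_neg (by omega), hz.S_eq]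
  rfl

end

end CycleEmbedding

namespace CycleEmbedding

/-! ### Shortest paths in a directed acyclic graph -/

/-- The state of a search for shortest paths from `z` along the relation `R` on `0, …, K - 1`, in
which the successors of all `u < k` have been treated: `T v` is `0` or the number of vertices of
some path from `z` to `v`, on which `Q v` stands before `v`. -/
structure Reached (R : ℕ → ℕ → Prop) (K z k : ℕ) (T Q : ℕ → ℕ) : Prop where
  start : T z = 1
  pred : ∀ v < K, v ≠ z → T v ≠ 0 → Q v ≤ k ∧ R (Q v) v ∧ T (Q v) ≠ 0 ∧ T v = T (Q v) + 1
  done : ∀ u < k, T u ≠ 0 → ∀ v, R u v → T v ≠ 0 ∧ T v ≤ T u + 1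

namespace Reached

variable {R : ℕ → ℕ → Prop} {K z k : ℕ} {T Q : ℕ → ℕ}

theorem init (h1 : T z = 1) (h0 : ∀ v < K, v ≠ z → T v = 0) : Reached R K z 0 T Q where
  start := h1
  pred v hv hz h := absurd (h0 v hv hz) h
  done u hu := absurd hu (Nat.not_lt_zero u)

/-- Moving along the edge from `k` to `v`, when this improves the count of `v`. -/
theorem relax (h : Reached R K z k T Q) (hR : ∀ u v, R u v → u < v) (hz : ∀ u, ¬ R u z)
    (hk : T k ≠ 0) {v : ℕ} (hv : R k v) (hT : T v = 0 ∨ T k + 1 < T v) :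
    Reached R K z k (Function.update T v (T k + 1)) (Function.update Q v k) where
  start := by
    rw [Function.update_of_ne, h.start]
    rintro rfl
    exact hz _ hv
  pred u hu huz hTu := by
    have hkv := hR _ _ hv
    by_cases huv : u = v
    · subst huv
      rw [Function.update_self, Function.update_self, Function.update_of_ne (by omega)]
      exact ⟨le_rfl, hv, hk, rfl⟩
    · rw [Function.update_of_ne huv] at hTu ⊢
      obtain ⟨h₁, h₂⟩ := h.pred u hu huz hTu
      rw [Function.update_of_ne huv, Function.update_of_ne (by omega)]
      exact ⟨h₁, h₂⟩
  done u hu hTu u' hu' := by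
    have hkv := hR _ _ hv
    have huv : u ≠ v := by omega
    rw [Function.update_of_ne huv] at hTu ⊢
    have h₁ := h.done u hu hTu u' hu'
    rw [Function.update_apply]
    split
    · subst u'
      omega
    · exact h₁

/-- The vertex `k` has been treated when all edges that leave it have been used. -/
theorem succ (h : Reached R K z k T Q) (hk : T k ≠ 0 → ∀ v, R k v → T v ≠ 0 ∧ T v ≤ T k + 1) :
    Reached R K z (k + 1) T Q where
  start := h.start
  pred v hv hz hT := by
    obtain ⟨h₁, h₂⟩ := h.pred v hv hz hT
    exact ⟨by omega, h₂⟩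
  done u hu hT := by
    rcases Nat.lt_succ_iff_lt_or_eq.1 hu with hu | rfl
    · exact h.done u hu hT
    · exact hk hT

/-- The counts fit into words, since the vertices increase along paths. -/
theorem le_succ (h : Reached R K z k T Q) (hR : ∀ u v, R u v → u < v) {v : ℕ} (hv : v < K) :
    T v ≤ v + 1 := by
  induction v using Nat.strong_induction_on with
  | _ v ih =>
    by_cases hz : v = z
    · rw [hz, h.start]
      omega
    by_cases h0 : T v = 0
    · omega
    obtain ⟨_, h₁, _, h₂⟩ := h.pred v hv hz h0
    have h₃ := hR _ _ h₁
    have := ih _ h₃ (by omega)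
    omega

/-- The counts are at most the numbers of vertices of paths from `z`. -/
theorem le_of_path (h : Reached R K z K T Q) {m : ℕ} {E : ℕ → ℕ} (h0 : E 0 = z)
    (hE : ∀ i, i + 1 < m → R (E i) (E (i + 1))) (hK : ∀ i < m, E i < K) {i : ℕ} (hi : i < m) :
    T (E i) ≠ 0 ∧ T (E i) ≤ i + 1 := by
  induction i with
  | zero => simp [h0, h.start]
  | succ i ih =>
    have h₁ := ih (by omega)
    have := h.done _ (hK i (by omega)) h₁.1 _ (hE i hi)
    omega

/-- The predecessors of a reached vertex form a path from `z` with `T e` vertices. -/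
theorem path (h : Reached R K z k T Q) (hR : ∀ u v, R u v → u < v) {e : ℕ} (he : e < K)
    (hT : T e ≠ 0) : Q^[T e - 1] e = z ∧ (∀ i < T e, Q^[i] e < K) ∧
      ∀ i, i + 1 < T e → R (Q^[i + 1] e) (Q^[i] e) := by
  have key : ∀ i < T e, Q^[i] e < K ∧ T (Q^[i] e) = T e - i := by
    intro i
    induction i with
    | zero => exact fun _ => ⟨he, rfl⟩
    | succ i ih =>
      intro hi
      obtain ⟨h₁, h₂⟩ := ih (by omega)
      have hz : Q^[i] e ≠ z := fun hz => by
        rw [hz, h.start] at h₂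
        omega
      obtain ⟨_, h₃, _, h₄⟩ := h.pred _ h₁ hz (by omega)
      rw [Function.iterate_succ_apply']
      have := hR _ _ h₃
      omega
  refine ⟨?_, fun i hi => (key i hi).1, fun i hi => ?_⟩
  · obtain ⟨h₁, h₂⟩ := key (T e - 1) (by omega)
    by_contra hz
    have := h.pred _ h₁ hz (by omega)
    omega
  · obtain ⟨h₁, h₂⟩ := key i (by omega)
    have hz : Q^[i] e ≠ z := fun hz => by
      rw [hz, h.start] at h₂
      omega
    rw [Function.iterate_succ_apply']
    exact (h.pred _ h₁ hz (by omega)).2.1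

end Reached

/-! ### Cells

The vertices of the search graph are the cells `e = (p * n + x) * S + c`, which stand for the window
with last vertex `x` and code `c`, when `x` is placed at the position `p`. -/

/-- The position of the last vertex of the window that the cell `e` stands for. -/
def cellPos (n S e : ℕ) : ℕ := e / S / n

/-- The last vertex of the window that the cell `e` stands for. -/
def cellVert (n S e : ℕ) : ℕ := e / S % n

section

variable {n N d B S L : ℕ} {s : St Var} {G : SimpleGraph (Fin n)} {idx ball : ℕ → ℕ → ℕ}

theorem cellPos_eq {q v c : ℕ} (hv : v < n) (hc : c < S) :
    cellPos n S ((q * n + v) * S + c) = q := by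
  rw [cellPos, flat_div hc, flat_div hv]

theorem cellVert_eq {q v c : ℕ} (hv : v < n) (hc : c < S) :
    cellVert n S ((q * n + v) * S + c) = v := by
  rw [cellVert, flat_div hc, flat_mod hv]

theorem cell_eq (e : ℕ) : (cellPos n S e * n + cellVert n S e) * S + e % S = e := by
  rw [cellPos, cellVert, Nat.div_add_mod', Nat.div_add_mod']

theorem lt_cells {q v c P : ℕ} (hv : v < n) (hc : c < S) (hq : q < P) :
    (q * n + v) * S + c < P * (n * S) := by
  rw [← mul_assoc]
  exact flat_lt (flat_lt hq hv) hc

theorem cellPos_lt {e P : ℕ} (h : e < P * (n * S)) : cellPos n S e < P := by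
  rw [cellPos, Nat.div_div_eq_div_mul]
  exact Nat.div_lt_of_lt_mul (by rwa [mul_comm S, mul_comm])

/-- The cell `e'` can be reached from the cell `e` by a move of at most `d` positions that does not
pass the end of the cycle. -/
structure Edge (G : SimpleGraph (Fin n)) (d B S : ℕ) (idx ball : ℕ → ℕ → ℕ) (N e e' : ℕ) :
    Prop where
  lt : cellPos n S e < cellPos n S e'
  le : cellPos n S e' ≤ cellPos n S e + d
  lt_N : cellPos n S e' < N
  lt_nd : cellPos n S e' < n * d
  move : Move G d B idx ball (cellVert n S e) (e % S) (cellPos n S e' - cellPos n S e)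
    (cellVert n S e') (e' % S)

theorem Edge.lt' {e e' : ℕ} (h : Edge G d B S idx ball N e e') : e < e' := by
  by_contra hle
  have : cellPos n S e' ≤ cellPos n S e := Nat.div_le_div_right (Nat.div_le_div_right (not_lt.1 hle))
  have := h.lt
  omega

theorem cellPos_of_lt {z : ℕ} (h : z < n * S) : cellPos n S z = 0 := by
  have := cellPos_lt (n := n) (S := S) (P := 1) (e := z) (by simpa using h)
  omega

/-- The variables of the program that describe the cell `e`. -/
structure AtCell (n S e : ℕ) (s : St Var) : Prop where
  hx : s.reg .x = cellVert n S e
  hp : s.reg .p = cellPos n S e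
  hc : s.reg .c = e % S

theorem AtCell.of_reg {e : ℕ} {s' : St Var} (h : AtCell n S e s) (hx : s'.reg .x = s.reg .x)
    (hp : s'.reg .p = s.reg .p) (hc : s'.reg .c = s.reg .c) : AtCell n S e s' :=
  ⟨hx.trans h.hx, hp.trans h.hp, hc.trans h.hc⟩

theorem unpack_spec (hz : Sizes n N d B S L) (hp : HasParams n N d B S s) {e : ℕ}
    (he : s.reg .e = e) (hlt : e < n * d * (n * S)) :
    (unpack.den L s).mem = s.mem ∧ AtCell n S e (unpack.den L s) := by
  have hcells := hz.cells
  have h₁ : e / S ≤ e := Nat.div_le_self _ _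
  refine ⟨rfl, ?_⟩
  rw [unpack, den_assign_seq, den_assign_seq, den_assign_seq, Com.den,
    eval_rem (by simp [eval_var, St.set_reg, he]; omega), eval_rem (by
      simp only [eval_var, eval_div, St.set_reg, he, hp.hS, if_true]
      simp
      omega)]
  constructor <;> simp [St.set_reg, eval_var, eval_div, he, hp.hS, hp.hn, cellVert, cellPos]

theorem relaxCell_spec (hz : Sizes n N d B S L) (hp : HasParams n N d B S s) {r e k : ℕ}
    (hr : s.reg .r = r) (hrK : r < n * d * (n * S)) (he : s.reg .e = e) (hk : s.reg .cnt = k)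
    (hkL : k + 1 < L) :
    (relaxCell.den L s).mem =
      if arr (3 + n * n) s.mem 4 r = 0 ∨ k + 1 < arr (3 + n * n) s.mem 4 r then
        Function.update (Function.update s.mem (cell (3 + n * n) 4 r) (k + 1))
          (cell (3 + n * n) 5 r) e
      else s.mem := by
  have hcells := hz.cells
  rw [relaxCell, den_assign_seq,
    eval_ld_of_eq hz hp (by decide) (by rw [eval_var, hr]) hrK]
  set t := arr (3 + n * n) s.mem 4 r with ht
  set s₁ := s.set .t t with hs₁
  have hp₁ : HasParams n N d B S s₁ := hp.set rfl _
  have ht₁ : s₁.reg .t = t := by simp [hs₁, St.set_reg]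
  have hr₁ : s₁.reg .r = r := by simp [hs₁, St.set_reg, hr]
  have he₁ : s₁.reg .e = e := by simp [hs₁, St.set_reg, he]
  have hk₁ : s₁.reg .cnt = k := by simp [hs₁, St.set_reg, hk]
  have hm₁ : s₁.mem = s.mem := rfl
  clear_value s₁
  have hk₂ : (Exp.var Var.cnt + .lit 1).eval L s₁ = k + 1 := by
    rw [eval_add, eval_var, eval_lit, hk₁, Nat.mod_eq_of_lt hkL]
  rw [Com.den, eval_add, eval_eq, eval_lt, hk₂, eval_var, ht₁, eval_lit, den_seq,
    den_st_of_eq hz hp₁ (by decide) (by rw [eval_var, hr₁]) hrK hk₂, hm₁]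
  have hp₂ : HasParams n N d B S
      ⟨s₁.reg, Function.update s.mem (cell (3 + n * n) 4 r) (k + 1)⟩ := hp₁.of_reg rfl
  rw [den_st_of_eq (i := r) (y := e) hz hp₂ (by decide) (by rw [eval_var, hr₁]) hrK
    (by rw [eval_var, he₁])]
  have hcond : ((if t = 0 then 1 else 0) + if k + 1 < t then 1 else 0) % L =
      if t = 0 ∨ k + 1 < t then 1 else 0 := by
    have h1 : 1 % L = 1 := Nat.mod_eq_of_lt (by omega)
    by_cases h₁ : t = 0 <;> by_cases h₂ : k + 1 < t <;> simp [h₁, h₂, h1]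
  rw [hcond]
  by_cases h : t = 0 ∨ k + 1 < t
  · rw [if_pos h, if_pos h, if_neg one_ne_zero]
  · rw [if_neg h, if_neg h, if_pos rfl]
    exact hm₁

/-- The number of a move in the order in which the program tries the moves from a cell. -/
def moveNumber (n B S : ℕ) (idx : ℕ → ℕ → ℕ) (e e' : ℕ) : ℕ :=
  (cellPos n S e' - cellPos n S e - 1) * B + idx (cellVert n S e) (cellVert n S e')

theorem Edge.moveNumber_lt {e e' : ℕ} (hz : Sizes n N d B S L) (hnum : IsNumbering G d B idx ball)
    (h : Edge G d B S idx ball N e e') : moveNumber n B S idx e e' < d * B := by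
  have h₁ := h.lt
  have h₂ := h.le
  exact flat_lt (by omega) (hnum.lt_base _ (Nat.mod_lt _ hz.n_pos) _ (Nat.mod_lt _ hz.n_pos))

/-- A trial changes the tables only along an edge that improves a count, and after the trial of an
edge no improvement along it is left. -/
theorem tryMove_spec (hz : Sizes n N d B S L) (hp : HasParams n N d B S s)
    (hT : HasTables G d B idx ball s.mem) (hnum : IsNumbering G d B idx ball) {e k f : ℕ}
    (he : s.reg .e = e) (heK : e < n * d * (n * S)) (hcell : AtCell n S e s)
    (hw : ∀ j ≤ 2 * d, arr (3 + n * n) s.mem 3 j = slot B ball (cellVert n S e) (e % S) j)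
    (hk : s.reg .cnt = k) (hkL : k + 1 < L) (hf : s.reg .f = f) (hfd : f < d * B) :
    ((tryMove.den L s).mem = s.mem ∨ ∃ e', Edge G d B S idx ball N e e' ∧
      (arr (3 + n * n) s.mem 4 e' = 0 ∨ k + 1 < arr (3 + n * n) s.mem 4 e') ∧
      (tryMove.den L s).mem = Function.update (Function.update s.mem (cell (3 + n * n) 4 e') (k + 1))
          (cell (3 + n * n) 5 e') e) ∧
    ∀ e', Edge G d B S idx ball N e e' → moveNumber n B S idx e e' = f →
      arr (3 + n * n) (tryMove.den L s).mem 4 e' ≠ 0 ∧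
        arr (3 + n * n) (tryMove.den L s).mem 4 e' ≤ k + 1 := by
  have hn := hz.n_pos
  have hcells := hz.cells
  have hNL := hz.N_lt
  have hd := hz.d_lt
  have hnB := hz.nB_le
  have hnn := hz.nn_le
  have hxn : cellVert n S e < n := Nat.mod_lt _ hn
  have hcS : e % S < S := Nat.mod_lt _ hz.S_pos
  have hpos := cellPos_lt heK
  have hnd : n * d ≤ n * d * (n * S) :=
    Nat.le_mul_of_pos_right _ (Nat.mul_pos hn hz.S_pos)
  have hfg : f / B < d := Nat.div_lt_of_lt_mul (by rwa [mul_comm])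
  have hfb : f % B < B := Nat.mod_lt _ hz.B_pos
  set x := cellVert n S e with hx
  set q := cellPos n S e with hq
  have key : ∀ e', Edge G d B S idx ball N e e' → moveNumber n B S idx e e' = f →
      cellPos n S e' = q + (f / B + 1) ∧ ball x (f % B) = cellVert n S e' + 1 := by
    rintro e' h rfl
    have h₁ := h.lt
    have h₂ := h.le
    have h₃ : gdist G x (cellVert n S e') ≤ _ := h.move.dist_le
    have hvn : cellVert n S e' < n := Nat.mod_lt _ hn
    have h₄ := hnum.lt_base x hxn _ hvn
    rw [moveNumber, flat_div h₄, flat_mod h₄]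
    exact ⟨by omega, hnum.ball_idx _ hxn _ hvn (by omega)⟩
  -- nothing happens if there is no move with the number `f`
  have idle : ∀ s' : St Var, s'.mem = s.mem →
      (∀ e', Edge G d B S idx ball N e e' → moveNumber n B S idx e e' ≠ f) →
      (s'.mem = s.mem ∨ ∃ e', Edge G d B S idx ball N e e' ∧
        (arr (3 + n * n) s.mem 4 e' = 0 ∨ k + 1 < arr (3 + n * n) s.mem 4 e') ∧
        s'.mem = Function.update (Function.update s.mem (cell (3 + n * n) 4 e') (k + 1))
          (cell (3 + n * n) 5 e') e) ∧
      ∀ e', Edge G d B S idx ball N e e' → moveNumber n B S idx e e' = f →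
        arr (3 + n * n) s'.mem 4 e' ≠ 0 ∧ arr (3 + n * n) s'.mem 4 e' ≤ k + 1 :=
    fun s' h h' => ⟨.inl h, fun e' h₁ h₂ => absurd h₂ (h' e' h₁)⟩
  rw [tryMove, den_assign_seq, den_assign_seq, eval_add, eval_div, eval_var, eval_var, eval_lit, hf,
    hp.hB, Nat.mod_eq_of_lt (by omega), eval_rem (by
      simp only [eval_var, St.set_reg, hf]
      have := Nat.mul_le_mul hz.B_le hz.B_le
      have : d * B ≤ B * B := Nat.mul_le_mul_right _ (by have := hz.base_ge'; omega)
      have := hz.codes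
      simp
      omega)]
  set g := f / B + 1 with hg
  have hg1 : 1 ≤ g := Nat.succ_pos _
  have hgd : g ≤ d := hfg
  set s₁ := (s.set .g g).set .b ((Exp.var Var.f).eval L (s.set .g g) %
    (Exp.var Var.B).eval L (s.set .g g)) with hs₁
  have hp₁ : HasParams n N d B S s₁ := (hp.set rfl _).set rfl _
  have hg₁ : s₁.reg .g = g := by simp [hs₁, St.set_reg]
  have hb₁ : s₁.reg .b = f % B := by simp [hs₁, St.set_reg, eval_var, hf, hp.hB]
  have hcell₁ : AtCell n S e s₁ := hcell.of_reg (by simp [hs₁, St.set_reg])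
    (by simp [hs₁, St.set_reg]) (by simp [hs₁, St.set_reg])
  have he₁ : s₁.reg .e = e := by simp [hs₁, St.set_reg, he]
  have hk₁ : s₁.reg .cnt = k := by simp [hs₁, St.set_reg, hk]
  have hm₁ : s₁.mem = s.mem := rfl
  clear_value s₁
  have hlt := flat_lt hxn hfb
  rw [den_assign_seq, eval_ld_of_eq hz hp₁ (by decide) (eval_index (i := x) (by rw [eval_var, hcell₁.hx])
    (by rw [eval_var, hp₁.hB]) (by rw [eval_var, hb₁]) (by omega)) (by omega), hm₁, hT.ball_eq]
  set s₂ := s₁.set .v (ball x (f % B)) with hs₂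
  have hp₂ : HasParams n N d B S s₂ := hp₁.set rfl _
  have hg₂ : s₂.reg .g = g := by simp [hs₂, St.set_reg, hg₁]
  have hcell₂ : AtCell n S e s₂ := hcell₁.of_reg (by simp [hs₂, St.set_reg])
    (by simp [hs₂, St.set_reg]) (by simp [hs₂, St.set_reg])
  have he₂ : s₂.reg .e = e := by simp [hs₂, St.set_reg, he₁]
  have hk₂ : s₂.reg .cnt = k := by simp [hs₂, St.set_reg, hk₁]
  have hm₂ : s₂.mem = s.mem := hm₁
  have hv₂ : s₂.reg .v = ball x (f % B) := by simp [hs₂, St.set_reg]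
  clear_value s₂
  rw [Com.den, eval_var, hv₂]
  by_cases hv0 : ball x (f % B) = 0
  · rw [if_pos hv0]
    refine idle _ hm₂ fun e' h₁ h₂ => ?_
    have := (key e' h₁ h₂).2
    omega
  obtain ⟨v, hv⟩ := Nat.exists_eq_succ_of_ne_zero hv0
  rw [Nat.succ_eq_add_one] at hv
  have hvn : v < n := by have := hnum.ball_le x hxn _ hfb; omega
  rw [if_neg hv0, den_assign_seq, den_assign_seq, eval_sub, eval_var, eval_lit, hv₂, hv,
    Nat.add_sub_cancel, eval_add, eval_var, eval_var]
  set s₃ := (s₂.set .v v).set .q (((s₂.set .v v).reg .p + (s₂.set .v v).reg .g) % L) with hs₃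
  have hp₃ : HasParams n N d B S s₃ := (hp₂.set rfl _).set rfl _
  have hg₃ : s₃.reg .g = g := by simp [hs₃, St.set_reg, hg₂]
  have hcell₃ : AtCell n S e s₃ := hcell₂.of_reg (by simp [hs₃, St.set_reg])
    (by simp [hs₃, St.set_reg]) (by simp [hs₃, St.set_reg])
  have he₃ : s₃.reg .e = e := by simp [hs₃, St.set_reg, he₂]
  have hk₃ : s₃.reg .cnt = k := by simp [hs₃, St.set_reg, hk₂]
  have hm₃ : s₃.mem = s.mem := hm₂
  have hv₃ : s₃.reg .v = v := by simp [hs₃, St.set_reg]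
  have hq₃ : s₃.reg .q = q + g := by
    simp [hs₃, St.set_reg, hcell₂.hp, hg₂]
    exact Nat.mod_eq_of_lt (by omega)
  clear_value s₃
  have hlt' := flat_lt hxn hvn
  have hcond : (Exp.lt (Exp.var Var.q) (Exp.var Var.N) *
        (Exp.lt (Exp.var Var.q) (Exp.var Var.nd) * (Exp.lit 1 - Exp.lt (Exp.var Var.g)
          (ld 0 (Exp.var Var.x * Exp.var Var.n + Exp.var Var.v))))).eval L s₃ =
      if q + g < N ∧ q + g < n * d ∧ gdist G x v ≤ g then 1 else 0 := by
    rw [eval_mul, eval_mul, eval_sub, eval_lt, eval_lt, eval_lt, eval_ld_of_eq hz hp₃ (by decide)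
      (eval_index (i := x) (by rw [eval_var, hcell₃.hx]) (by rw [eval_var, hp₃.hn])
        (by rw [eval_var, hv₃]) (by omega)) (by omega), hm₃, hT.dist _ hxn _ hvn, eval_var,
      eval_var, eval_var, eval_var, eval_lit, hq₃, hp₃.hN, hp₃.hnd, hg₃]
    have h1 : 1 % L = 1 := Nat.mod_eq_of_lt (by omega)
    by_cases h₁ : q + g < N <;> by_cases h₂ : q + g < n * d <;> by_cases h₃ : gdist G x v ≤ g <;>
      simp [h₁, h₂, h₃, h1, not_lt.2, lt_of_not_ge]
  rw [Com.den, hcond]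
  by_cases hcon : q + g < N ∧ q + g < n * d ∧ gdist G x v ≤ g
  swap
  · rw [if_neg hcon, if_pos rfl]
    refine idle _ hm₃ fun e' h₁ h₂ => hcon ?_
    obtain ⟨h₃, h₄⟩ := key e' h₁ h₂
    obtain rfl : v = cellVert n S e' := by omega
    rw [← h₃]
    refine ⟨h₁.lt_N, h₁.lt_nd, h₁.move.dist_le.trans ?_⟩
    omega
  rw [if_pos hcon, if_neg one_ne_zero, den_seq]
  obtain ⟨hqN, hqd, hdist⟩ := hcon
  have hcheck := checkWindow_spec hz hp₃ (by rw [hm₃]; exact hT) hnum hxn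
    (by rw [hm₃]; exact hw) hg₃ (by omega)
  have hfr : ∀ u : Var, u ∉ checkWindow.writes → (checkWindow.den L s₃).reg u = s₃.reg u :=
    fun u hu => checkWindow.den_reg L hu s₃
  have hp₄ : HasParams n N d B S (checkWindow.den L s₃) := hp₃.den (by decide)
  rw [hm₃] at hcheck
  set s₄ := checkWindow.den L s₃ with hs₄
  rw [Com.den, eval_var]
  by_cases hok : s₄.reg .ok = 0
  · rw [if_pos hok]
    refine idle _ hcheck.1 fun e' h₁ h₂ => ?_
    refine (hcheck.2.2 ?_) hok
    have h₅ := h₁.move.windowOk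
    rwa [(key e' h₁ h₂).1, Nat.add_sub_cancel_left] at h₅
  rw [if_neg hok, den_seq]
  have hcell₄ : AtCell n S e s₄ :=
    hcell₃.of_reg (hfr _ (by decide)) (hfr _ (by decide)) (hfr _ (by decide))
  have hg₄ : s₄.reg .g = g := (hfr _ (by decide)).trans hg₃
  have hv₄ : s₄.reg .v = v := (hfr _ (by decide)).trans hv₃
  have hq₄ : s₄.reg .q = q + g := (hfr _ (by decide)).trans hq₃
  have he₄ : s₄.reg .e = e := (hfr _ (by decide)).trans he₃
  have hk₄ : s₄.reg .cnt = k := (hfr _ (by decide)).trans hk₃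
  have hcode := newCode_spec hz hp₄ (by rw [hcheck.1]; exact hT) hnum hcell₄.hx hxn hv₄ hvn
    hcell₄.hc hcS hg₄ hg1 hgd
  have hfr' : ∀ u : Var, u ∉ newCode.writes → (newCode.den L s₄).reg u = s₄.reg u :=
    fun u hu => newCode.den_reg L hu s₄
  have hp₅ : HasParams n N d B S (newCode.den L s₄) := hp₄.den (by decide)
  rw [hcheck.1] at hcode
  set s₅ := newCode.den L s₄ with hs₅
  have hc' : nextCode B d (e % S) g (idx v x) < S := by
    rw [hz.S_eq]
    exact nextCode_lt hz.B_pos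
  have hlt₁ := flat_lt hqd hvn
  have hlt₂ := lt_cells hvn hc' hqd
  set c' := nextCode B d (e % S) g (idx v x) with hc'_def
  set e' := ((q + g) * n + v) * S + c' with he'
  have hev : ((Exp.var Var.q * .var .n + .var .v) * .var .S + .var .nc).eval L s₅ = e' := by
    have h₁ : n * d * n ≤ n * d * (n * S) :=
      Nat.mul_le_mul_left _ (Nat.le_mul_of_pos_right _ hz.S_pos)
    refine eval_index (eval_index (by rw [eval_var, hfr' _ (by decide), hq₄])
      (by rw [eval_var, hp₅.hn]) (by rw [eval_var, hfr' _ (by decide), hv₄]) (by omega))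
      (by rw [eval_var, hp₅.hS]) (by rw [eval_var, hcode.2]) (by omega)
  rw [den_assign_seq, hev]
  have hr := relaxCell_spec (s := s₅.set .r e') (r := e') (e := e) (k := k) hz (hp₅.set rfl _)
    (by simp [St.set_reg]) hlt₂ (by simp [St.set_reg, hfr' .e (by decide), he₄])
    (by simp [St.set_reg, hfr' .cnt (by decide), hk₄]) hkL
  rw [St.set_mem, hcode.1] at hr
  have hpos' : cellPos n S e' = q + g := cellPos_eq hvn hc'
  have hvert' : cellVert n S e' = v := cellVert_eq hvn hc'
  have hcode' : e' % S = c' := flat_mod hc'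
  have hedge : Edge G d B S idx ball N e e' := by
    refine ⟨by omega, by omega, by omega, by omega, ?_⟩
    rw [hpos', ← hq, Nat.add_sub_cancel_left, hvert', hcode']
    exact ⟨hdist, hcheck.2.1 hok, rfl⟩
  constructor
  · split at hr
    · exact .inr ⟨e', hedge, ‹_›, hr⟩
    · exact .inl hr
  · intro e'' h₁ h₂
    have : e'' = e' := by
      obtain ⟨h₃, h₄⟩ := key e'' h₁ h₂
      have h₅ : v = cellVert n S e'' := by omega
      have h₆ := h₁.move.code
      rw [h₃, Nat.add_sub_cancel_left, ← h₅] at h₆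
      rw [← cell_eq (n := n) (S := S) e'', h₃, ← h₅, h₆]
    rw [this, hr]
    split
    · rw [arr_update_of_ne (by decide) (by decide) (by decide), arr_update, Function.update_self]
      omega
    · omega

end

end CycleEmbedding

namespace CycleEmbedding

/-! ### The search for closed trails -/

/-- The window that was chosen as the start `z` is reached again from the cell `e`, at the end of the
cycle. -/
def Closes {n : ℕ} (G : SimpleGraph (Fin n)) (d B S : ℕ) (idx ball : ℕ → ℕ → ℕ) (N z e : ℕ) :
    Prop :=
  Move G d B idx ball (cellVert n S e) (e % S) (N - cellPos n S e) (cellVert n S z) (z % S)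

section

variable {n N d B S L : ℕ} {s : St Var} {G : SimpleGraph (Fin n)} {idx ball : ℕ → ℕ → ℕ}

theorem not_edge_start {z : ℕ} (hz : z < n * S) (u : ℕ) : ¬ Edge G d B S idx ball N u z := fun h => by
  have := h.lt
  rw [cellPos_of_lt hz] at this
  omega

/-- A path of cells that can be closed is a closed trail. -/
theorem closedTrail_of_reached {K z k e : ℕ} {T Q : ℕ → ℕ} (hn : 0 < n) (hN : 0 < N)
    (hzn : z < n * S) (h : Reached (Edge G d B S idx ball N) K z k T Q) (he : e < K) (hT : T e ≠ 0)
    (hc : Closes G d B S idx ball N z e) :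
    ClosedTrail G d B idx ball N (T e) (fun i => cellVert n S (Q^[T e - 1 - i] e))
      (fun i => cellPos n S (Q^[T e - 1 - i] e)) (fun i => Q^[T e - 1 - i] e % S) := by
  obtain ⟨h₁, h₂, h₃⟩ := h.path (fun _ _ => Edge.lt') he hT
  have hedge : ∀ i, i + 1 < T e →
      Edge G d B S idx ball N (Q^[T e - 1 - i] e) (Q^[T e - 1 - (i + 1)] e) := fun i hi => by
    have := h₃ (T e - 1 - (i + 1)) (by omega)
    rwa [show T e - 1 - (i + 1) + 1 = T e - 1 - i by omega] at this
  refine ⟨by omega, fun i _ => Nat.mod_lt _ hn, ?_, ?_, fun i hi => (hedge i hi).lt,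
    fun i hi => (hedge i hi).move, ?_⟩
  · simp only [Nat.sub_zero, h₁]
    exact cellPos_of_lt hzn
  · simp only [Nat.sub_self, Function.iterate_zero, id]
    by_cases hz : e = z
    · rw [hz, cellPos_of_lt hzn]
      exact hN
    · exact (h.pred e he hz hT).2.1.lt_N
  · simp only [Nat.sub_self, Function.iterate_zero, id, Nat.sub_zero, h₁]
    exact hc

/-- Since edges lead to larger cells, one pass through all cells in increasing order finds all
shortest paths. -/
theorem reachPass_spec (hz : Sizes n N d B S L) (hp : HasParams n N d B S s)
    (hT : HasTables G d B idx ball s.mem) (hnum : IsNumbering G d B idx ball) {z : ℕ}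
    (hzn : z < n * S) (h1 : arr (3 + n * n) s.mem 4 z = 1)
    (h0 : ∀ v < n * d * (n * S), v ≠ z → arr (3 + n * n) s.mem 4 v = 0) :
    Unchanged [3, 4, 5] (3 + n * n) s.mem (reachPass.den L s).mem ∧
      Reached (Edge G d B S idx ball N) (n * d * (n * S)) z (n * d * (n * S))
        (arr (3 + n * n) (reachPass.den L s).mem 4) (arr (3 + n * n) (reachPass.den L s).mem 5) := by
  have hn := hz.n_pos
  have hcells := hz.cells
  have hd := hz.d_lt
  have hstart := not_edge_start (G := G) (d := d) (B := B) (idx := idx) (ball := ball) (N := N) hzn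
  let I : ℕ → St Var → Prop := fun k s' => Unchanged [3, 4, 5] (3 + n * n) s.mem s'.mem ∧
    Reached (Edge G d B S idx ball N) (n * d * (n * S)) z k
      (arr (3 + n * n) s'.mem 4) (arr (3 + n * n) s'.mem 5)
  suffices h : I (n * d * (n * S)) (reachPass.den L s) from h
  refine loop_rule (by decide) hp hp.hRS I (fun k s' x h => h)
    ⟨Unchanged.refl _ _ _, Reached.init h1 h0⟩ ?_
  rintro k s' hk he hp' hfr ⟨hu, hreach⟩
  have hkT := hreach.le_succ (fun _ _ => Edge.lt') hk
  rw [den_assign_seq, eval_ld_of_eq hz hp' (by decide) (by rw [eval_var, he]) hk]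
  set t := arr (3 + n * n) s'.mem 4 k with ht
  set s₁ := s'.set .cnt t with hs₁
  have hp₁ : HasParams n N d B S s₁ := hp'.set rfl _
  have hm₁ : s₁.mem = s'.mem := rfl
  have he₁ : s₁.reg .e = k := by simp [hs₁, St.set_reg, he]
  have ht₁ : s₁.reg .cnt = t := by simp [hs₁, St.set_reg]
  clear_value s₁
  rw [Com.den, eval_var, ht₁]
  by_cases ht0 : t = 0
  · rw [if_pos ht0]
    change I (k + 1) s₁
    refine ⟨hm₁ ▸ hu, ?_⟩
    rw [hm₁]
    exact hreach.succ fun h => absurd ht0 h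
  rw [if_neg ht0, den_seq, den_seq]
  obtain ⟨hm₂, hcell₂⟩ := unpack_spec hz hp₁ he₁ hk
  have hp₂ : HasParams n N d B S (unpack.den L s₁) := hp₁.den (by decide)
  have he₂ := unpack.den_reg L (v := .e) (by decide) s₁
  have ht₂ := unpack.den_reg L (v := .cnt) (by decide) s₁
  rw [he₁] at he₂
  rw [ht₁] at ht₂
  rw [hm₁] at hm₂
  set s₂ := unpack.den L s₁ with hs₂
  have hT₂ : HasTables G d B idx ball s₂.mem := by
    rw [hm₂]
    exact hT.of_unchanged hu (by decide) (by decide) (by decide) (by decide)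
  obtain ⟨hu₃, hw₃⟩ := decode_spec hz hp₂ hT₂ hnum hcell₂.hx (Nat.mod_lt _ hn) hcell₂.hc
    (Nat.mod_lt _ hz.S_pos)
  have hfr₃ : ∀ u : Var, u ∉ decode.writes → (decode.den L s₂).reg u = s₂.reg u :=
    fun u hu => decode.den_reg L hu s₂
  have hp₃ : HasParams n N d B S (decode.den L s₂) := hp₂.den (by decide)
  rw [hm₂] at hu₃
  set s₃ := decode.den L s₂ with hs₃
  have hu₃' : Unchanged [3, 4, 5] (3 + n * n) s'.mem s₃.mem := fun q hq =>
    hu₃ q (hq.imp_right fun h h' => h (by simp at h'; simp [h']))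
  have h₄ : arr (3 + n * n) s₃.mem 4 = arr (3 + n * n) s'.mem 4 := hu₃.arr (by decide) (by decide)
  have h₅ : arr (3 + n * n) s₃.mem 5 = arr (3 + n * n) s'.mem 5 := hu₃.arr (by decide) (by decide)
  let J : ℕ → St Var → Prop := fun f s' =>
    Unchanged [3, 4, 5] (3 + n * n) s.mem s'.mem ∧
    Reached (Edge G d B S idx ball N) (n * d * (n * S)) z k
      (arr (3 + n * n) s'.mem 4) (arr (3 + n * n) s'.mem 5) ∧
    (∀ j ≤ 2 * d, arr (3 + n * n) s'.mem 3 j = slot B ball (cellVert n S k) (k % S) j) ∧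
    arr (3 + n * n) s'.mem 4 k = t ∧
    ∀ e', Edge G d B S idx ball N k e' → moveNumber n B S idx k e' < f →
      arr (3 + n * n) s'.mem 4 e' ≠ 0 ∧ arr (3 + n * n) s'.mem 4 e' ≤ t + 1
  suffices h : J (d * B) (Com.den L (.loop .f .dB tryMove) s₃) by
    obtain ⟨h₁, h₂, _, h₃, h₄⟩ := h
    refine ⟨h₁, h₂.succ fun _ e' he' => ?_⟩
    rw [h₃]
    exact h₄ e' he' (he'.moveNumber_lt hz hnum)
  refine loop_rule (by decide) hp₃ hp₃.hdB J (fun k s' x h => h)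
    ⟨hu.trans hu₃', by rwa [h₄, h₅], hw₃, by rw [h₄], by simp⟩ ?_
  rintro f s₄ hf hf₄ hp₄ hfr₄ ⟨hu₄, hreach₄, hw₄, ht₄, hdone₄⟩
  have hreg : ∀ u : Var, u ∉ (Com.loop .f .dB tryMove).writes → u ∉ decode.writes →
      s₄.reg u = s₂.reg u := fun u h h' => (hfr₄ u h).trans (hfr₃ u h')
  have hT₄ := hT.of_unchanged hu₄ (by decide) (by decide) (by decide) (by decide)
  obtain ⟨hres, hnew⟩ := tryMove_spec hz hp₄ hT₄ hnum
    (by rw [hreg _ (by decide) (by decide), he₂]) hk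
    (hcell₂.of_reg (hreg _ (by decide) (by decide)) (hreg _ (by decide) (by decide))
      (hreg _ (by decide) (by decide))) hw₄ (by rw [hreg _ (by decide) (by decide), ht₂])
    (show t + 1 < L by omega) hf₄ hf
  set s₅ := tryMove.den L s₄ with hs₅
  rcases hres with hm | ⟨e', he', hlt, hm⟩
  · rw [hm] at hnew
    refine ⟨hm ▸ hu₄, by rwa [hm], by rwa [hm], by rwa [hm], fun e' he' hf' => ?_⟩
    rw [hm]
    rcases Nat.lt_succ_iff_lt_or_eq.1 hf' with h | h
    · exact hdone₄ e' he' h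
    · exact hnew e' he' h
  · have hT₅ : arr (3 + n * n) s₅.mem 4 =
        Function.update (arr (3 + n * n) s₄.mem 4) e' (t + 1) := by
      rw [hm, arr_update_of_ne (by decide) (by decide) (by decide), arr_update]
    have hQ₅ : arr (3 + n * n) s₅.mem 5 = Function.update (arr (3 + n * n) s₄.mem 5) e' k := by
      rw [hm, arr_update, arr_update_of_ne (by decide) (by decide) (by decide)]
    have h3₅ : arr (3 + n * n) s₅.mem 3 = arr (3 + n * n) s₄.mem 3 := by
      rw [hm, arr_update_of_ne (by decide) (by decide) (by decide),
        arr_update_of_ne (by decide) (by decide) (by decide)]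
    have hke := he'.lt'
    refine ⟨?_, ?_, by rwa [h3₅], ?_, fun e'' he'' hf' => ?_⟩
    · rw [hm]
      exact (hu₄.update (by decide) (by simp)).update (by decide) (by simp)
    · rw [hT₅, hQ₅]
      have := hreach₄.relax (fun _ _ => Edge.lt') hstart (by rwa [ht₄]) he' (by rwa [ht₄])
      rwa [ht₄] at this
    · rw [hT₅, Function.update_of_ne (by omega), ht₄]
    · rcases Nat.lt_succ_iff_lt_or_eq.1 hf' with h | h
      · rw [hT₅, Function.update_apply]
        split
        · omega
        · exact hdone₄ e'' he'' h
      · exact hnew e'' he'' h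

/-- The predecessors are followed from the cell `e`, and the position of each vertex met is written. -/
theorem writeOutput_spec (hz : Sizes n N d B S L) (hp : HasParams n N d B S s) {e : ℕ}
    {Q : ℕ → ℕ} (he : s.reg .res = e + 1) (hQ : arr (3 + n * n) s.mem 5 = Q)
    (hK : ∀ i < n, Q^[i] e < n * d * (n * S))
    (hinj : Set.InjOn (fun i => cellVert n S (Q^[i] e)) (Set.Iio n)) :
    (writeOutput.den L s).mem 0 = 1 ∧
      ∀ i < n, (writeOutput.den L s).mem (1 + cellVert n S (Q^[i] e)) =
        cellPos n S (Q^[i] e) := by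
  have hn := hz.n_pos
  have hcells := hz.cells
  have hnn : n ≤ n * n := Nat.le_mul_of_pos_left _ hn
  let I : ℕ → St Var → Prop := fun k s' => s'.mem 0 = 1 ∧
    s'.reg .r = Q^[k] e ∧ arr (3 + n * n) s'.mem 5 = Q ∧
    ∀ i < k, s'.mem (1 + cellVert n S (Q^[i] e)) = cellPos n S (Q^[i] e)
  suffices h : I n (writeOutput.den L s) from ⟨h.1, h.2.2.2⟩
  rw [writeOutput, den_seq, den_assign_seq, Com.den]
  simp only [eval_lit, eval_var, eval_sub, he, Nat.add_sub_cancel]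
  set s₁ : St Var := (⟨s.reg, Function.update s.mem 0 1⟩ : St Var).set .r e with hs₁
  have hp₁ : HasParams n N d B S s₁ := hp.of_eq fun v hv => by
    rw [hs₁, St.set_reg, if_neg]
    rintro rfl
    exact absurd hv (by decide)
  refine loop_rule (by decide) hp₁ hp₁.hn I ?_ ?_ ?_
  · rintro k s' x ⟨h₂, h₃, h₄⟩
    exact ⟨h₂, by simpa [St.set_reg] using h₃, h₄⟩
  · refine ⟨by simp [hs₁], by simp [hs₁, St.set_reg], ?_, by simp⟩
    rw [hs₁, St.set_mem, arr_update_low (by omega)]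
    exact hQ
  rintro k s' hk hi hp' hfr ⟨h₂, h₃, h₄, h₅⟩
  have hlt := hK k hk
  have hdiv : Q^[k] e / S ≤ Q^[k] e := Nat.div_le_self _ _
  rw [den_assign_seq, den_assign_seq, den_assign_seq, den_seq,
    eval_rem (by simp [eval_var, eval_div, St.set_reg, h₃, hp'.hS]; omega)]
  simp only [eval_var, eval_div]
  set s₂ := ((s'.set .t (s'.reg .r / s'.reg .S)).set .u
    ((s'.set .t (s'.reg .r / s'.reg .S)).reg .t / (s'.set .t (s'.reg .r / s'.reg .S)).reg .n)).set .y
    (((s'.set .t (s'.reg .r / s'.reg .S)).set .u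
    ((s'.set .t (s'.reg .r / s'.reg .S)).reg .t / (s'.set .t (s'.reg .r / s'.reg .S)).reg .n)).reg .t
    % ((s'.set .t (s'.reg .r / s'.reg .S)).set .u
    ((s'.set .t (s'.reg .r / s'.reg .S)).reg .t /
      (s'.set .t (s'.reg .r / s'.reg .S)).reg .n)).reg .n) with hs₂
  have hp₂ : HasParams n N d B S s₂ := ((hp'.set rfl _).set rfl _).set rfl _
  have hm₂ : s₂.mem = s'.mem := rfl
  have hu₂ : s₂.reg .u = cellPos n S (Q^[k] e) := by
    simp [hs₂, St.set_reg, h₃, hp'.hS, hp'.hn, cellPos]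
  have hy₂ : s₂.reg .y = cellVert n S (Q^[k] e) := by
    simp [hs₂, St.set_reg, h₃, hp'.hS, hp'.hn, cellVert]
  have hr₂ : s₂.reg .r = Q^[k] e := by simp [hs₂, St.set_reg, h₃]
  clear_value s₂
  have hvert : ∀ i, cellVert n S (Q^[i] e) < n := fun i => Nat.mod_lt _ hn
  have hv := hvert k
  have hst : Com.den L (.store (.lit 1 + .var .y) (.var .u)) s₂ = ⟨s₂.reg, Function.update s'.mem
      (1 + cellVert n S (Q^[k] e)) (cellPos n S (Q^[k] e))⟩ := by
    rw [Com.den, eval_add, eval_lit, eval_var, eval_var, hy₂, hu₂, hm₂, Nat.mod_eq_of_lt (by omega)]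
  rw [hst]
  set s₃ : St Var := ⟨s₂.reg, Function.update s'.mem
      (1 + cellVert n S (Q^[k] e)) (cellPos n S (Q^[k] e))⟩ with hs₃
  have hp₃ : HasParams n N d B S s₃ := hp₂.of_reg rfl
  have hQ₃ : arr (3 + n * n) s₃.mem 5 = Q := by
    rw [hs₃, arr_update_low (by omega), h₄]
  rw [Com.den, eval_ld_of_eq (i := Q^[k] e) hz hp₃ (by decide) (by rw [eval_var]; exact hr₂) hlt,
    hQ₃]
  refine ⟨?_, ?_, hQ₃, fun i hi => ?_⟩
  · rw [St.set_mem, hs₃]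
    dsimp only
    rw [Function.update_of_ne (by omega), h₂]
  · rw [Function.iterate_succ_apply']
    simp [St.set_reg]
  · rw [St.set_mem, hs₃]
    dsimp only
    rcases Nat.lt_succ_iff_lt_or_eq.1 hi with h | rfl
    · rw [Function.update_of_ne, h₅ i h]
      intro heq
      have := hinj (show i ∈ Set.Iio n from h.trans hk) (show k ∈ Set.Iio n from hk)
        (Nat.add_left_cancel heq)
      omega
    · rw [Function.update_self]

end

end CycleEmbedding

namespace CycleEmbedding

/-! ### The correctness of the search -/

section

variable {n N d B S L : ℕ} {s : St Var} {G : SimpleGraph (Fin n)} {idx ball : ℕ → ℕ → ℕ}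

/-- A closed trail with `n` moves is an embedding, and `writeOutput` writes it down. -/
theorem isCorrectAnswer_writeOutput (hz : Sizes n N d B S L) (hp : HasParams n N d B S s)
    (hG : G.Connected) (hnum : IsNumbering G d B idx ball) {z k e : ℕ} {T Q : ℕ → ℕ}
    (hzn : z < n * S) (hreach : Reached (Edge G d B S idx ball N) (n * d * (n * S)) z k T Q)
    (he : s.reg .res = e + 1) (heK : e < n * d * (n * S)) (hQ : arr (3 + n * n) s.mem 5 = Q)
    (hT : T e = n) (hc : Closes G d B S idx ball N z e) :
    IsCorrectAnswer G N d (writeOutput.den L s).mem := by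
  have hn := hz.n_pos
  have htrail := closedTrail_of_reached hn (by have := hz.three_le; omega) hzn hreach heK
    (by omega) hc
  have hK := (hreach.path (fun _ _ => Edge.lt') heK (by omega)).2.1
  rw [hT] at htrail hK
  obtain ⟨hinj, F, hF, hFp⟩ := htrail.exists_embedding hnum hG hz.three_le
  have hinj' : Set.InjOn (fun i => cellVert n S (Q^[i] e)) (Set.Iio n) := by
    intro i hi j hj hij
    have hi' : i < n := hi
    have hj' : j < n := hj
    have := hinj (show n - 1 - i ∈ Set.Iio n from by simp; omega)
      (show n - 1 - j ∈ Set.Iio n from by simp; omega) (by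
        dsimp only at hij ⊢
        rwa [show n - 1 - (n - 1 - i) = i by omega, show n - 1 - (n - 1 - j) = j by omega])
    omega
  obtain ⟨h₂, h₃⟩ := writeOutput_spec hz hp he hQ hK hinj'
  refine .inl ⟨h₂, F, hF, fun v => ?_⟩
  obtain ⟨i, hi, hv⟩ := htrail.exists_eq hnum hG v.2
  rw [hFp v i hi hv, ← h₃ _ (show n - 1 - i < n by omega), ← hv]

/-- The pass decides whether some cell is reached with `n` vertices and closes. -/
theorem closePass_spec (hz : Sizes n N d B S L) (hp : HasParams n N d B S s)
    (hT : HasTables G d B idx ball s.mem) (hnum : IsNumbering G d B idx ball) {z : ℕ}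
    (hzn : z < n * S) (hx0 : s.reg .x0 = cellVert n S z) (hc0 : s.reg .c0 = z % S)
    (hreach : Reached (Edge G d B S idx ball N) (n * d * (n * S)) z (n * d * (n * S))
      (arr (3 + n * n) s.mem 4) (arr (3 + n * n) s.mem 5)) (hdone : s.reg .done = 0) :
    Unchanged [3] (3 + n * n) s.mem (closePass.den L s).mem ∧
      ((closePass.den L s).reg .done ≠ 0 → ∃ e < n * d * (n * S),
        (closePass.den L s).reg .res = e + 1 ∧ arr (3 + n * n) s.mem 4 e = n ∧
          Closes G d B S idx ball N z e) ∧
      ((closePass.den L s).reg .done = 0 → (closePass.den L s).reg .res = s.reg .res ∧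
        ∀ e < n * d * (n * S), arr (3 + n * n) s.mem 4 e = n → ¬ Closes G d B S idx ball N z e) := by
  have hn := hz.n_pos
  have hcells := hz.cells
  have hNL := hz.N_lt
  have hnn := hz.nn_le
  set T := arr (3 + n * n) s.mem 4 with hT_def
  let I : ℕ → St Var → Prop := fun k s' =>
    Unchanged [3] (3 + n * n) s.mem s'.mem ∧
      (s'.reg .done ≠ 0 → ∃ e < n * d * (n * S), s'.reg .res = e + 1 ∧ T e = n ∧
        Closes G d B S idx ball N z e) ∧
      (s'.reg .done = 0 → s'.reg .res = s.reg .res ∧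
        ∀ e < k, T e = n → ¬ Closes G d B S idx ball N z e)
  suffices h : I (n * d * (n * S)) (closePass.den L s) from h
  refine loop_rule (by decide) hp hp.hRS I (fun k s' x h => by simpa [I, St.set_reg] using h)
    ⟨Unchanged.refl _ _ _, fun h => absurd hdone h, fun _ => ⟨rfl, by simp⟩⟩ ?_
  rintro k s' hk he hp' hfr ⟨hu, hdone', hnot⟩
  have h1 : 1 % L = 1 := Nat.mod_eq_of_lt (by omega)
  have hcond : (Exp.eq (Exp.var Var.done) (Exp.lit 0) *
      Exp.eq (ld 4 (Exp.var Var.e)) (Exp.var Var.n)).eval L s' =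
      if s'.reg .done = 0 ∧ arr (3 + n * n) s'.mem 4 k = n then 1 else 0 := by
    rw [eval_mul, eval_eq, eval_eq, eval_ld_of_eq hz hp' (by decide) (by rw [eval_var, he]) hk,
      eval_var, eval_var, eval_lit, hp'.hn]
    by_cases h₁ : s'.reg .done = 0 <;> by_cases h₂ : arr (3 + n * n) s'.mem 4 k = n <;>
      simp [h₁, h₂, h1]
  rw [Com.den, hcond]
  by_cases hcon : s'.reg .done = 0 ∧ arr (3 + n * n) s'.mem 4 k = n
  swap
  · rw [if_neg hcon, if_pos rfl]
    refine ⟨hu, hdone', fun h => ⟨(hnot h).1, fun e he hTe => ?_⟩⟩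
    rcases Nat.lt_succ_iff_lt_or_eq.1 he with he | rfl
    · exact (hnot h).2 e he hTe
    · refine absurd ⟨h, ?_⟩ hcon
      rwa [hu.arr (by decide) (by decide)]
  rw [if_pos hcon, if_neg one_ne_zero, den_seq, den_seq]
  obtain ⟨hd', hTk⟩ := hcon
  obtain ⟨hres, hnot⟩ := hnot hd'
  rw [hu.arr (by decide) (by decide)] at hTk
  obtain ⟨hm₂, hcell₂⟩ := unpack_spec hz hp' he hk
  have hp₂ : HasParams n N d B S (unpack.den L s') := hp'.den (by decide)
  have hfr₂ : ∀ u : Var, u ∉ unpack.writes → (unpack.den L s').reg u = s'.reg u :=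
    fun u hu => unpack.den_reg L hu s'
  set s₂ := unpack.den L s' with hs₂
  have hT₂ : HasTables G d B idx ball s₂.mem := by
    rw [hm₂]
    exact hT.of_unchanged hu (by decide) (by decide) (by decide) (by decide)
  have hxn : cellVert n S k < n := Nat.mod_lt _ hn
  obtain ⟨hu₃, hw₃⟩ := decode_spec hz hp₂ hT₂ hnum hcell₂.hx hxn hcell₂.hc
    (Nat.mod_lt _ hz.S_pos)
  have hfr₃ : ∀ u : Var, u ∉ decode.writes → (decode.den L s₂).reg u = s₂.reg u :=
    fun u hu => decode.den_reg L hu s₂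
  have hp₃ : HasParams n N d B S (decode.den L s₂) := hp₂.den (by decide)
  rw [hm₂] at hu₃
  set s₃ := decode.den L s₂ with hs₃
  have hT₃ := hT.of_unchanged (hu.trans hu₃) (by decide) (by decide) (by decide) (by decide)
  have hreg₃ : ∀ u : Var, u ∉ closePass.writes → s₃.reg u = s.reg u := fun u hu => by
    simp only [closePass, Com.writes, List.mem_cons, List.mem_append, not_or] at hu
    rw [hfr₃ _ (by tauto), hfr₂ _ (by tauto), hfr]
    simp only [Com.writes, List.mem_cons, List.mem_append, not_or]
    tauto
  have hr₃ : s₃.reg .res = s.reg .res := by rw [hfr₃ _ (by decide), hfr₂ _ (by decide), hres]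
  have hd₃ : s₃.reg .done = 0 := by rw [hfr₃ _ (by decide), hfr₂ _ (by decide), hd']
  have he₃ : s₃.reg .e = k := by rw [hfr₃ _ (by decide), hfr₂ _ (by decide), he]
  have hcell₃ : AtCell n S k s₃ :=
    hcell₂.of_reg (hfr₃ _ (by decide)) (hfr₃ _ (by decide)) (hfr₃ _ (by decide))
  have hx₃ : s₃.reg .x0 = cellVert n S z := (hreg₃ _ (by decide)).trans hx0
  have hc₃ : s₃.reg .c0 = z % S := (hreg₃ _ (by decide)).trans hc0
  rw [den_assign_seq, den_assign_seq, eval_sub]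
  simp only [eval_var]
  set s₄ := (s₃.set .g (s₃.reg .N - s₃.reg .p)).set .v ((s₃.set .g (s₃.reg .N - s₃.reg .p)).reg .x0)
    with hs₄
  have hp₄ : HasParams n N d B S s₄ := (hp₃.set rfl _).set rfl _
  set g := N - cellPos n S k with hg
  have hg₄ : s₄.reg .g = g := by simp [hs₄, St.set_reg, hcell₃.hp, hp₃.hN, hg]
  have hv₄ : s₄.reg .v = cellVert n S z := by simp [hs₄, St.set_reg, hx₃]
  have hcell₄ : AtCell n S k s₄ := hcell₃.of_reg (by simp [hs₄, St.set_reg])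
    (by simp [hs₄, St.set_reg]) (by simp [hs₄, St.set_reg])
  have hc₄ : s₄.reg .c0 = z % S := by simp [hs₄, St.set_reg, hc₃]
  have hr₄ : s₄.reg .res = s.reg .res := by simp [hs₄, St.set_reg, hr₃]
  have hd₄ : s₄.reg .done = 0 := by simp [hs₄, St.set_reg, hd₃]
  have he₄ : s₄.reg .e = k := by simp [hs₄, St.set_reg, he₃]
  have hm₄ : s₄.mem = s₃.mem := rfl
  clear_value s₄
  have hvn : cellVert n S z < n := Nat.mod_lt _ hn
  have hlt := flat_lt hxn hvn
  have hpos : cellPos n S k < N := by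
    by_cases hkz : k = z
    · rw [hkz, cellPos_of_lt hzn]
      have := hz.three_le
      omega
    · exact (hreach.pred k hk hkz (by rw [hT_def, hTk]; omega)).2.1.lt_N
  -- it is enough to decide whether the trail that ends in the cell `k` can be closed
  have next : ∀ s'' : St Var, s''.mem = s₃.mem → s''.reg .done = 0 →
      s''.reg .res = s.reg .res → ¬ Closes G d B S idx ball N z k → I (k + 1) s'' :=
      fun s'' hm hd'' hr'' hc => by
    refine ⟨by rw [hm]; exact hu.trans hu₃, fun h => absurd hd'' h, fun _ => ⟨hr'', fun e he hTe => ?_⟩⟩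
    rcases Nat.lt_succ_iff_lt_or_eq.1 he with he | rfl
    · exact hnot e he hTe
    · exact hc
  rw [Com.den, eval_lt, eval_ld_of_eq hz hp₄ (by decide)
    (eval_index (i := cellVert n S k) (k := n) (j := cellVert n S z) (by rw [eval_var, hcell₄.hx])
      (by rw [eval_var, hp₄.hn]) (by rw [eval_var, hv₄]) (by omega)) (by omega),
    hm₄, hT₃.dist _ hxn _ hvn, eval_var, hg₄]
  by_cases hdist : g < gdist G (cellVert n S k) (cellVert n S z)
  · rw [if_pos hdist, if_neg one_ne_zero]
    exact next _ hm₄ hd₄ hr₄ fun h => by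
      have := h.dist_le
      omega
  rw [if_neg hdist, if_pos rfl, den_seq]
  obtain ⟨hm₅, hok₅⟩ := checkWindow_spec hz hp₄ (by rw [hm₄]; exact hT₃) hnum hxn
    (by rw [hm₄]; exact hw₃) hg₄ (by omega)
  have hfr₅ : ∀ u : Var, u ∉ checkWindow.writes → (checkWindow.den L s₄).reg u = s₄.reg u :=
    fun u hu => checkWindow.den_reg L hu s₄
  have hp₅ : HasParams n N d B S (checkWindow.den L s₄) := hp₄.den (by decide)
  rw [hm₄] at hm₅
  set s₅ := checkWindow.den L s₄ with hs₅
  have hd₅ : s₅.reg .done = 0 := (hfr₅ _ (by decide)).trans hd₄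
  have hr₅ : s₅.reg .res = s.reg .res := (hfr₅ _ (by decide)).trans hr₄
  rw [Com.den, eval_var]
  by_cases hok : s₅.reg .ok = 0
  · rw [if_pos hok]
    exact next _ hm₅ hd₅ hr₅ fun h => hok₅.2 h.windowOk hok
  rw [if_neg hok, den_seq]
  have hg₅ : s₅.reg .g = g := (hfr₅ _ (by decide)).trans hg₄
  have hnc : (Com.den L (.ite (.lt (.var .d) (.var .g)) (.nc ≔ .lit 0) newCode) s₅).mem = s₃.mem ∧
      (Com.den L (.ite (.lt (.var .d) (.var .g)) (.nc ≔ .lit 0) newCode) s₅).reg .nc =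
        nextCode B d (k % S) g (idx (cellVert n S z) (cellVert n S k)) := by
    rw [Com.den, eval_lt, eval_var, eval_var, hp₅.hd, hg₅]
    by_cases hdg : d < g
    · rw [if_pos hdg, if_neg one_ne_zero, Com.den, eval_lit]
      refine ⟨hm₅, ?_⟩
      rw [nextCode, if_pos hdg]
      simp [St.set_reg]
    · rw [if_neg hdg, if_pos rfl, ← hm₅]
      exact newCode_spec hz hp₅ (by rw [hm₅]; exact hT₃) hnum
        ((hfr₅ _ (by decide)).trans hcell₄.hx) hxn ((hfr₅ _ (by decide)).trans hv₄) hvn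
        ((hfr₅ _ (by decide)).trans hcell₄.hc) (Nat.mod_lt _ hz.S_pos) hg₅ (by omega) (by omega)
  have hfr₆ : ∀ u : Var, u ∉ (Com.ite (.lt (.var .d) (.var .g)) (.nc ≔ .lit 0) newCode).writes →
      (Com.den L (.ite (.lt (.var .d) (.var .g)) (.nc ≔ .lit 0) newCode) s₅).reg u = s₅.reg u :=
    fun u hu => Com.den_reg L _ hu s₅
  have hp₆ : HasParams n N d B S
      (Com.den L (.ite (.lt (.var .d) (.var .g)) (.nc ≔ .lit 0) newCode) s₅) := hp₅.den (by decide)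
  set s₆ := Com.den L (.ite (.lt (.var .d) (.var .g)) (.nc ≔ .lit 0) newCode) s₅ with hs₆
  rw [Com.den, eval_eq, eval_var, eval_var, hnc.2, hfr₆ .c0 (by decide), hfr₅ .c0 (by decide), hc₄]
  by_cases hcode : nextCode B d (k % S) g (idx (cellVert n S z) (cellVert n S k)) = z % S
  · rw [if_pos hcode, if_neg one_ne_zero]
    have hc : Closes G d B S idx ball N z k := ⟨not_lt.1 hdist, hok₅.1 hok, hcode.symm⟩
    have he₆ : s₆.reg .e = k := by rw [hfr₆ _ (by decide), hfr₅ _ (by decide), he₄]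
    refine ⟨?_, fun _ => ⟨k, hk, ?_, hTk, hc⟩, fun h => ?_⟩
    · show Unchanged _ _ _ s₆.mem
      rw [hnc.1]
      exact hu.trans hu₃
    · simp [Com.den, eval_lit, eval_var, eval_add, St.set_reg, he₆]
      exact Nat.mod_eq_of_lt (by omega)
    · simp [Com.den, eval_lit, St.set_reg] at h
  · rw [if_neg hcode, if_pos rfl]
    exact next _ hnc.1 ((hfr₆ _ (by decide)).trans hd₅) ((hfr₆ _ (by decide)).trans hr₅) fun h => hcode h.code.symm

theorem clearCells_spec (hz : Sizes n N d B S L) (hp : HasParams n N d B S s) :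
    Unchanged [4] (3 + n * n) s.mem (clearCells.den L s).mem ∧
      ∀ e < n * d * (n * S), arr (3 + n * n) (clearCells.den L s).mem 4 e = 0 := by
  let I : ℕ → St Var → Prop := fun k s' => Unchanged [4] (3 + n * n) s.mem s'.mem ∧
    ∀ e < k, arr (3 + n * n) s'.mem 4 e = 0
  suffices h : I (n * d * (n * S)) (clearCells.den L s) from h
  refine loop_rule (by decide) hp hp.hRS I (fun k s' x h => h) ⟨Unchanged.refl _ _ _, by simp⟩ ?_
  rintro k s' hk he hp' hfr ⟨h₁, h₂⟩
  rw [den_st_of_eq (i := k) hz hp' (by decide) (by rw [eval_var, he]) hk rfl]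
  refine ⟨h₁.update (by decide) (by simp), fun e he => ?_⟩
  simp only [arr_update, Function.update_apply, eval_lit]
  split
  · rfl
  · exact h₂ e (by omega)

/-- The state in which the search has been successful: the variable `res` holds the successor of the
last cell of a closed trail with `n` moves. -/
def Found (G : SimpleGraph (Fin n)) (N d B S : ℕ) (idx ball : ℕ → ℕ → ℕ) (s : St Var) : Prop :=
  ∃ z < n * S, ∃ e < n * d * (n * S), s.reg .res = e + 1 ∧
    Reached (Edge G d B S idx ball N) (n * d * (n * S)) z (n * d * (n * S))
      (arr (3 + n * n) s.mem 4) (arr (3 + n * n) s.mem 5) ∧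
    arr (3 + n * n) s.mem 4 e = n ∧ Closes G d B S idx ball N z e

/-- A closed trail with `n` moves is found by the search that starts with its window. -/
theorem exists_closes {z : ℕ} (hz : Sizes n N d B S L) (hG : G.Connected)
    (hnum : IsNumbering G d B idx ball) {x p c T Q : ℕ → ℕ}
    (htrail : ClosedTrail G d B idx ball N n x p c) (hgap : ∀ i, i + 1 < n → p (i + 1) - p i ≤ d)
    (hc : ∀ i, c i < B ^ (2 * d)) (hzx : x 0 * S + c 0 = z)
    (hreach : Reached (Edge G d B S idx ball N) (n * d * (n * S)) z (n * d * (n * S)) T Q) :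
    ∃ e < n * d * (n * S), T e = n ∧ Closes G d B S idx ball N z e := by
  have hn := hz.n_pos
  have hd := hz.d_pos
  rw [← hz.S_eq] at hc
  have hpos : ∀ i < n, p i < n * d := by
    have : ∀ i < n, p i ≤ i * d := by
      intro i
      induction i with
      | zero => simp [htrail.start]
      | succ i ih =>
        intro hi
        have h₁ := ih (by omega)
        have h₂ := hgap i hi
        rw [Nat.succ_mul]
        omega
    exact fun i hi => (this i hi).trans_lt (Nat.mul_lt_mul_of_pos_right hi hd)
  have hposN : ∀ i < n, p i < N := by
    have : ∀ k < n, p (n - 1 - k) < N := by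
      intro k
      induction k with
      | zero => exact fun _ => htrail.lt_N
      | succ k ih =>
        intro hk
        have h₁ := htrail.lt_succ (n - 1 - (k + 1)) (by omega)
        rw [show n - 1 - (k + 1) + 1 = n - 1 - k by omega] at h₁
        exact h₁.trans (ih (by omega))
    intro i hi
    have h₁ := this (n - 1 - i) (by omega)
    rwa [show n - 1 - (n - 1 - i) = i by omega] at h₁
  let E : ℕ → ℕ := fun i => (p i * n + x i) * S + c i
  have hEpos : ∀ i < n, cellPos n S (E i) = p i := fun i hi => cellPos_eq (htrail.lt_n i hi) (hc i)
  have hEvert : ∀ i < n, cellVert n S (E i) = x i := fun i hi =>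
    cellVert_eq (htrail.lt_n i hi) (hc i)
  have hEcode : ∀ i, E i % S = c i := fun i => flat_mod (hc i)
  have hE0 : E 0 = z := by simp [E, htrail.start, hzx]
  have hEK : ∀ i < n, E i < n * d * (n * S) := fun i hi =>
    lt_cells (htrail.lt_n i hi) (hc i) (hpos i hi)
  have hedge : ∀ i, i + 1 < n → Edge G d B S idx ball N (E i) (E (i + 1)) := fun i hi => by
    have h₁ := htrail.lt_succ i hi
    have h₂ := hgap i hi
    have h₃ := htrail.move i hi
    constructor <;> rw [hEpos (i + 1) hi]
    · rwa [hEpos i (by omega)]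
    · rw [hEpos i (by omega)]
      omega
    · exact hposN _ hi
    · exact hpos _ hi
    · rwa [hEpos i (by omega), hEvert i (by omega), hEvert _ hi, hEcode, hEcode]
  have hlast := hreach.le_of_path hE0 hedge hEK (show n - 1 < n by omega)
  have hcl : Closes G d B S idx ball N z (E (n - 1)) := by
    rw [Closes, ← hE0, hEpos _ (by omega), hEvert _ (by omega), hEvert _ (by omega), hEcode, hEcode]
    exact htrail.close
  have hzn : z < n * S := by
    have := flat_lt (htrail.lt_n 0 hn) (hc 0)
    omega
  have := (closedTrail_of_reached hn (by have := hz.three_le; omega) hzn hreach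
    (hEK _ (by omega)) hlast.1 hcl).card_le hnum hG
  exact ⟨E (n - 1), hEK _ (by omega), by omega, hcl⟩

/-- The search from the start window number `z` finds a closed trail with `n` moves, or there is none
with gaps of at most `d` that starts with this window. -/
theorem searchFrom_spec (hz : Sizes n N d B S L) (hp : HasParams n N d B S s) (hG : G.Connected)
    (hT : HasTables G d B idx ball s.mem) (hnum : IsNumbering G d B idx ball) {z : ℕ}
    (hzn : z < n * S) (hs : s.reg .z = z) (hdone : s.reg .done = 0) :
    Unchanged [3, 4, 5] (3 + n * n) s.mem (searchFrom.den L s).mem ∧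
      ((searchFrom.den L s).reg .done ≠ 0 → Found G N d B S idx ball (searchFrom.den L s)) ∧
      ((searchFrom.den L s).reg .done = 0 → (searchFrom.den L s).reg .res = s.reg .res ∧
        ∀ x p c, ClosedTrail G d B idx ball N n x p c → (∀ i, i + 1 < n → p (i + 1) - p i ≤ d) →
          (∀ i, c i < B ^ (2 * d)) → x 0 * S + c 0 ≠ z) := by
  have hn := hz.n_pos
  have hd := hz.d_pos
  have hcells := hz.cells
  have hzK : z < n * d * (n * S) :=
    hzn.trans_le (Nat.le_mul_of_pos_left _ (Nat.mul_pos hn hd))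
  rw [searchFrom, den_assign_seq, den_assign_seq, den_seq, den_seq, den_seq,
    eval_rem (by simp [eval_var, St.set_reg, hs]; omega), eval_div]
  simp only [eval_var]
  set s₁ := (s.set .x0 (s.reg .z / s.reg .S)).set .c0 ((s.set .x0 (s.reg .z / s.reg .S)).reg .z %
    (s.set .x0 (s.reg .z / s.reg .S)).reg .S) with hs₁
  have hp₁ : HasParams n N d B S s₁ := (hp.set rfl _).set rfl _
  have hx₁ : s₁.reg .x0 = cellVert n S z := by
    have : z / S < n := Nat.div_lt_of_lt_mul (by rwa [mul_comm])
    simp [hs₁, St.set_reg, hs, hp.hS, cellVert, Nat.mod_eq_of_lt this]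
  have hc₁ : s₁.reg .c0 = z % S := by simp [hs₁, St.set_reg, hs, hp.hS]
  have hz₁ : s₁.reg .z = z := by simp [hs₁, St.set_reg, hs]
  have hd₁ : s₁.reg .done = 0 := by simp [hs₁, St.set_reg, hdone]
  have hr₁ : s₁.reg .res = s.reg .res := by simp [hs₁, St.set_reg]
  have hm₁ : s₁.mem = s.mem := rfl
  clear_value s₁
  obtain ⟨hu₂, hT₂⟩ := clearCells_spec hz hp₁
  have hp₂ : HasParams n N d B S (clearCells.den L s₁) := hp₁.den (by decide)
  have hfr₂ : ∀ u : Var, u ∉ clearCells.writes → (clearCells.den L s₁).reg u = s₁.reg u :=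
    fun u hu => Com.den_reg L _ hu s₁
  set s₂ := clearCells.den L s₁ with hs₂
  rw [den_st_of_eq (i := z) (y := 1) hz hp₂ (by decide)
    (by rw [eval_var, hfr₂ _ (by decide), hz₁]) hzK rfl]
  set s₃ : St Var := ⟨s₂.reg, Function.update s₂.mem (cell (3 + n * n) 4 z) 1⟩ with hs₃
  have hp₃ : HasParams n N d B S s₃ := hp₂.of_reg rfl
  have hu₃ : Unchanged [4] (3 + n * n) s.mem s₃.mem := by
    rw [← hm₁]
    exact hu₂.update (by decide) (by simp)
  have hT₃ : arr (3 + n * n) s₃.mem 4 = Function.update (arr (3 + n * n) s₂.mem 4) z 1 := by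
    rw [hs₃, arr_update]
  obtain ⟨hu₄, hreach₄⟩ := reachPass_spec hz hp₃
    (hT.of_unchanged hu₃ (by decide) (by decide) (by decide) (by decide)) hnum hzn
    (by rw [hT₃, Function.update_self])
    (fun v hv hvz => by rw [hT₃, Function.update_of_ne hvz, hT₂ v hv])
  have hp₄ : HasParams n N d B S (reachPass.den L s₃) := hp₃.den (by decide)
  have hreg₄ : ∀ u : Var, u ∉ reachPass.writes → u ∉ clearCells.writes →
      (reachPass.den L s₃).reg u = s₁.reg u :=
    fun u hu hu' => (Com.den_reg L _ hu s₃).trans (hfr₂ u hu')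
  set s₄ := reachPass.den L s₃ with hs₄
  have hu₄' : Unchanged [3, 4, 5] (3 + n * n) s.mem s₄.mem := fun q hq => by
    rw [hu₄ q hq]
    exact hu₃ q (hq.imp_right fun h h' => h (by simp at h'; simp [h']))
  obtain ⟨hu₅, h₁, h₂⟩ := closePass_spec hz hp₄
    (hT.of_unchanged hu₄' (by decide) (by decide) (by decide) (by decide)) hnum hzn
    (by rw [hreg₄ _ (by decide) (by decide), hx₁]) (by rw [hreg₄ _ (by decide) (by decide), hc₁])
    hreach₄ (by rw [hreg₄ _ (by decide) (by decide), hd₁])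
  refine ⟨fun q hq => ?_, fun h => ?_, fun h => ?_⟩
  · rw [hu₅ q (hq.imp_right fun h h' => h (by simp at h'; simp [h'])), hu₄' q hq]
  · obtain ⟨e, he, hres, hTe, hcl⟩ := h₁ h
    refine ⟨z, hzn, e, he, hres, ?_⟩
    rw [hu₅.arr (by decide) (by decide), hu₅.arr (by decide) (by decide)]
    exact ⟨hreach₄, hTe, hcl⟩
  · obtain ⟨hres, hno⟩ := h₂ h
    refine ⟨by rw [hres, hreg₄ _ (by decide) (by decide), hr₁], fun x p c htrail hgap hc hzx => ?_⟩
    obtain ⟨e, he, hTe, hcl⟩ := exists_closes hz hG hnum htrail hgap hc hzx hreach₄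
    exact hno e he hTe hcl

/-- The main part solves the problem. -/
theorem mainPart_spec (hz : Sizes n N d B S L) (hp : HasParams n N d B S s) (hG : G.Connected)
    (hin : HasInput G s.mem) (h₁ : ∀ e, arr (3 + n * n) s.mem 1 e = 0)
    (h₂ : ∀ e, arr (3 + n * n) s.mem 2 e = 0) (hdone : s.reg .done = 0)
    (hres : s.reg .res = 0) : IsCorrectAnswer G N d (mainPart.den L s).mem := by
  have hn := hz.n_pos
  rw [mainPart, den_seq, den_seq, den_seq, den_seq, den_seq, den_seq]
  have hst : Com.den L (.store (.lit 0) (.lit 0)) s = ⟨s.reg, Function.update s.mem 0 0⟩ := rfl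
  rw [hst]
  set s₀ : St Var := ⟨s.reg, Function.update s.mem 0 0⟩ with hs₀
  have hp₀ : HasParams n N d B S s₀ := hp.of_reg rfl
  have hin₀ : HasInput G s₀.mem := fun i hi j hj => by
    rw [← hin i hi j hj, hs₀]
    exact Function.update_of_ne (by omega) _ _
  have h0₀ : s₀.mem 0 = 0 := by simp [hs₀]
  have harr₀ : ∀ a, arr (3 + n * n) s₀.mem a = arr (3 + n * n) s.mem a := fun a =>
    arr_update_low (by omega) a
  have hd₀ : s₀.reg .done = 0 := hdone
  have hr₀ : s₀.reg .res = 0 := hres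
  clear_value s₀
  obtain ⟨hu₁, hpow₁⟩ := powTable_spec hz hp₀
  have hp₁ : HasParams n N d B S (powTable.den L s₀) := hp₀.den (by decide)
  have hd₁ := (powTable.den_reg L (v := .done) (by decide) s₀).trans hd₀
  set s₁ := powTable.den L s₀
  obtain ⟨hu₂, hinit₂⟩ := distInit_spec hz hp₁ (G := G) fun i hi j hj => by
    rw [hu₁ _ (.inl ?_)]
    · exact hin₀ i hi j hj
    · have := flat_lt hi hj
      omega
  have hp₂ : HasParams n N d B S (distInit.den L s₁) := hp₁.den (by decide)
  have hd₂ := (distInit.den_reg L (v := .done) (by decide) s₁).trans hd₁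
  set s₂ := distInit.den L s₁
  obtain ⟨hu₃, hdist₃⟩ := floydWarshall_spec hG hz hp₂ hinit₂
  have hp₃ : HasParams n N d B S (floydWarshall.den L s₂) := hp₂.den (by decide)
  have hd₃ := (floydWarshall.den_reg L (v := .done) (by decide) s₂).trans hd₂
  set s₃ := floydWarshall.den L s₂
  have harr₃ : ∀ a < 8, a ≠ 0 → a ≠ 6 → arr (3 + n * n) s₃.mem a = arr (3 + n * n) s.mem a :=
    fun a ha h0 h6 => by
      rw [hu₃.arr ha (by simpa using h0), hu₂.arr ha (by simpa using h0),
        hu₁.arr ha (by simpa using h6), harr₀]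
  obtain ⟨hu₄, hover, hnum₄⟩ := numberBalls_spec hz hp₃ hd₃ hdist₃
    (by rw [harr₃ 1 (by decide) (by decide) (by decide)]; exact h₁)
    (by rw [harr₃ 2 (by decide) (by decide) (by decide)]; exact h₂)
  have hp₄ : HasParams n N d B S (numberBalls.den L s₃) := hp₃.den (by decide)
  have hr₄ : (numberBalls.den L s₃).reg .res = 0 := by
    rw [Com.den_reg L _ (by decide), Com.den_reg L _ (by decide), Com.den_reg L _ (by decide),
      Com.den_reg L _ (by decide), hr₀]
  set s₄ := numberBalls.den L s₃
  have h0₄ : s₄.mem 0 = 0 := by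
    rw [hu₄ 0 (.inl (by omega)), hu₃ 0 (.inl (by omega)), hu₂ 0 (.inl (by omega)),
      hu₁ 0 (.inl (by omega)), h0₀]
  by_cases hd₄ : s₄.reg .done = 0
  swap
  · -- a ball has too many vertices
    let I : ℕ → St Var → Prop := fun _ s' => s'.reg .done ≠ 0 ∧ s'.reg .res = 0 ∧ s'.mem = s₄.mem
    have hI : I (n * S) (Com.den L (.loop .z .nS (.ite (.var .done) .skip searchFrom)) s₄) := by
      refine loop_rule (by decide) hp₄ hp₄.hnS I (fun k s' x h => by
        simpa [I, St.set_reg] using h) ⟨hd₄, hr₄, rfl⟩ ?_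
      rintro k s' hk he hp' hfr ⟨h₁, h₂⟩
      rw [Com.den, eval_var, if_neg h₁]
      exact ⟨h₁, h₂⟩
    obtain ⟨x, hx, hB⟩ := hover hd₄
    rw [Com.den, eval_var, hI.2.1, if_pos rfl, Com.den, hI.2.2]
    refine .inr ⟨h0₄, fun ⟨F, hF⟩ => ?_⟩
    have := rank_le_of_embedding hG hz.three_le hF hx
    have := hz.base_ge
    omega
  have hnum := (hnum₄ hd₄).isNumbering hz.B_pos
  set idx : ℕ → ℕ → ℕ := fun x y => arr (3 + n * n) s₄.mem 1 (x * n + y) with hidx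
  set ball : ℕ → ℕ → ℕ := fun x k => arr (3 + n * n) s₄.mem 2 (x * B + k) with hball
  have hT₄ : HasTables G d B idx ball s₄.mem := by
    refine ⟨fun x hx y hy => ?_, fun _ _ => rfl, fun _ _ => rfl, fun i hi => ?_⟩
    · rw [hu₄.arr (by decide) (by decide), hdist₃ _ (flat_lt hx hy), flat_div hy, flat_mod hy]
    · rw [hu₄.arr (by decide) (by decide), hu₃.arr (by decide) (by decide),
        hu₂.arr (by decide) (by decide), hpow₁ i hi]
  let I : ℕ → St Var → Prop := fun k s' =>
    Unchanged [3, 4, 5] (3 + n * n) s₄.mem s'.mem ∧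
      (s'.reg .done ≠ 0 → Found G N d B S idx ball s') ∧
      (s'.reg .done = 0 → s'.reg .res = 0 ∧
        ∀ x p c, ClosedTrail G d B idx ball N n x p c → (∀ i, i + 1 < n → p (i + 1) - p i ≤ d) →
          (∀ i, c i < B ^ (2 * d)) → k ≤ x 0 * S + c 0)
  have hI : I (n * S) (Com.den L (.loop .z .nS (.ite (.var .done) .skip searchFrom)) s₄) := by
    refine loop_rule (by decide) hp₄ hp₄.hnS I (fun k s' x h => by
      simpa [I, Found, St.set_reg] using h)
      ⟨Unchanged.refl _ _ _, fun h => absurd hd₄ h, fun _ => ⟨hr₄, by simp⟩⟩ ?_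
    rintro k s' hk he hp' hfr ⟨hu', h₁, h₂⟩
    rw [Com.den, eval_var]
    by_cases hd' : s'.reg .done = 0
    · rw [if_pos hd']
      obtain ⟨hres', hno⟩ := h₂ hd'
      obtain ⟨hu'', h₃, h₄⟩ := searchFrom_spec hz hp' hG
        (hT₄.of_unchanged hu' (by decide) (by decide) (by decide) (by decide)) hnum hk he hd'
      refine ⟨hu'.trans hu'', h₃, fun h => ⟨(h₄ h).1.trans hres', fun x p c htrail hgap hc => ?_⟩⟩
      have h₅ := hno x p c htrail hgap hc
      have h₆ := (h₄ h).2 x p c htrail hgap hc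
      omega
    · rw [if_neg hd']
      exact ⟨hu', h₁, fun h => absurd h hd'⟩
  obtain ⟨hu₅, hfound, hnone⟩ := hI
  have hp₅ : HasParams n N d B S (Com.den L (.loop .z .nS (.ite (.var .done) .skip searchFrom)) s₄) :=
    hp₄.den (by decide)
  set s₅ := Com.den L (.loop .z .nS (.ite (.var .done) .skip searchFrom)) s₄
  rw [Com.den, eval_var]
  by_cases hd₅ : s₅.reg .done = 0
  · obtain ⟨hr₅, hno⟩ := hnone hd₅
    rw [hr₅, if_pos rfl, Com.den]
    refine .inr ⟨by rw [hu₅ 0 (.inl (by omega)), h0₄], fun ⟨F, hF⟩ => ?_⟩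
    obtain ⟨x, p, c, htrail, hgap, hc⟩ := exists_closedTrail hG hz.three_le hnum hF
    have h₃ := hno x p c htrail hgap hc
    have h₄ := hc 0
    rw [← hz.S_eq] at h₄
    have := flat_lt (htrail.lt_n 0 hn) h₄
    omega
  · obtain ⟨z, hzn, e, he, hr₅, hreach, hTe, hcl⟩ := hfound hd₅
    rw [if_neg (by omega)]
    exact isCorrectAnswer_writeOutput hz hp₅ hG hnum hzn hreach hr₅ he rfl hTe hcl

end

end CycleEmbedding

namespace CycleEmbedding

/-! ### The running time -/

/-- The largest product of the numbers of rounds of nested loops in a command. -/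
def Com.weight {ν : Type} (ρ : ν → ℕ) : Com ν → ℕ
  | .skip => 1
  | .assign _ _ => 1
  | .store _ _ => 1
  | .seq c₁ c₂ => max (c₁.weight ρ) (c₂.weight ρ)
  | .ite _ c₁ c₂ => max (c₁.weight ρ) (c₂.weight ρ)
  | .loop _ b c => ρ b * c.weight ρ

/-- The constant in the running time of a command. -/
def Com.size {ν : Type} : Com ν → ℕ
  | .skip => 0
  | .assign _ e => e.len + 2
  | .store a e => a.len + (e.len + 1)
  | .seq c₁ c₂ => c₁.size + c₂.size
  | .ite e c₁ c₂ => e.len + 3 + (c₁.size + c₂.size)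
  | .loop _ _ c => c.size + 7

/-- The running time is bounded by the largest product of the bounds of nested loops. -/
theorem Com.time_le {ν : Type} [DecidableEq ν] {par : ν → Bool} {c : Com ν} (hc : c.ok par)
    {ρ : ν → ℕ} (hρ : ∀ v, par v → 1 ≤ ρ v) :
    1 ≤ c.weight ρ ∧ c.time ρ ≤ c.size * c.weight ρ := by
  induction c with
  | skip => simp [Com.weight, Com.time]
  | assign v e => simp [Com.weight, Com.time, Com.size]
  | store a e => simp [Com.weight, Com.time, Com.size]
  | seq c₁ c₂ h₁ h₂ =>
    simp [Com.ok] at hc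
    obtain ⟨h₁, h₁'⟩ := h₁ hc.1
    obtain ⟨h₂, h₂'⟩ := h₂ hc.2
    simp only [Com.weight, Com.time, Com.size]
    refine ⟨h₁.trans (le_max_left _ _), ?_⟩
    rw [add_mul]
    exact add_le_add (h₁'.trans (Nat.mul_le_mul_left _ (le_max_left _ _)))
      (h₂'.trans (Nat.mul_le_mul_left _ (le_max_right _ _)))
  | ite e c₁ c₂ h₁ h₂ =>
    simp [Com.ok] at hc
    obtain ⟨h₁, h₁'⟩ := h₁ hc.2.1
    obtain ⟨h₂, h₂'⟩ := h₂ hc.2.2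
    simp only [Com.weight, Com.time, Com.size]
    have h := h₁.trans (le_max_left _ (c₂.weight ρ))
    refine ⟨h, ?_⟩
    rw [add_mul (_ + 3), add_mul c₁.size]
    exact add_le_add (Nat.le_mul_of_pos_right _ h)
      (add_le_add (h₁'.trans (Nat.mul_le_mul_left _ (le_max_left _ _)))
        (h₂'.trans (Nat.mul_le_mul_left _ (le_max_right _ _))))
  | loop i b c h =>
    simp [Com.ok] at hc
    obtain ⟨h, h'⟩ := h hc.2.2.2
    have hb := hρ b hc.2.1
    simp only [Com.weight, Com.time, Com.size]
    have h₁ : 1 ≤ ρ b * c.weight ρ := Nat.mul_pos hb h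
    refine ⟨h₁, ?_⟩
    calc ρ b * (c.time ρ + 4) + 3
        ≤ ρ b * (c.size * c.weight ρ + 4 * c.weight ρ) + 3 * (ρ b * c.weight ρ) := by gcongr <;> omega
      _ = (c.size + 7) * (ρ b * c.weight ρ) := by ring

/-- The bound for the running time, up to a constant. -/
def bound (n d : ℕ) : ℕ := n ^ 3 * d ^ (2 * d + 3) * base d ^ (4 * d + 4)

section

variable {n d : ℕ}

theorem le_bound {a b c : ℕ} (ha : a ≤ n ^ 3) (hb : b ≤ d ^ 3) (hc : c ≤ base d ^ (4 * d + 4))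
    (hd : 1 ≤ d) : a * b * c ≤ bound n d :=
  Nat.mul_le_mul (Nat.mul_le_mul ha (hb.trans (Nat.pow_le_pow_right hd (by omega)))) hc

theorem base_ge (hd : 1 ≤ d) : 2 * d * d + 3 ≤ base d ∧ 2 * d + 2 ≤ base d ∧ d + 1 ≤ base d := by
  unfold base
  refine ⟨?_, ?_, ?_⟩ <;> nlinarith

/-- No number in the computation exceeds the words, if they can hold the running time and `N`. -/
theorem sizes_of_bound_le (hn : 1 ≤ n) (hd : 1 ≤ d) {N L : ℕ} (hN : 3 ≤ N) (h : 100 * bound n d + N ≤ L) :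
    Sizes n N d (base d) (base d ^ (2 * d)) L := by
  obtain ⟨h₁, h₂, -⟩ := base_ge hd
  have hB : 1 ≤ base d := by omega
  have hpow : ∀ k ≤ 4 * d + 4, base d ^ k ≤ base d ^ (4 * d + 4) := fun k hk =>
    Nat.pow_le_pow_right hB hk
  have h1 : 1 ≤ base d ^ (4 * d + 4) := Nat.one_le_pow _ _ hB
  have hn1 : n ≤ n ^ 3 := Nat.le_self_pow (by decide) n
  have hn2 : n * n ≤ n ^ 3 := by nlinarith
  have hd1 : d ≤ d ^ 3 := Nat.le_self_pow (by decide) d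
  have b₁ : 1 * 1 * 1 ≤ bound n d := le_bound (by omega) (by omega) h1 hd
  have b₂ : n * 1 * 1 ≤ bound n d := le_bound hn1 (by omega) h1 hd
  have b₃ : 1 * d * 1 ≤ bound n d := le_bound (by omega) hd1 h1 hd
  have b₄ : n * n * 1 * 1 ≤ bound n d := le_bound hn2 (by omega) h1 hd
  have b₅ : n * n * d * base d ^ (2 * d) ≤ bound n d := le_bound hn2 hd1 (hpow _ (by omega)) hd
  have b₆ : 1 * 1 * base d ^ (2 * d + 2 * d) ≤ bound n d :=
    le_bound (by omega) (by omega) (hpow _ (by omega)) hd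
  rw [pow_add] at b₆
  refine ⟨hn, hd, hN, h₁, h₂, rfl, ?_, ?_, ?_⟩
  · have : n * d * (n * base d ^ (2 * d)) = n * n * d * base d ^ (2 * d) := by ring
    omega
  · omega
  · omega

/-- The innermost loop, which looks for a vertex in a window, dominates: it is run for all `n * S`
starts, `n * d * (n * S)` cells, `d * B` moves, and `(d + 1) * B` pairs of an entry of the window
and a neighbour. -/
theorem mainPart_time_le {N : ℕ} {s : St Var} (hn : 1 ≤ n) (hd : 1 ≤ d) (hN : 3 ≤ N)
    (hp : HasParams n N d (base d) (base d ^ (2 * d)) s) :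
    mainPart.time s.reg ≤ mainPart.size * bound n d := by
  obtain ⟨h₁, h₂, h₃⟩ := base_ge hd
  have hB : 1 ≤ base d := by omega
  set B := base d with hB_def
  set S := B ^ (2 * d) with hS_def
  have hS : 1 ≤ S := Nat.one_le_pow _ _ hB
  have hpos : ∀ v, isParam v → 1 ≤ s.reg v := by
    intro v hv
    have hnd := Nat.mul_pos hn hd
    have hnS := Nat.mul_pos hn hS
    cases v <;> first
      | exact absurd hv (by decide)
      | simp only [hp.hn, hp.hN, hp.hd, hp.hW, hp.hW1, hp.hd1, hp.hB, hp.hS, hp.hoff, hp.hnn,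
          hp.hnd, hp.hnS, hp.hRS, hp.hdB, hp.hdB1]
        first
          | omega
          | exact Nat.mul_pos hn hn
          | exact Nat.mul_pos hd hB
          | exact Nat.mul_pos (Nat.succ_pos d) hB
          | exact Nat.mul_pos hnd hnS
  refine (Com.time_le mainPart_ok hpos).2.trans (Nat.mul_le_mul_left _ ?_)
  have hdB := Nat.mul_pos hd hB
  have hdB1 := Nat.mul_pos (Nat.succ_pos d) hB
  have hnS := Nat.mul_pos hn hS
  have hRS := Nat.mul_pos (Nat.mul_pos hn hd) hnS
  have hn3 : n * (n * n) = n ^ 3 := by ring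
  have hB1 : 1 ≤ B ^ (4 * d + 4) := Nat.one_le_pow _ _ hB
  have hn1 : n ≤ n ^ 3 := Nat.le_self_pow (by decide) n
  have hn2 : n * n ≤ n ^ 3 := hn3 ▸ Nat.le_mul_of_pos_left _ hn
  have hd1 : 1 ≤ d ^ 3 := Nat.one_le_pow _ _ hd
  have b₁ : 1 * 1 * 1 ≤ bound n d := le_bound (by omega) hd1 hB1 hd
  have b₂ : n * 1 * 1 ≤ bound n d := le_bound hn1 hd1 hB1 hd
  have b₃ : 1 * d * 1 ≤ bound n d := le_bound (by omega) (Nat.le_self_pow (by decide) d) hB1 hd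
  have b₄ : n * n * 1 * 1 ≤ bound n d := le_bound hn2 hd1 hB1 hd
  have b₅ : n ^ 3 * 1 * 1 ≤ bound n d := le_bound le_rfl hd1 hB1 hd
  -- the time for all moves from all cells, for all starts
  have hM : ∀ Y ≤ d * B * ((d + 1) * B * (2 * d + 1)), n * S * (n * d * (n * S) * Y) ≤ bound n d := by
    intro Y hY
    calc n * S * (n * d * (n * S) * Y)
        ≤ n * S * (n * d * (n * S) * (d * B * ((d + 1) * B * (2 * d + 1)))) :=
          Nat.mul_le_mul_left _ (Nat.mul_le_mul_left _ hY)
      _ = n ^ 3 * d ^ 2 * (S * S * (B ^ 2 * ((d + 1) * (2 * d + 1)))) := by ring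
      _ ≤ bound n d := by
        refine le_bound le_rfl (Nat.pow_le_pow_right hd (by decide)) ?_ hd
        calc S * S * (B ^ 2 * ((d + 1) * (2 * d + 1))) ≤ S * S * (B ^ 2 * (B * B)) := by
              gcongr
              omega
          _ = B ^ (4 * d + 4) := by
              rw [hS_def]
              ring
  have hW : 1 ≤ (d + 1) * B * (2 * d + 1) := Nat.mul_pos hdB1 (by omega)
  have hA : (d + 1) * B * (2 * d + 1) ≤ d * B * ((d + 1) * B * (2 * d + 1)) :=
    Nat.le_mul_of_pos_left _ hdB
  have hA' : (d + 1) * B ≤ (d + 1) * B * (2 * d + 1) := Nat.le_mul_of_pos_right _ (by omega)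
  have hW' : 2 * d + 1 ≤ (d + 1) * B * (2 * d + 1) := Nat.le_mul_of_pos_left _ hdB1
  have c₀ := hM _ le_rfl
  have c₁ := hM _ hA
  have c₂ := hM ((d + 1) * B) (hA'.trans hA)
  have c₃ := hM (2 * d) (by omega)
  have c₄ := hM 1 (by omega)
  have c₅ := hM (d * B) (Nat.le_mul_of_pos_right _ hW)
  have c₆ := hM (d * B * ((d + 1) * B)) (Nat.mul_le_mul_left _ hA')
  have c₇ : n * S ≤ bound n d := by
    refine le_trans ?_ c₄
    rw [mul_one]
    exact Nat.le_mul_of_pos_right _ hRS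
  simp only [mul_one, one_mul] at *
  simp only [mainPart, Com.weight, powTable, distInit, floydWarshall, numberBalls, searchFrom,
    clearCells, reachPass, closePass, unpack, decode, tryMove, checkWindow, findInWindow, newCode,
    relaxCell, writeOutput, st, ← Nat.mul_max_mul_left, max_le_iff, mul_one,
    hp.hn, hp.hd, hp.hW, hp.hW1, hp.hnn, hp.hnS, hp.hRS, hp.hdB, hp.hdB1, hn3]
  and_intros <;> assumption

end

end CycleEmbedding

namespace CycleEmbedding

open WordRAM

/-! ### The input and the run of the program -/

section

variable {n N d L : ℕ} {s : St Var}

theorem readInput_spec (hn : s.mem 0 = n) (hN : s.mem 1 = N) (hd : s.mem 2 = d)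
    (hz : Sizes n N d (base d) (base d ^ (2 * d)) L) :
    (readInput.den L s).mem = s.mem ∧ (readInput.den L s).reg .n = n ∧
      (readInput.den L s).reg .N = N ∧ (readInput.den L s).reg .d = d ∧
      (readInput.den L s).reg .W = 2 * d ∧ (readInput.den L s).reg .W1 = 2 * d + 1 ∧
      (readInput.den L s).reg .d1 = d + 1 ∧ (readInput.den L s).reg .B = base d ∧
      (readInput.den L s).reg .S = 1 := by
  have hNL := hz.N_lt
  have hBL := hz.B_le
  have hcodes := hz.codes
  have hself := Nat.le_mul_self (base d ^ (2 * d))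
  have h₁ : (d + d) % L = 2 * d := by rw [Nat.mod_eq_of_lt] <;> omega
  have h₂ : (2 * d + 1) % L = 2 * d + 1 := Nat.mod_eq_of_lt (by omega)
  have h₃ : (d + 1) % L = d + 1 := Nat.mod_eq_of_lt (by omega)
  have h₄ : 8 * (d * (d + 1)) = base d := by
    unfold base
    ring
  have h₅ : (d * (d + 1)) % L = d * (d + 1) := Nat.mod_eq_of_lt (by omega)
  have h₆ : base d % L = base d := Nat.mod_eq_of_lt (by omega)
  simp [readInput, Com.den, St.set_reg, eval_load, eval_lit, eval_var, eval_add, eval_mul, hn, hN,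
    hd, -Nat.add_mod_mod, -Nat.mod_add_mod, -Nat.mul_mod_mod, h₁, h₂, h₃, h₅, h₄, h₆]

theorem powerLoop_spec {B : ℕ} (hW : s.reg .W = 2 * d) (hB : s.reg .B = B) (hS : s.reg .S = 1)
    (hz : Sizes n N d B (B ^ (2 * d)) L) :
    (powerLoop.den L s).mem = s.mem ∧ (powerLoop.den L s).reg .S = B ^ (2 * d) := by
  have hcodes := hz.codes
  have hself := Nat.le_mul_self (B ^ (2 * d))
  rw [← hW]
  refine Com.den_loop (i := .i) (b := .W) (c := .S ≔ .var .S * .var .B) (fun k s' => s'.mem = s.mem ∧ s'.reg .S = B ^ k)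
    (fun k s' x h => by simpa [St.set_reg] using h) ⟨rfl, by simpa using hS⟩ ?_
  rintro k s' hk hi hfr ⟨h₁, h₂⟩
  rw [hW] at hk
  refine ⟨h₁, ?_⟩
  have := hz.pow_le (k := k + 1) (by omega)
  simp only [Com.den, St.set_reg, if_true, eval_mul, eval_var, h₂, hfr .B (by decide), hB]
  rw [← pow_succ, Nat.mod_eq_of_lt (by omega)]

theorem deriveParams_spec {B S : ℕ} (hz : Sizes n N d B S L) (hn : s.reg .n = n)
    (hN : s.reg .N = N) (hd : s.reg .d = d) (hW : s.reg .W = 2 * d) (hW1 : s.reg .W1 = 2 * d + 1)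
    (hd1 : s.reg .d1 = d + 1) (hB : s.reg .B = B) (hS : s.reg .S = S) :
    (deriveParams.den L s).mem = s.mem ∧ HasParams n N d B S (deriveParams.den L s) := by
  have hcells := hz.cells
  have hcodes := hz.codes
  have hnn := hz.nn_le
  have hn1 := hz.n_pos
  have hd1' := hz.d_pos
  have hnS := Nat.mul_pos hn1 hz.S_pos
  have hnd := Nat.mul_pos hn1 hd1'
  have e₁ : n * S ≤ n * d * (n * S) := Nat.le_mul_of_pos_left _ hnd
  have e₂ : n * d ≤ n * d * (n * S) := Nat.le_mul_of_pos_right _ hnS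
  have hSS := Nat.mul_le_mul hz.B_le hz.B_le
  have e₃ : d * B ≤ B * B := Nat.mul_le_mul_right _ (by have := hz.base_ge'; omega)
  have e₄ : (d + 1) * B ≤ B * B := Nat.mul_le_mul_right _ (by have := hz.base_ge'; omega)
  have m₁ : (n * n) % L = n * n := Nat.mod_eq_of_lt (by omega)
  have m₂ : (3 + n * n) % L = 3 + n * n := Nat.mod_eq_of_lt (by omega)
  have m₃ : (n * S) % L = n * S := Nat.mod_eq_of_lt (by omega)
  have m₄ : (n * d) % L = n * d := Nat.mod_eq_of_lt (by omega)
  have m₅ : (n * d * (n * S)) % L = n * d * (n * S) := Nat.mod_eq_of_lt (by omega)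
  have m₆ : (d * B) % L = d * B := Nat.mod_eq_of_lt (by omega)
  have m₇ : ((d + 1) * B) % L = (d + 1) * B := Nat.mod_eq_of_lt (by omega)
  refine ⟨rfl, ?_⟩
  constructor <;>
    simp [deriveParams, Com.den, St.set_reg, eval_lit, eval_var, eval_add, eval_mul, hn, hN, hd, hW,
      hW1, hd1, hB, hS, -Nat.add_mod_mod, -Nat.mul_mod_mod, -Nat.mod_mul_mod, m₁, m₂, m₃, m₄, m₅, m₆,
      m₇]

end

section

variable {n : ℕ} {G : SimpleGraph (Fin n)} {N d : ℕ}

/-- The arrays of the program are initially `0`. -/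
theorem inputMemory_of_le {a : ℕ} (ha : 3 + n * n ≤ a) : inputMemory G N d a = 0 := by
  rw [inputMemory, if_neg (by omega), if_neg (by omega), if_neg (by omega), if_neg]
  rintro ⟨u, v, h, -⟩
  have := flat_lt u.2 v.2
  rw [mul_comm n u.val] at h
  omega

theorem hasInput_inputMemory : HasInput G (inputMemory G N d) := by
  intro i hi j hj
  rw [inputMemory, if_neg (by omega), if_neg (by omega), if_neg (by omega)]
  by_cases h : gdist G i j = 1
  · rw [if_pos h, if_pos]
    rw [gdist_of_lt hi hj] at h
    exact ⟨⟨i, hi⟩, ⟨j, hj⟩, by dsimp only; ring, SimpleGraph.dist_eq_one_iff_adj.1 h⟩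
  · rw [if_neg h, if_neg]
    rintro ⟨u, v, h', hadj⟩
    have h' : i * n + j = u.val * n + v.val := by
      rw [mul_comm n u.val] at h'
      omega
    have hu : i = u.val := by rw [← flat_div (i := i) hj, h', flat_div v.2]
    have hv : j = v.val := by rw [← flat_mod (i := i) hj, h', flat_mod v.2]
    rw [hu, hv, gdist_val] at h
    exact h (SimpleGraph.dist_eq_one_iff_adj.2 hadj)

theorem inputMemory_lt {L : ℕ} (h1 : 1 < L) (hn : n < L) (hN : N < L) (hd : d < L) (a : ℕ) :
    inputMemory G N d a < L := by
  unfold inputMemory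
  split_ifs <;> omega

end

/-- The constant in the running time of the program. -/
def timeConstant : ℕ := readInput.size + powerLoop.size + deriveParams.size + mainPart.size + 100

theorem program_solves : SolvesCycleEmbedding program fun n d =>
    timeConstant * (n ^ 3 * d ^ (2 * d + 3) * (4 * d * (2 * d + 2)) ^ (4 * d + 4)) := by
  intro n N d w G hG hN hd hw
  obtain ⟨v⟩ := hG.nonempty
  have hn : 1 ≤ n := v.pos
  change timeConstant * bound n d + N ≤ 2 ^ w at hw
  have h100 : 100 * bound n d ≤ timeConstant * bound n d :=
    Nat.mul_le_mul_right _ (Nat.le_add_left _ _)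
  have hz := sizes_of_bound_le hn hd hN (L := 2 ^ w) (by omega)
  have hb : 1 ≤ bound n d := by
    obtain ⟨h, -⟩ := base_ge hd
    exact Nat.mul_pos (Nat.mul_pos (by positivity) (by positivity))
      (Nat.pow_pos (by omega))
  have hNL := hz.N_lt
  set m := inputMemory G N d with hm
  set s₀ : Config := { pc := 0, reg := fun _ => 0, mem := m } with hs₀
  let σ₀ : St Var := ⟨fun _ => 0, m⟩
  have hbd₀ : Bounded (2 ^ w) s₀ :=
    ⟨fun _ => by positivity, inputMemory_lt (by omega) (by omega) (by omega) (by omega)⟩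
  have hr₀ : Represents Var.loc s₀ σ₀ := ⟨fun _ => rfl, rfl⟩
  have hw8 : 8 < 2 ^ w := by omega
  have hP : CodeAt program 0 program := fun k i hk => by rwa [zero_add]
  have hP₁ : CodeAt program 0 (readInput.code Var.loc 45 0) := hP.left
  have hP' := hP.right
  rw [Com.length_code, zero_add] at hP'
  have hP₂ := hP'.left
  have hP'' := hP'.right
  rw [Com.length_code] at hP''
  have hP₃ := hP''.left
  have hP₄ := hP''.right
  rw [Com.length_code] at hP₄
  have hlen : program.length = readInput.len + powerLoop.len + deriveParams.len + mainPart.len := by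
    simp [program, Com.length_code]
    omega
  obtain ⟨s₁, hst₁, hpc₁, hr₁, hbd₁⟩ := Com.spec hw8 Var.loc_injective Var.loc_lt readInput
    readInput_ok 0 s₀ σ₀ hP₁ rfl hbd₀ hr₀
  rw [zero_add] at hpc₁
  obtain ⟨s₂, hst₂, hpc₂, hr₂, hbd₂⟩ := Com.spec hw8 Var.loc_injective Var.loc_lt powerLoop
    powerLoop_ok _ s₁ _ hP₂ hpc₁ hbd₁ hr₁
  obtain ⟨s₃, hst₃, hpc₃, hr₃, hbd₃⟩ := Com.spec hw8 Var.loc_injective Var.loc_lt deriveParams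
    deriveParams_ok _ s₂ _ hP₃ hpc₂ hbd₂ hr₂
  obtain ⟨s₄, hst₄, hpc₄, hr₄, hbd₄⟩ := Com.spec hw8 Var.loc_injective Var.loc_lt mainPart
    mainPart_ok _ s₃ _ hP₄ hpc₃ hbd₃ hr₃
  obtain ⟨hm₁, p₁, p₂, p₃, p₄, p₅, p₆, p₇, p₈⟩ :=
    readInput_spec (s := σ₀) (n := n) (N := N) (d := d) rfl rfl rfl hz
  have hq : ∀ u : Var, u ∉ powerLoop.writes → (powerLoop.den (2 ^ w) (readInput.den (2 ^ w) σ₀)).reg u =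
      (readInput.den (2 ^ w) σ₀).reg u := fun u hu => Com.den_reg _ _ hu _
  have h0 : ∀ u : Var, u ∉ readInput.writes → u ∉ powerLoop.writes → u ∉ deriveParams.writes →
      (deriveParams.den (2 ^ w) (powerLoop.den (2 ^ w) (readInput.den (2 ^ w) σ₀))).reg u = 0 :=
    fun u h₁ h₂ h₃ => by
      rw [Com.den_reg _ _ h₃, Com.den_reg _ _ h₂, Com.den_reg _ _ h₁]
  obtain ⟨hm₂, q₈⟩ := powerLoop_spec p₄ p₇ p₈ hz
  obtain ⟨hm₃, hp⟩ := deriveParams_spec hz ((hq _ (by decide)).trans p₁)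
    ((hq _ (by decide)).trans p₂) ((hq _ (by decide)).trans p₃) ((hq _ (by decide)).trans p₄)
    ((hq _ (by decide)).trans p₅) ((hq _ (by decide)).trans p₆) ((hq _ (by decide)).trans p₇) q₈
  have t₁ : readInput.time σ₀.reg ≤ readInput.size * bound n d := by
    refine (Nat.le_mul_of_pos_right _ hb).trans' (le_of_eq ?_)
    rfl
  have t₂ : powerLoop.time (readInput.den (2 ^ w) σ₀).reg ≤ powerLoop.size * bound n d := by
    refine (Com.time_le powerLoop_ok fun u hu => ?_).2.trans (Nat.mul_le_mul_left _ ?_)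
    · obtain rfl : u = .W := by simpa using hu
      omega
    · simp only [powerLoop, Com.weight, p₄, mul_one]
      have h₁ : 1 * 1 * base d ≤ bound n d := le_bound (Nat.one_le_pow _ _ hn)
        (Nat.one_le_pow _ _ hd) (Nat.le_self_pow (by omega) _) hd
      have h₂ := hz.base_ge'
      omega
  have t₃ : deriveParams.time (powerLoop.den (2 ^ w) (readInput.den (2 ^ w) σ₀)).reg ≤
      deriveParams.size * bound n d := by
    refine (Nat.le_mul_of_pos_right _ hb).trans' (le_of_eq ?_)
    rfl
  have t₄ := mainPart_time_le hn hd hN hp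
  obtain ⟨t, ht, hrun⟩ := ((hst₁.trans hst₂).trans hst₃).trans hst₄
  refine ⟨t, ?_, ?_⟩
  · change t ≤ timeConstant * bound n d
    unfold timeConstant
    rw [add_mul, add_mul, add_mul, add_mul]
    omega
  · have hrun' : run program w (inputMemory G N d) t = s₄ := hrun
    rw [hrun']
    refine ⟨by rw [Halted, hlen, hpc₄], ?_⟩
    rw [hr₄.2]
    have hmem : (deriveParams.den (2 ^ w) (powerLoop.den (2 ^ w) (readInput.den (2 ^ w) σ₀))).mem = m := by
      rw [hm₃, hm₂, hm₁]
    have hzero : ∀ a e, arr (3 + n * n) m a e = 0 := fun a e =>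
      inputMemory_of_le (by rw [cell]; omega)
    refine mainPart_spec hz hp hG ?_ ?_ ?_ (h0 _ (by decide) (by decide) (by decide))
      (h0 _ (by decide) (by decide) (by decide)) <;> rw [hmem]
    · exact hasInput_inputMemory
    · exact hzero 1
    · exact hzero 2

theorem computable_bound (c : ℕ) : Computable fun d : ℕ =>
    c * (d ^ (2 * d + 3) * (4 * d * (2 * d + 2)) ^ (4 * d + 4)) := by
  have hpow : Primrec₂ fun a b : ℕ => a ^ b := Primrec₂.unpaired'.1 Nat.Primrec.pow
  have hmul := Primrec.nat_mul
  have hadd := Primrec.nat_add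
  have hlin : ∀ a b : ℕ, Primrec fun d : ℕ => a * d + b := fun a b =>
    hadd.comp (hmul.comp (Primrec.const a) Primrec.id) (Primrec.const b)
  have h4 : Primrec fun d : ℕ => 4 * d := hmul.comp (Primrec.const 4) Primrec.id
  exact (hmul.comp (Primrec.const c) (hmul.comp (hpow.comp Primrec.id (hlin 2 3))
    (hpow.comp (hmul.comp h4 (hlin 2 2)) (hlin 4 4)))).to_comp

end CycleEmbedding

theorem theorem3 :
    (∃ (P : WordRAM.Program) (c : ℕ),
      SolvesCycleEmbedding P
        (fun n d => c * (n ^ 3 * d ^ (2 * d + 3) * (4 * d * (2 * d + 2)) ^ (4 * d + 4)))) ∧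
    CycleEmbeddingFPT := by
  refine ⟨⟨_, _, CycleEmbedding.program_solves⟩, CycleEmbedding.program, _, 3,
    CycleEmbedding.computable_bound CycleEmbedding.timeConstant, ?_⟩
  convert CycleEmbedding.program_solves using 3
  ring
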